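/- For an integer $m\ge 1$ let $K=\mathbb{Q}(\zeta_m)$, with ring of integers $\mathcal{O}_K$ and discriminant $d_K$, and let $K_{\mathbb R}=K\otimes_{\mathbb Q}\mathbb{R}$ be the Euclidean space of dimension $\varphi(m)$ with scalar product induced by the trace form $\mathrm{Tr}(x\overline{y})$. Equip $E_m=K_{\mathbb R}^2$, of dimension $n=2\varphi(m)$, with the sum scalar product. For a Euclidean space $E$ of dimension $n$ and a lattice $\Lambda\subset E$ (a discrete subgroup spanning $E$), let $\Lambda^\#=\{x\in E:\langle x,y\rangle\in\mathbb{Z}\text{ for all }y\in\Lambda\}$ be the dual lattice, let $\mu$ be the least norm of a nonzero vector of $\Lambda$, and let $\Delta(\Lambda)=\mathrm{Vol}(B(\mu))/(2^n\,\mathrm{Vol}(\Lambda))$ be the packing density, where $B(\mu)$ is the closed ball of radius $\mu$ and $\mathrm{Vol}(\Lambda)$ is the covolume. The lattice $\Lambda$ is called symplectic if there is an isometry $\sigma$ of $E$ with $\sigma(\Lambda)=\Lambda^\#$ and $\sigma^2=-\mathrm{Id}$. Let $\mathfrak{P}$ be a prime ideal of $\mathcal{O}_K$ lying over a prime number that does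 not divide $m$, let $F=\mathcal{O}_K/\mathfrak{P}$ and $q=|F|$. Put $\alpha=(q|d_K|)^{1/(2\varphi(m))}$ and $$\Lambda_0=\alpha^{-1}\mathcal{O}_K\times\alpha\,\mathfrak{P}^{-1}\mathcal{O}_K^\#\subset E_m ,$$ where $\mathcal{O}_K^\#$ is the dual of $\mathcal{O}_K$ for the trace form, and let $\pi:\Lambda_0\to\Lambda_0/\mathfrak{P}\Lambda_0$ be the canonical surjection onto this $F$-vector space. Let $\mathcal{L}_{\mathcal C}(m,\mathfrak{P})$ be the family of all $\Lambda_C=\pi^{-1}(C)$, where $C$ runs through the one-dimensional $F$-subspaces of $\Lambda_0/\mathfrak{P}\Lambda_0$. **Corollary.** There are choices, for every $m\ge1$, of a prime ideal $\mathfrak{P}_m$ of the ring of integers of $\mathbb{Q}(\zeta_m)$ lying over a prime number that does not divide $m$, such that the cardinalities $q_m$ of the residue fields satisfy $\varphi(m)^2m=o\big(q_m^{1/\varphi(m)}\big)$ as $m\to\infty$. For every such choice there are infinitely many dimensions $n$ for which there is $m\ge 1$ with $n=2\varphi(m)=\dim E_m$ such that the family $\mathcal{L}_{\mathcal C}(m,\mathfrak{P}_m)$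 contains a symplectic lattice $\Lambda$ with $$\Delta(\Lambda)\ \ge\ \frac{0.89\,n\log\log n}{2^n}.$$ -/

import Mathlib

open scoped NumberField Pointwise

/-! ### Lattices in Euclidean spaces -/

section Lattices

variable {E : Type*} [NormedAddCommGroup E] [InnerProductSpace ℝ E] [FiniteDimensional ℝ E]

/-- A lattice: a discrete subgroup of `E` spanning `E` over `ℝ`. -/
def IsEuclideanLattice (L : Submodule ℤ E) : Prop :=
  DiscreteTopology L ∧ Submodule.span ℝ (L : Set E) = ⊤

/-- The dual lattice `L^# = {x | ∀ y ∈ L, ⟨x, y⟩ ∈ ℤ}`. -/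
def dualLattice (L : Submodule ℤ E) : Submodule ℤ E where
  carrier := {x | ∀ y ∈ L, ∃ k : ℤ, inner ℝ x y = (k : ℝ)}
  zero_mem' := fun y _ => ⟨0, by simp⟩
  add_mem' := by
    intro a b ha hb y hy
    obtain ⟨k, hk⟩ := ha y hy
    obtain ⟨l, hl⟩ := hb y hy
    exact ⟨k + l, by rw [inner_add_left, hk, hl]; push_cast; rfl⟩
  smul_mem' := by
    intro c a ha y hy
    obtain ⟨k, hk⟩ := ha y hy
    refine ⟨c * k, ?_⟩
    rw [← Int.cast_smul_eq_zsmul ℝ c a, real_inner_smul_left, hk]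
    push_cast
    rfl

/-- A symplectic lattice: there is an isometry `σ` of `E` with `σ(L) = L^#` and `σ² = -Id`. -/
def IsSymplecticLattice (L : Submodule ℤ E) : Prop :=
  IsEuclideanLattice L ∧
    ∃ σ : E ≃ₗᵢ[ℝ] E, σ '' (L : Set E) = (dualLattice L : Set E) ∧ ∀ x, σ (σ x) = -x

/-- The minimum `μ` of a lattice: the least norm of a nonzero vector. -/
noncomputable def latticeMinimum (L : Submodule ℤ E) : ℝ :=
  sInf {r : ℝ | ∃ x ∈ L, x ≠ 0 ∧ ‖x‖ = r}

/-- The packing density `Δ(L) = Vol(B(μ)) / (2^n Vol(L))`, where `n = dim E`. -/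
noncomputable def packingDensity [MeasurableSpace E] [BorelSpace E] (L : Submodule ℤ E) : ℝ :=
  MeasureTheory.volume.real (Metric.closedBall (0 : E) (latticeMinimum L)) /
    (2 ^ Module.finrank ℝ E * ZLattice.covolume L)

end Lattices

/-! ### The Euclidean space `K_ℝ` and the plane `K_ℝ²` -/

section Minkowski

variable (K : Type*) [Field K] [NumberField K]

/-- The real subspace of `∏_φ ℂ`, where `φ` runs through the embeddings `K → ℂ`, of the families
`(x_φ)` satisfying `x_{conj φ} = conj x_φ`. -/
noncomputable def minkowskiSubspace : Submodule ℝ (PiLp 2 (fun _ : K →+* ℂ => ℂ)) where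
  carrier := {x | ∀ φ : K →+* ℂ,
    x (NumberField.ComplexEmbedding.conjugate φ) = starRingEnd ℂ (x φ)}
  zero_mem' := fun φ => by simp
  add_mem' := by
    intro a b ha hb φ
    simp [ha φ, hb φ]
  smul_mem' := by
    intro c a ha φ
    simp [ha φ]

/-- The Euclidean space `K_ℝ = K ⊗ ℝ`, realized as the space of families `(x_φ)` of complex
numbers indexed by the embeddings `φ : K → ℂ` and satisfying `x_{conj φ} = conj x_φ`. Its scalar
product is `∑_φ x_φ * conj y_φ`, that is, the trace form `Tr(x ȳ)`. -/
def MinkowskiSpace : Type _ := minkowskiSubspace K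

noncomputable instance : NormedAddCommGroup (MinkowskiSpace K) :=
  inferInstanceAs (NormedAddCommGroup (minkowskiSubspace K))

noncomputable instance : InnerProductSpace ℝ (MinkowskiSpace K) :=
  inferInstanceAs (InnerProductSpace ℝ (minkowskiSubspace K))

instance : FiniteDimensional ℝ (MinkowskiSpace K) :=
  inferInstanceAs (FiniteDimensional ℝ (minkowskiSubspace K))

noncomputable instance : MeasurableSpace (MinkowskiSpace K) := borel _

instance : BorelSpace (MinkowskiSpace K) := ⟨rfl⟩

variable {K} in
/-- The coordinate `x_φ` of an element of `K_ℝ`. -/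
def MinkowskiSpace.coord (x : MinkowskiSpace K) (φ : K →+* ℂ) : ℂ := x.1 φ

@[ext]
theorem MinkowskiSpace.ext {K : Type*} [Field K] {x y : MinkowskiSpace K}
    (h : ∀ φ, x.coord φ = y.coord φ) : x = y :=
  Subtype.ext (PiLp.ext h)

theorem MinkowskiSpace.inner_eq (x y : MinkowskiSpace K) :
    ((inner ℝ x y : ℝ) : ℂ) = ∑ φ, x.coord φ * starRingEnd ℂ (y.coord φ) := by
  have h1 : (inner ℝ x y : ℝ) = ∑ φ : K →+* ℂ, inner ℝ (x.coord φ) (y.coord φ) := by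
    change (inner ℝ x.1 y.1 : ℝ) = _
    rw [PiLp.inner_apply]
    rfl
  have h2 : (inner ℝ x y : ℝ) = (∑ φ, x.coord φ * starRingEnd ℂ (y.coord φ)).re := by
    rw [h1, Complex.re_sum]
    refine Finset.sum_congr rfl fun φ _ => ?_
    simp only [Complex.inner, Complex.mul_re, Complex.conj_re, Complex.conj_im]
    ring
  rw [h2]
  refine Complex.conj_eq_iff_re.mp ?_
  rw [map_sum,
    ← Equiv.sum_comp (NumberField.ComplexEmbedding.involutive_conjugate K).toPerm]
  refine Finset.sum_congr rfl fun φ _ => ?_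
  have hx := x.2 φ
  have hy := y.2 φ
  change x.coord _ = _ at hx
  change y.coord _ = _ at hy
  simp only [Function.Involutive.coe_toPerm, map_mul, hx, hy, Complex.conj_conj]
  rfl

/-- Multiplication by algebraic integers on `K_ℝ`. -/
noncomputable instance : Module (𝓞 K) (MinkowskiSpace K) where
  smul a x := ⟨WithLp.toLp 2 (fun φ => φ (a : K) * x.1 φ), fun φ => by
    simp [x.2 φ]⟩
  one_smul x := by
    ext φ
    change φ ((1 : 𝓞 K) : K) * x.1 φ = x.1 φ
    simp
  mul_smul a b x := by
    ext φ
    change φ ((a * b : 𝓞 K) : K) * x.1 φ = φ (a : K) * (φ (b : K) * x.1 φ)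
    simp [mul_assoc]
  smul_zero a := by
    ext φ
    change φ (a : K) * (0 : ℂ) = 0
    simp
  smul_add a x y := by
    ext φ
    change φ (a : K) * (x.1 φ + y.1 φ) = φ (a : K) * x.1 φ + φ (a : K) * y.1 φ
    ring
  add_smul a b x := by
    ext φ
    change φ ((a + b : 𝓞 K) : K) * x.1 φ = φ (a : K) * x.1 φ + φ (b : K) * x.1 φ
    simp [add_mul]
  zero_smul x := by
    ext φ
    change φ ((0 : 𝓞 K) : K) * x.1 φ = 0
    simp

instance : SMulCommClass ℝ (𝓞 K) (MinkowskiSpace K) where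
  smul_comm r a x := by
    ext φ
    change (r : ℝ) • (φ (a : K) * x.1 φ) = φ (a : K) * (r • x.1 φ)
    exact (mul_smul_comm r _ _).symm

/-- The natural embedding `K → K_ℝ`, `x ↦ (φ(x))_φ`. -/
noncomputable def toMinkowski : K →ₗ[𝓞 K] MinkowskiSpace K where
  toFun x := ⟨WithLp.toLp 2 (fun φ => φ x), fun φ => by simp⟩
  map_add' x y := by
    ext φ
    change φ (x + y) = φ x + φ y
    simp
  map_smul' a x := by
    ext φ
    change φ (a • x) = φ (a : K) * φ x
    rw [Algebra.smul_def, map_mul]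

/-- The image in `K_ℝ` of a fractional ideal of `K`. -/
noncomputable def idealLattice (I : FractionalIdeal (nonZeroDivisors (𝓞 K)) K) :
    Submodule (𝓞 K) (MinkowskiSpace K) :=
  (I : Submodule (𝓞 K) K).map (toMinkowski K)

/-- The scalar product of `K_ℝ` is the trace form `Tr(x ȳ)`. -/
theorem inner_toMinkowski (c : K ≃ₐ[ℚ] K) (hc : ∀ (φ : K →+* ℂ) x, φ (c x) = starRingEnd ℂ (φ x))
    (x y : K) :
    inner ℝ (toMinkowski K x) (toMinkowski K y) = ((Algebra.trace ℚ K (x * c y) : ℚ) : ℝ) := by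
  have h1 := MinkowskiSpace.inner_eq K (toMinkowski K x) (toMinkowski K y)
  have h2 := trace_eq_sum_embeddings (K := ℚ) (L := K) ℂ (x := x * c y)
  rw [← (RingHom.equivRatAlgHom K ℂ).sum_comp] at h2
  have h3 : ((inner ℝ (toMinkowski K x) (toMinkowski K y) : ℝ) : ℂ) =
      (((Algebra.trace ℚ K (x * c y) : ℚ) : ℝ) : ℂ) := by
    rw [h1]
    rw [eq_ratCast] at h2
    rw [Complex.ofReal_ratCast]
    refine Eq.trans ?_ h2.symm
    refine Finset.sum_congr rfl fun φ _ => ?_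
    change φ x * starRingEnd ℂ (φ y) = φ (x * c y)
    rw [map_mul, hc]
  exact_mod_cast h3

/-- Complex conjugation on an abelian number field. -/
theorem exists_conj_of_isAbelianGalois [IsAbelianGalois ℚ K] :
    ∃ c : K ≃ₐ[ℚ] K, ∀ (φ : K →+* ℂ) x, φ (c x) = starRingEnd ℂ (φ x) := by
  let φ₀ : K →+* ℂ := Classical.choice inferInstance
  obtain ⟨σ, hσ⟩ := NumberField.ComplexEmbedding.exists_comp_symm_eq_of_comp_eq (k := ℚ) φ₀
    (NumberField.ComplexEmbedding.conjugate φ₀) (by ext; simp)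
  refine ⟨σ.symm, fun φ x => ?_⟩
  obtain ⟨ν, rfl⟩ := NumberField.ComplexEmbedding.exists_comp_symm_eq_of_comp_eq (k := ℚ) φ₀ φ
    (by ext; simp)
  have h1 : ν.symm (σ.symm x) = σ.symm (ν.symm x) :=
    DFunLike.congr_fun (mul_comm' (ν.symm : Gal(K/ℚ)) σ.symm) x
  have h2 := RingHom.congr_fun hσ (ν.symm x)
  change φ₀ (ν.symm (σ.symm x)) = starRingEnd ℂ (φ₀ (ν.symm x))
  rw [h1]
  exact h2

/-- For an abelian number field, the dual lattice of `𝓞_K` in `K_ℝ` is the image of the fractional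
ideal of all `x ∈ K` with `Tr(x y) ∈ ℤ` for every `y ∈ 𝓞_K`. -/
theorem dualLattice_idealLattice_one [IsAbelianGalois ℚ K] :
    (dualLattice ((idealLattice K 1).restrictScalars ℤ) : Set (MinkowskiSpace K)) =
      idealLattice K (FractionalIdeal.dual ℤ ℚ 1) := by
  obtain ⟨c, hc⟩ := exists_conj_of_isAbelianGalois K
  have hint : ∀ x : K, toMinkowski K x ∈ dualLattice ((idealLattice K 1).restrictScalars ℤ) ↔
      x ∈ (FractionalIdeal.dual ℤ ℚ 1 : FractionalIdeal (nonZeroDivisors (𝓞 K)) K) := by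
    intro x
    rw [FractionalIdeal.mem_dual
      (one_ne_zero : (1 : FractionalIdeal (nonZeroDivisors (𝓞 K)) K) ≠ 0)]
    constructor
    · intro h a ha
      obtain ⟨a, rfl⟩ := (FractionalIdeal.mem_one_iff _).mp ha
      obtain ⟨k, hk⟩ := h (toMinkowski K (c.symm a)) ⟨_, (FractionalIdeal.mem_one_iff _).mpr
        ⟨⟨c.symm a, a.2.map c.symm⟩, rfl⟩, rfl⟩
      rw [inner_toMinkowski K c hc, AlgEquiv.apply_symm_apply] at hk
      exact ⟨k, by rw [Algebra.traceForm_apply]; exact_mod_cast hk.symm⟩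
    · rintro h _ ⟨a, ha, rfl⟩
      obtain ⟨a, rfl⟩ := (FractionalIdeal.mem_one_iff _).mp ha
      obtain ⟨k, hk⟩ := h (c a) ((FractionalIdeal.mem_one_iff _).mpr ⟨⟨c a, a.2.map c⟩, rfl⟩)
      refine ⟨k, ?_⟩
      rw [inner_toMinkowski K c hc]
      rw [Algebra.traceForm_apply] at hk
      exact_mod_cast hk.symm
  ext v
  constructor
  · intro hv
    choose n hn using fun i => hv (toMinkowski K (NumberField.integralBasis K i))
      ⟨_, (FractionalIdeal.mem_one_iff _).mpr ⟨NumberField.RingOfIntegers.basis K i,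
        (NumberField.integralBasis_apply K i).symm⟩, rfl⟩
    let ℓ : K →ₗ[ℚ] ℚ := (NumberField.integralBasis K).constr ℚ fun i => (n i : ℚ)
    let y₀ : K := ((Algebra.traceForm ℚ K).toDual (traceForm_nondegenerate ℚ K)).symm ℓ
    have hy₀ : ∀ x, Algebra.trace ℚ K (y₀ * x) = ℓ x := fun x => by
      rw [← Algebra.traceForm_apply]
      exact LinearMap.BilinForm.apply_toDual_symm_apply (hB := traceForm_nondegenerate ℚ K) ℓ x
    let f : K →ₗ[ℚ] ℝ := ((innerₛₗ ℝ (v - toMinkowski K (c y₀))).toAddMonoidHom.comp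
      (toMinkowski K).toAddMonoidHom).toRatLinearMap
    have hf : f = 0 := (NumberField.integralBasis K).ext fun i => by
      change inner ℝ (v - toMinkowski K (c y₀)) (toMinkowski K _) = (0 : ℝ)
      rw [inner_sub_left, hn, inner_toMinkowski K c hc, ← map_mul, Algebra.trace_eq_of_algEquiv,
        hy₀, Module.Basis.constr_basis]
      simp
    have hu : v = toMinkowski K (c y₀) := by
      have hinj : Function.Injective fun φ : K →+* ℂ =>
          ((NumberField.ComplexEmbedding.conjugate φ : K →+* ℂ) : K →* ℂ) := fun φ ψ h =>
        (NumberField.ComplexEmbedding.involutive_conjugate K).injective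
          (RingHom.ext fun x => DFunLike.congr_fun h x)
      have hli := Fintype.linearIndependent_iff.mp
        ((linearIndependent_monoidHom K ℂ).comp _ hinj)
        (fun φ => (v - toMinkowski K (c y₀)).coord φ) (by
          ext x
          have h1 := MinkowskiSpace.inner_eq K (v - toMinkowski K (c y₀)) (toMinkowski K x)
          have h2 : inner ℝ (v - toMinkowski K (c y₀)) (toMinkowski K x) = (0 : ℝ) :=
            LinearMap.congr_fun hf x
          rw [h2] at h1
          rw [Finset.sum_apply]
          exact h1.symm)
      refine sub_eq_zero.mp (MinkowskiSpace.ext hli)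
    exact ⟨c y₀, (hint _).mp (hu ▸ hv), hu.symm⟩
  · rintro ⟨x, hx, rfl⟩
    exact (hint x).mpr hx

/-- The Euclidean space `K_ℝ²`, with scalar product `⟨x₁, y₁⟩ + ⟨x₂, y₂⟩`. -/
abbrev MinkowskiPlane : Type _ := WithLp 2 (MinkowskiSpace K × MinkowskiSpace K)

end Minkowski

/-! ### The lattices constructed from lines over the residue field -/

section Codes

variable {K : Type*} [Field K] [NumberField K]

/-- `α = (q |d_K|)^(1 / (2 [K : ℚ]))`, where `q` is the cardinality of `𝓞 K ⧸ P` and `d_K` is the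
discriminant of `K`. -/
noncomputable def scalingFactor (P : Ideal (𝓞 K)) : ℝ :=
  ((Nat.card (𝓞 K ⧸ P) : ℝ) * |(NumberField.discr K : ℝ)|) ^
    (1 / (2 * (Module.finrank ℚ K : ℝ)))

/-- `Λ₀ = α⁻¹ 𝓞_K × α P⁻¹ 𝓞_K^#`, an `𝓞_K`-submodule of `K_ℝ²`. Here `𝓞_K^#` is the fractional
ideal of all `x ∈ K` with `Tr(x y) ∈ ℤ` for every `y ∈ 𝓞_K`. -/
noncomputable def baseLattice (P : Ideal (𝓞 K)) : Submodule (𝓞 K) (MinkowskiPlane K) :=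
  ((((scalingFactor P)⁻¹ • idealLattice K 1 : Submodule (𝓞 K) (MinkowskiSpace K))).prod
    (scalingFactor P • idealLattice K
      ((P : FractionalIdeal (nonZeroDivisors (𝓞 K)) K)⁻¹ *
        FractionalIdeal.dual ℤ ℚ 1))).comap
    (WithLp.linearEquiv 2 (𝓞 K) (MinkowskiSpace K × MinkowskiSpace K)).toLinearMap

/-- The quotient `Λ₀ / P Λ₀`, a vector space over the residue field `𝓞 K ⧸ P`. -/
abbrev CodeSpace (P : Ideal (𝓞 K)) : Type _ :=
  baseLattice P ⧸ (P • ⊤ : Submodule (𝓞 K) (baseLattice P))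

/-- `Λ_C`, the preimage in `Λ₀` of a subspace `C` of `Λ₀ / P Λ₀`, as a subgroup of `K_ℝ²`. -/
noncomputable def codeLattice (P : Ideal (𝓞 K)) (C : Submodule (𝓞 K ⧸ P) (CodeSpace P)) :
    Submodule ℤ (MinkowskiPlane K) :=
  AddSubgroup.toIntSubmodule
    ((C.toAddSubgroup.comap
      (Submodule.mkQ (P • ⊤ : Submodule (𝓞 K) (baseLattice P))).toAddMonoidHom).map
        (baseLattice P).subtype.toAddMonoidHom)

/-- The family of the lattices `Λ_C`, where `C` runs through the lines of `Λ₀ / P Λ₀`. -/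
def codeLatticeFamily (P : Ideal (𝓞 K)) : Set (Submodule ℤ (MinkowskiPlane K)) :=
  {L | ∃ C : Submodule (𝓞 K ⧸ P) (CodeSpace P),
    Module.finrank (𝓞 K ⧸ P) C = 1 ∧ L = codeLattice P C}

end Codes

/-- A choice, for every `m ≥ 1`, of a prime ideal `P m` of the ring of integers of `ℚ(ζ_m)`, lying
over a prime number that does not divide `m`, such that the cardinalities `q_m` of the residue
fields satisfy `φ(m)² m = o(q_m^(1/φ(m)))` as `m → ∞`. -/
def IsAdmissiblePrimeChoice (P : (m : ℕ+) → Ideal (𝓞 (CyclotomicField (m : ℕ) ℚ))) : Prop :=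
  (∀ m : ℕ+, (P m).IsPrime ∧ ∃ p : ℕ, p.Prime ∧ ¬ p ∣ (m : ℕ) ∧
    (P m).LiesOver (Ideal.span {(p : ℤ)})) ∧
  (fun m : ℕ+ => ((m : ℕ).totient : ℝ) ^ 2 * ((m : ℕ) : ℝ)) =o[Filter.atTop]
    (fun m : ℕ+ => (Nat.card (𝓞 (CyclotomicField (m : ℕ) ℚ) ⧸ P m) : ℝ) ^
      (1 / ((m : ℕ).totient : ℝ)))

/-! The proof averages over the q + 1 lines C. The map σ(x₁, x₂) = (-conj x₂, conj x₁) is an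
isometry with σ² = -Id, and ⟨σx, y⟩ is the trace of the determinant x₁y₂ - x₂y₁, the scalings α⁻¹
and α cancelling. Modulo P this determinant is a nondegenerate alternating form on the plane Λ₀/PΛ₀,
for which every line is its own orthogonal. Hence σ(Λ_C) = Λ_C^# for every C
(`planeRotation_codeLattice`): all Λ_C are symplectic, so of covolume 1
(`covolume_eq_one_of_symplectic`), and Λ₀, which contains Λ_C with index q, has covolume 1/q.

Let B(r) be a ball of volume T. A vector of Λ₀ outside PΛ₀ lies in at most one Λ_C. The nonzero
vectors of PΛ₀ have norm at least r, by the inequality between arithmetic and geometric means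
applied to the conjugates (`card_div_discr_le`). Each Λ_C is stable under the m-th roots of unity,
so its nonzero vectors of given norm come in orbits of size m. If every Λ_C had a nonzero vector
shorter than r, then Λ₀ would have at least (q + 1)m vectors of norm at most r
(`exists_codeLattice_of_card_lt`). It has at most q Vol(B(r + τ)) of them, where τ bounds its
covering radius (`card_mul_covolume_le`). Minkowski's theorem on convex bodies and the growth of q
make τ so small that Vol(B(r + τ)) ≤ m as soon as T is slightly below m. So some Λ_C has density at
least T/2^n (`exists_symplectic_packingDensity_ge`).

It remains to find m with m/φ(m) large. For primorials, Mertens' third theorem gives m/φ(m) ~ e^γ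
log log m, and e^γ = 1.781... exceeds 2 · 0.89 = 1.78. A lower bound for arbitrarily large
primorials suffices. It is obtained from the pole of ζ at 1 by comparing Laplace transforms
(`mertens_frequently`). -/

/-! ### Mertens' third theorem and integers with large m/φ(m) -/

section Mertens

open MeasureTheory ProbabilityTheory Filter Topology

theorem expMeasure_Ioi {δ : ℝ} (hδ : 0 < δ) {x : ℝ} (hx : 0 ≤ x) :
    expMeasure δ (Set.Ioi x) = ENNReal.ofReal (Real.exp (-(δ * x))) := by
  have := isProbabilityMeasure_expMeasure hδ
  rw [← Set.compl_Iic, prob_compl_eq_one_sub measurableSet_Iic, ← ofReal_cdf,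
    cdf_expMeasure_eq hδ, if_pos hx, ← ENNReal.ofReal_one, ← ENNReal.ofReal_sub]
  · congr 1; ring
  · have : Real.exp (-(δ * x)) ≤ 1 := Real.exp_le_one_iff.mpr (by have := mul_nonneg hδ.le hx; linarith)
    linarith

/-- Comparison of the Laplace transforms of two step functions, the second one being the
harmonic step function. -/
theorem laplace_comparison {ι : Type*} (s : Finset ι) (a x : ι → ℝ) (ha : ∀ i, 0 ≤ a i)
    (hx : ∀ i, 0 ≤ x i) {η C w δ : ℝ} (hη : 0 ≤ η) (hC : 0 ≤ C) (hw : 0 ≤ w) (hδ : 0 < δ)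
    (h : ∀ u : ℝ, 0 < u → (∑ i ∈ s with x i < u, a i) + (if w < u then η else 0) ≤
      (harmonic (⌈u⌉₊ - 1) : ℝ) + (if w < u then 0 else C)) :
    (∑ i ∈ s, a i * Real.exp (-(δ * x i))) + η * Real.exp (-(δ * w)) ≤
      -Real.log (1 - Real.exp (-δ)) + C * (1 - Real.exp (-(δ * w))) := by
  have hprob := isProbabilityMeasure_expMeasure hδ
  -- The hypothesis is integrated in u against the exponential law δe^{-δu}du, under which a step at
  -- x has integral e^{-δx}. Extended nonnegative integrals avoid any integrability question.
  have hpt : ∀ᵐ u ∂(expMeasure δ),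
      (∑ i ∈ s, (Set.Ioi (x i)).indicator (fun _ => ENNReal.ofReal (a i)) u) +
        (Set.Ioi w).indicator (fun _ => ENNReal.ofReal η) u ≤
      (∑' k : ℕ, (Set.Ioi ((k : ℝ) + 1)).indicator
        (fun _ => ENNReal.ofReal (1 / ((k : ℝ) + 1))) u) +
        (Set.Iic w).indicator (fun _ => ENNReal.ofReal C) u := by
    have hpos : ∀ᵐ u ∂(expMeasure δ), u ∈ Set.Ioi (0 : ℝ) := by
      have h0 : expMeasure δ (Set.Iic 0) = 0 := by
        rw [← ofReal_cdf, cdf_expMeasure_eq hδ]; simp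
      rw [ae_iff]
      simpa [Set.Iic] using h0
    filter_upwards [hpos] with u hu
    have hu' : 0 < u := hu
    have h1 := h u hu'
    have hL : (∑ i ∈ s, (Set.Ioi (x i)).indicator (fun _ => ENNReal.ofReal (a i)) u) +
        (Set.Ioi w).indicator (fun _ => ENNReal.ofReal η) u =
        ENNReal.ofReal ((∑ i ∈ s with x i < u, a i) + (if w < u then η else 0)) := by
      rw [ENNReal.ofReal_add (Finset.sum_nonneg fun i _ => ha i) (by split_ifs <;> simp [hη]),
        ENNReal.ofReal_sum_of_nonneg fun i _ => ha i, Finset.sum_filter]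
      congr 1
      simp only [Set.indicator, Set.mem_Ioi]
      split_ifs <;> simp
    have hR : ENNReal.ofReal ((harmonic (⌈u⌉₊ - 1) : ℝ) + (if w < u then 0 else C)) ≤
        (∑' k : ℕ, (Set.Ioi ((k : ℝ) + 1)).indicator
        (fun _ => ENNReal.ofReal (1 / ((k : ℝ) + 1))) u) +
        (Set.Iic w).indicator (fun _ => ENNReal.ofReal C) u := by
      -- The index ⌈u⌉ - 1 makes this the sum of 1/k over the integers k ≥ 1 with k < u strictly,
      -- matching the strict steps x i < u on the left.
      have hcast : (harmonic (⌈u⌉₊ - 1) : ℝ) =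
          ∑ k ∈ Finset.range (⌈u⌉₊ - 1), 1 / ((k : ℝ) + 1) := by
        simp [harmonic]
      rw [hcast, ENNReal.ofReal_add (Finset.sum_nonneg fun i _ => by positivity)
        (by split_ifs <;> simp [hC]), ENNReal.ofReal_sum_of_nonneg fun i _ => by positivity]
      refine add_le_add ?_ (le_of_eq ?_)
      · refine le_trans (le_of_eq (Finset.sum_congr rfl fun k hk => ?_)) (ENNReal.sum_le_tsum _)
        rw [Set.indicator_of_mem]
        rw [Finset.mem_range] at hk
        have : k + 1 < ⌈u⌉₊ := by omega
        have := Nat.lt_ceil.mp this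
        push_cast at this
        exact this
      · simp only [Set.indicator, Set.mem_Iic]
        by_cases hwu : w < u
        · simp [hwu]
        · simp [hwu, not_lt.mp hwu]
    rw [hL]
    exact (ENNReal.ofReal_le_ofReal h1).trans hR
  have hint := lintegral_mono_ae hpt
  rw [lintegral_add_right _ (measurable_const.indicator measurableSet_Ioi),
    lintegral_add_right _ (measurable_const.indicator measurableSet_Iic),
    lintegral_finsetSum _ (fun i _ => measurable_const.indicator measurableSet_Ioi),
    lintegral_tsum (fun i => (measurable_const.indicator measurableSet_Ioi).aemeasurable)] at hint
  simp only [lintegral_indicator_const measurableSet_Ioi,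
    lintegral_indicator_const measurableSet_Iic] at hint
  have hIic : expMeasure δ (Set.Iic w) = ENNReal.ofReal (1 - Real.exp (-(δ * w))) := by
    rw [← ofReal_cdf, cdf_expMeasure_eq hδ, if_pos hw]
  have hle1 : Real.exp (-(δ * w)) ≤ 1 :=
    Real.exp_le_one_iff.mpr (by have := mul_nonneg hδ.le hw; linarith)
  have hlog : HasSum (fun k : ℕ => 1 / ((k : ℝ) + 1) * Real.exp (-(δ * ((k : ℝ) + 1))))
      (-Real.log (1 - Real.exp (-δ))) := by
    have hlt : |Real.exp (-δ)| < 1 := by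
      rw [abs_of_pos (Real.exp_pos _)]
      exact Real.exp_lt_one_iff.mpr (by linarith)
    convert Real.hasSum_pow_div_log_of_abs_lt_one hlt using 2 with k
    rw [← Real.exp_nat_mul]
    push_cast
    rw [show ((k : ℝ) + 1) * -δ = -(δ * (k + 1)) by ring]
    ring
  have hsum : ∑' k : ℕ, ENNReal.ofReal (1 / ((k : ℝ) + 1)) *
      expMeasure δ (Set.Ioi ((k : ℝ) + 1)) =
      ENNReal.ofReal (-Real.log (1 - Real.exp (-δ))) := by
    rw [← hlog.tsum_eq, ENNReal.ofReal_tsum_of_nonneg (fun k => by positivity) hlog.summable]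
    refine tsum_congr fun k => ?_
    rw [expMeasure_Ioi hδ (by positivity), ← ENNReal.ofReal_mul (by positivity)]
  rw [hsum, hIic, expMeasure_Ioi hδ hw, ← ENNReal.ofReal_mul hη, ← ENNReal.ofReal_mul hC,
    Finset.sum_congr rfl (fun i _ => by
      rw [expMeasure_Ioi hδ (hx i), ← ENNReal.ofReal_mul (ha i)]),
    ← ENNReal.ofReal_sum_of_nonneg (fun i _ => mul_nonneg (ha i) (Real.exp_pos _).le),
    ← ENNReal.ofReal_add (Finset.sum_nonneg fun i _ => mul_nonneg (ha i) (Real.exp_pos _).le)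
      (mul_nonneg hη (Real.exp_pos _).le),
    ← ENNReal.ofReal_add (hlog.tsum_eq ▸ tsum_nonneg fun k => by positivity)
      (mul_nonneg hC (by linarith))] at hint
  refine (ENNReal.ofReal_le_ofReal_iff (add_nonneg
    (hlog.tsum_eq ▸ tsum_nonneg fun k => by positivity) (mul_nonneg hC (by linarith)))).mp hint

/-- Concavity of log between 1 - x and 1. With x = 1/p and y = p^{-δ} it bounds the logarithm of an
Euler factor at 1 + δ by p^{-δ} times the one at 1, so that log ζ(1 + δ) is dominated by a Laplace
transform. -/
theorem neg_log_one_sub_mul_le {x y : ℝ} (hx : x < 1) (hy0 : 0 ≤ y) (hy : y ≤ 1) :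
    -Real.log (1 - x * y) ≤ y * -Real.log (1 - x) := by
  have h := strictConcaveOn_log_Ioi.concaveOn.2 (x := 1 - x) (y := 1) (by simpa using hx)
    (by simp) hy0 (by linarith : 0 ≤ 1 - y) (by ring)
  simp only [smul_eq_mul, Real.log_one, mul_zero, add_zero, mul_one] at h
  rw [show y * (1 - x) + (1 - y) = 1 - x * y by ring] at h
  linarith

theorem tendsto_log_zeta_euler {δ : ℝ} (hδ : 0 < δ) :
    Tendsto (fun n : ℕ => ∑ p ∈ n.primesBelow, -Real.log (1 - (p : ℝ) ^ (-(1 + δ)))) atTop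
      (𝓝 (Real.log ‖riemannZeta ((1 + δ : ℝ) : ℂ)‖)) := by
  have hs : 1 < ((1 + δ : ℝ) : ℂ).re := by simp [hδ]
  have h1 := (riemannZeta_eulerProduct hs).norm
  have h2 := h1.log (norm_ne_zero_iff.mpr (riemannZeta_ne_zero_of_one_lt_re hs))
  refine h2.congr fun n => ?_
  rw [norm_prod, Real.log_prod]
  · refine Finset.sum_congr rfl fun p hp => ?_
    have hp' := (Nat.prime_of_mem_primesBelow hp)
    have h3 : (1 - (p : ℂ) ^ (-((1 + δ : ℝ) : ℂ))) = ((1 - (p : ℝ) ^ (-(1 + δ)) : ℝ) : ℂ) := by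
      rw [Complex.ofReal_sub, Complex.ofReal_one, Complex.ofReal_cpow (by positivity)]
      push_cast
      rfl
    have h4 : (p : ℝ) ^ (-(1 + δ)) < 1 :=
      Real.rpow_lt_one_of_one_lt_of_neg (by exact_mod_cast hp'.one_lt) (by linarith)
    rw [h3, norm_inv, Complex.norm_real, Real.norm_of_nonneg (by linarith), Real.log_inv]
  · intro p hp
    have hp' := (Nat.prime_of_mem_primesBelow hp)
    have h4 : (p : ℝ) ^ (-(1 + δ)) < 1 :=
      Real.rpow_lt_one_of_one_lt_of_neg (by exact_mod_cast hp'.one_lt) (by linarith)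
    rw [norm_ne_zero_iff]
    refine inv_ne_zero ?_
    have h3 : (1 - (p : ℂ) ^ (-((1 + δ : ℝ) : ℂ))) = ((1 - (p : ℝ) ^ (-(1 + δ)) : ℝ) : ℂ) := by
      rw [Complex.ofReal_sub, Complex.ofReal_one, Complex.ofReal_cpow (by positivity)]
      push_cast
      rfl
    rw [h3]
    exact_mod_cast (by linarith : (0 : ℝ) < 1 - (p : ℝ) ^ (-(1 + δ))).ne'


/-- As δ → 0 from the right, ζ(1 + δ) ~ 1/δ by the residue at 1, while 1 - e^{-δ} ~ δ. -/
theorem tendsto_log_zeta_add_log :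
    Tendsto (fun δ : ℝ => Real.log ‖riemannZeta ((1 + δ : ℝ) : ℂ)‖ +
      Real.log (1 - Real.exp (-δ))) (𝓝[>] 0) (𝓝 0) := by
  have h1 : Tendsto (fun δ : ℝ => ((1 + δ : ℝ) : ℂ)) (𝓝[>] 0) (𝓝[≠] 1) := by
    refine tendsto_nhdsWithin_iff.mpr ⟨?_, ?_⟩
    · have : ContinuousAt (fun δ : ℝ => ((1 + δ : ℝ) : ℂ)) 0 := by fun_prop
      have h := this.tendsto
      simp only [add_zero, Complex.ofReal_one] at h
      exact h.mono_left nhdsWithin_le_nhds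
    · filter_upwards [self_mem_nhdsWithin] with δ hδ
      have : δ ≠ 0 := (Set.mem_Ioi.mp hδ).ne'
      simpa using this
  have h2 := (riemannZeta_residue_one.comp h1).norm
  simp only [Function.comp_def, norm_one] at h2
  have h3 : Tendsto (fun δ : ℝ => (1 - Real.exp (-δ)) / δ) (𝓝[>] 0) (𝓝 1) := by
    have hd : HasDerivAt (fun δ : ℝ => 1 - Real.exp (-δ)) 1 0 := by
      have := ((hasDerivAt_neg (0 : ℝ)).exp).const_sub 1
      simpa using this
    have h := hd.tendsto_slope_zero_right
    simpa [div_eq_inv_mul] using h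
  have h4 := (h2.mul h3).log (by simp)
  rw [mul_one, Real.log_one] at h4
  refine h4.congr' ?_
  filter_upwards [self_mem_nhdsWithin] with δ hδ
  have hδ' : 0 < δ := hδ
  have h5 : ‖riemannZeta ((1 + δ : ℝ) : ℂ)‖ ≠ 0 :=
    norm_ne_zero_iff.mpr (riemannZeta_ne_zero_of_one_lt_re (by simp [hδ']))
  have h6 : 0 < 1 - Real.exp (-δ) := by
    have := Real.exp_lt_one_iff.mpr (neg_lt_zero.mpr hδ')
    linarith
  rw [← Real.log_mul h5 h6.ne', norm_mul]
  congr 1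
  have : ‖((1 + δ : ℝ) : ℂ) - 1‖ = δ := by
    push_cast
    rw [add_sub_cancel_left, Complex.norm_real, Real.norm_of_nonneg hδ'.le]
  rw [this]
  field_simp

theorem harmonic_ceil_lower {c : ℝ} (hc : c < Real.eulerMascheroniConstant) :
    ∃ u₀ : ℝ, ∀ u ≥ u₀, Real.log u + c ≤ (harmonic (⌈u⌉₊ - 1) : ℝ) := by
  have h := Real.tendsto_harmonic_sub_log_add_one.eventually_const_lt hc
  obtain ⟨N, hN⟩ := eventually_atTop.mp h
  refine ⟨N + 1, fun u hu => ?_⟩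
  have hu1 : N + 1 ≤ ⌈u⌉₊ := by
    have : ((N + 1 : ℕ) : ℝ) ≤ (⌈u⌉₊ : ℝ) := by push_cast; exact hu.trans (Nat.le_ceil u)
    exact_mod_cast this
  have h1 := hN (⌈u⌉₊ - 1) (by omega)
  have h2 : ((⌈u⌉₊ - 1 : ℕ) : ℝ) + 1 = (⌈u⌉₊ : ℝ) := by
    rw [Nat.cast_sub (by omega)]; simp
  have h3 : Real.log u ≤ Real.log (⌈u⌉₊ : ℝ) :=
    Real.log_le_log (by have : (0:ℝ) ≤ N := by positivity
                        linarith) (Nat.le_ceil u)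
  rw [h2] at h1
  linarith

/-- One half of Mertens' third theorem, along a subsequence. -/
theorem mertens_frequently {b : ℝ} (hb : b < Real.eulerMascheroniConstant) (u₀ : ℝ) :
    ∃ u ≥ u₀, Real.log u + b < ∑ p ∈ (⌊Real.exp u⌋₊ + 1).primesBelow,
      -Real.log (1 - (p : ℝ)⁻¹) := by
  by_contra! hcon
  set F : ℝ → ℝ := fun u => ∑ p ∈ (⌊Real.exp u⌋₊ + 1).primesBelow, -Real.log (1 - (p : ℝ)⁻¹)
  have hg : ∀ p : ℕ, 0 ≤ -Real.log (1 - (p : ℝ)⁻¹) := by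
    intro p
    rw [neg_nonneg]
    rcases Nat.eq_zero_or_pos p with rfl | hp
    · simp
    · refine Real.log_nonpos ?_ ?_
      · have : (p : ℝ)⁻¹ ≤ 1 := inv_le_one_of_one_le₀ (by exact_mod_cast hp)
        linarith
      · have : 0 ≤ (p : ℝ)⁻¹ := by positivity
        linarith
  have hF : ∀ u v, u ≤ v → F u ≤ F v := by
    intro u v huv
    refine Finset.sum_le_sum_of_subset_of_nonneg ?_ fun p _ _ => hg p
    intro p hp
    rw [Nat.mem_primesBelow] at hp ⊢
    exact ⟨hp.1.trans_le (by gcongr), hp.2⟩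
  obtain ⟨c, hbc, hc⟩ := exists_between hb
  obtain ⟨u₁, hu₁⟩ := harmonic_ceil_lower hc
  -- Beyond w, the assumed upper bound log u + b for F and the lower bound log u + c for the
  -- harmonic step function hold together, leaving a gap c - b > 0. Up to w, F is at most F w.
  set w := max 0 (max u₀ u₁)
  have hw : 0 ≤ w := le_max_left _ _
  have hwu₀ : u₀ ≤ w := (le_max_left _ _).trans (le_max_right _ _)
  have hwu₁ : u₁ ≤ w := (le_max_right _ _).trans (le_max_right _ _)
  have hη : 0 < c - b := by linarith
  have hC : 0 ≤ F w := Finset.sum_nonneg fun p _ => hg p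
  have key : ∀ δ : ℝ, 0 < δ → Real.log ‖riemannZeta ((1 + δ : ℝ) : ℂ)‖ +
      (c - b) * Real.exp (-(δ * w)) ≤
      -Real.log (1 - Real.exp (-δ)) + F w * (1 - Real.exp (-(δ * w))) := by
    intro δ hδ
    refine le_of_tendsto ((tendsto_log_zeta_euler hδ).add_const _) (Eventually.of_forall fun n => ?_)
    have hcomp := laplace_comparison n.primesBelow (fun p : ℕ => -Real.log (1 - (p : ℝ)⁻¹))
      (fun p : ℕ => Real.log p) hg (fun p => Real.log_natCast_nonneg p) hη.le hC hw hδ ?_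
    · refine le_trans (add_le_add_left (Finset.sum_le_sum fun p hp => ?_) _) hcomp
      have hp' := Nat.prime_of_mem_primesBelow hp
      have hp0 : (0 : ℝ) < p := by exact_mod_cast hp'.pos
      have h1 := neg_log_one_sub_mul_le (x := (p : ℝ)⁻¹) (y := Real.exp (-(δ * Real.log p)))
        (inv_lt_one_of_one_lt₀ (by exact_mod_cast hp'.one_lt)) (Real.exp_pos _).le
        (Real.exp_le_one_iff.mpr (by
          have := mul_nonneg hδ.le (Real.log_natCast_nonneg p); linarith))
      have h2 : (p : ℝ) ^ (-(1 + δ)) = (p : ℝ)⁻¹ * Real.exp (-(δ * Real.log p)) := by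
        rw [neg_add, Real.rpow_add hp0, Real.rpow_neg_one, Real.rpow_def_of_pos hp0]
        congr 2; ring
      rw [h2]
      linarith
    · intro u hu
      have h1 : ∑ p ∈ n.primesBelow with Real.log (p : ℕ) < u, -Real.log (1 - (p : ℝ)⁻¹) ≤ F u := by
        refine Finset.sum_le_sum_of_subset_of_nonneg ?_ fun p _ _ => hg p
        intro p hp
        rw [Finset.mem_filter, Nat.mem_primesBelow] at hp
        rw [Nat.mem_primesBelow]
        refine ⟨Nat.lt_succ_of_le (Nat.le_floor ?_), hp.1.2⟩
        exact ((Real.log_lt_iff_lt_exp (by exact_mod_cast hp.1.2.pos)).mp hp.2).le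
      have h0 : (0 : ℝ) ≤ (harmonic (⌈u⌉₊ - 1) : ℝ) := by
        have : (0 : ℚ) ≤ harmonic (⌈u⌉₊ - 1) := by
          unfold harmonic; positivity
        exact_mod_cast this
      split_ifs with hwu
      · have h2 := hcon u (hwu₀.trans hwu.le)
        have h3 := hu₁ u (hwu₁.trans hwu.le)
        change F u ≤ _ at h2
        linarith
      · have := hF u w (not_lt.mp hwu)
        linarith
  have hlim : Tendsto (fun δ : ℝ => Real.exp (-(δ * w))) (𝓝[>] 0) (𝓝 1) := by
    have : ContinuousAt (fun δ : ℝ => Real.exp (-(δ * w))) 0 := by fun_prop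
    have h := this.tendsto
    simp only [zero_mul, neg_zero, Real.exp_zero] at h
    exact h.mono_left nhdsWithin_le_nhds
  -- As δ → 0 the two main terms cancel, the bounded range up to w contributes nothing, and the gap
  -- survives: c - b ≤ 0, a contradiction.
  have hl1 := tendsto_log_zeta_add_log.add (hlim.const_mul (c - b))
  have hl2 := (hlim.const_sub 1).const_mul (F w)
  have := le_of_tendsto_of_tendsto hl1 hl2 (by
    filter_upwards [self_mem_nhdsWithin] with δ hδ
    have := key δ hδ
    linarith)
  simp at this
  linarith

/-- The left side increases with n to its limit γ. With t = log((x + 1)/x), the increment is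
nonnegative because t ≤ sinh t = (1/x + 1/(x + 1))/2. The correction 1/(2n) makes convergence fast
enough for n = 16 to give the decimals needed. -/
theorem harmonic_sub_log_le (n : ℕ) (hn : 0 < n) :
    (harmonic n : ℝ) - Real.log n - 1 / (2 * n) ≤ Real.eulerMascheroniConstant := by
  set a : ℕ → ℝ := fun k => (harmonic (n + k) : ℝ) - Real.log ((n + k : ℕ) : ℝ) -
    1 / (2 * ((n + k : ℕ) : ℝ))
  have hmono : Monotone a := by
    refine monotone_nat_of_le_succ fun k => ?_
    have hx : (0 : ℝ) < ((n + k : ℕ) : ℝ) := by positivity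
    simp only [a]
    rw [← add_assoc, harmonic_succ]
    push_cast
    push_cast at hx
    set x : ℝ := (n : ℝ) + k
    have h1 : 0 ≤ Real.log ((x + 1) / x) := Real.log_nonneg (by rw [le_div_iff₀ hx]; linarith)
    have h2 := Real.self_le_sinh_iff.mpr h1
    rw [Real.sinh_eq, Real.exp_neg, Real.exp_log (by positivity),
      Real.log_div (by positivity) hx.ne'] at h2
    have h3 : ((x + 1) / x - ((x + 1) / x)⁻¹) / 2 = (x + 1)⁻¹ - 1 / (2 * (x + 1)) + 1 / (2 * x) := by
      field_simp
      ring
    linarith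
  have hlim : Tendsto a atTop (𝓝 Real.eulerMascheroniConstant) := by
    have h1 := (tendsto_add_atTop_iff_nat n).mpr Real.tendsto_harmonic_sub_log
    have h2 : Tendsto (fun k : ℕ => 1 / (2 * ((n + k : ℕ) : ℝ))) atTop (𝓝 0) := by
      have h := (tendsto_add_atTop_iff_nat n).mpr
        (tendsto_one_div_atTop_nhds_zero_nat (𝕜 := ℝ))
      have := h.const_mul (1 / 2)
      rw [mul_zero] at this
      refine this.congr fun k => ?_
      rw [add_comm n k]
      field_simp
    have := h1.sub h2
    rw [sub_zero] at this
    refine this.congr fun k => ?_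
    simp only [a, add_comm n k]
  have := hmono.ge_of_tendsto hlim 0
  simpa [a] using this

theorem lt_eulerMascheroniConstant : (0.57688 : ℝ) < Real.eulerMascheroniConstant := by
  have h := harmonic_sub_log_le 16 (by norm_num)
  have h1 : (harmonic 16 : ℝ) = 2436559 / 720720 := by
    have : harmonic 16 = 2436559 / 720720 := by
      norm_num [harmonic, Finset.sum_range_succ]
    rw [this]; norm_num
  have h2 : Real.log ((16 : ℕ) : ℝ) = 4 * Real.log 2 := by
    rw [show ((16 : ℕ) : ℝ) = 2 ^ 4 by norm_num, Real.log_pow]; norm_num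
  rw [h1, h2] at h
  have := Real.log_two_lt_d9
  norm_num at h ⊢
  linarith

theorem log_lt_eulerMascheroniConstant : Real.log 1.7804 < Real.eulerMascheroniConstant := by
  refine lt_of_le_of_lt ?_ lt_eulerMascheroniConstant
  rw [Real.log_le_iff_le_exp (by norm_num)]
  refine le_trans ?_ (Real.sum_le_exp_of_nonneg (by norm_num) 9)
  norm_num [Finset.sum_range_succ, Nat.factorial]

/-- There are arbitrarily large `N` with `∏_{p ≤ N} (1 - 1/p)⁻¹ > 1.7804 log N`. -/
theorem exists_primorial_totient (B : ℕ) :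
    ∃ N : ℕ, B ≤ N ∧ 1.7804 * Real.log N * ((primorial N).totient : ℝ) ≤ primorial N := by
  obtain ⟨u, hu, hlt⟩ := mertens_frequently log_lt_eulerMascheroniConstant (max 1 (B : ℝ))
  have hu1 : 1 ≤ u := (le_max_left _ _).trans hu
  have huB : (B : ℝ) ≤ u := (le_max_right _ _).trans hu
  set N := ⌊Real.exp u⌋₊
  have hexp : u ≤ Real.exp u := by linarith [Real.add_one_le_exp u]
  refine ⟨N, Nat.le_floor (huB.trans hexp), ?_⟩
  have hN1 : 1 ≤ N := Nat.le_floor (by push_cast; linarith)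
  have hlogN : Real.log N ≤ u := by
    rw [Real.log_le_iff_le_exp (by exact_mod_cast hN1)]
    exact Nat.floor_le (Real.exp_pos _).le
  have hφ : ((primorial N).totient : ℝ) =
      primorial N * ∏ p ∈ (N + 1).primesBelow, (1 - (p : ℝ)⁻¹) := by
    have h := Nat.totient_eq_mul_prod_factors (primorial N)
    have h2 : (primorial N).primeFactors = (N + 1).primesBelow := by
      ext p
      rw [Nat.mem_primeFactors_of_ne_zero (primorial_ne_zero N), Nat.mem_primesBelow,
        Nat.lt_succ_iff]
      constructor
      · rintro ⟨h1, h2⟩; exact ⟨(h1.dvd_primorial_iff).mp h2, h1⟩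
      · rintro ⟨h1, h2⟩; exact ⟨h2, (h2.dvd_primorial_iff).mpr h1⟩
    rw [h2] at h
    have h' := congrArg (Rat.cast : ℚ → ℝ) h
    push_cast at h'
    exact h'
  have hpos : ∀ p ∈ (N + 1).primesBelow, (0 : ℝ) < 1 - (p : ℝ)⁻¹ := by
    intro p hp
    have := inv_lt_one_of_one_lt₀ (a := (p : ℝ))
      (by exact_mod_cast (Nat.prime_of_mem_primesBelow hp).one_lt)
    linarith
  have hprod : 0 < ∏ p ∈ (N + 1).primesBelow, (1 - (p : ℝ)⁻¹) := Finset.prod_pos hpos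
  rw [Finset.sum_neg_distrib, ← Real.log_prod fun p hp => (hpos p hp).ne',
    ← Real.log_mul (by linarith) (by norm_num), ← Real.log_inv] at hlt
  have hlt2 := (Real.log_lt_log_iff (by positivity) (by positivity)).mp hlt
  rw [hφ]
  have h3 : u * 1.7804 * ∏ p ∈ (N + 1).primesBelow, (1 - (p : ℝ)⁻¹) ≤ 1 := by
    have := mul_le_mul_of_nonneg_right hlt2.le hprod.le
    rwa [inv_mul_cancel₀ hprod.ne'] at this
  have h4 : 1.7804 * Real.log N * ∏ p ∈ (N + 1).primesBelow, (1 - (p : ℝ)⁻¹) ≤ 1 := by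
    refine le_trans ?_ h3
    refine mul_le_mul_of_nonneg_right ?_ hprod.le
    linarith
  have h5 : (0 : ℝ) ≤ primorial N := by positivity
  nlinarith [mul_le_mul_of_nonneg_left h4 h5]

/-- For m = primorial N one has φ(m) ≤ 4^N, so log log(2φ(m)) is at most log N + 2. The loss from
1.7804 to 1.7802 pays for the additive constant. -/
theorem exists_totient_ratio (B : ℕ) :
    ∃ m : ℕ, 0 < m ∧ B ≤ m.totient ∧
      1.7802 * (m.totient : ℝ) * Real.log (Real.log (2 * (m.totient : ℝ))) ≤ m := by
  obtain ⟨p, hpB, hp⟩ := Nat.exists_infinite_primes (B + 1)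
  -- A prime p > B with p ≤ N forces φ(m) ≥ p - 1 ≥ B. The bound log N ≥ 20000 gives 1.7802 (2 + log
  -- N) ≤ 1.7804 log N, since 2 · 1.7802 ≤ 0.0002 · 20000.
  obtain ⟨N, hN, hle⟩ := exists_primorial_totient (max p ⌈Real.exp 20000⌉₊)
  have hpN : p ≤ N := (le_max_left _ _).trans hN
  have hN2 : Real.exp 20000 ≤ N := (Nat.le_ceil _).trans
    (by exact_mod_cast (le_max_right _ _).trans hN)
  have hNpos : (0 : ℝ) < N := (Real.exp_pos _).trans_le hN2
  have hlogN : 20000 ≤ Real.log N := (Real.le_log_iff_exp_le hNpos).mpr hN2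
  refine ⟨primorial N, primorial_pos N, ?_, ?_⟩
  · have h1 : p.totient ∣ (primorial N).totient :=
      Nat.totient_dvd_of_dvd (hp.dvd_primorial_iff.mpr hpN)
    have h2 := Nat.le_of_dvd (Nat.totient_pos.mpr (primorial_pos N)) h1
    rw [Nat.totient_prime hp] at h2
    omega
  · refine le_trans ?_ hle
    have hφ1 : (1 : ℝ) ≤ (primorial N).totient := by
      exact_mod_cast Nat.totient_pos.mpr (primorial_pos N)
    have hφ2 : ((primorial N).totient : ℝ) ≤ 4 ^ N := by
      exact_mod_cast (Nat.totient_le _).trans (primorial_le_four_pow N)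
    have hN1 : (1 : ℝ) ≤ N := by
      have : 0 < N := by exact_mod_cast hNpos
      exact_mod_cast this
    have hlog : Real.log (2 * ((primorial N).totient : ℝ)) ≤ 3 * N := by
      calc Real.log (2 * ((primorial N).totient : ℝ)) ≤ Real.log (2 * 4 ^ N) :=
            Real.log_le_log (by positivity) (by linarith)
        _ = (1 + 2 * N) * Real.log 2 := by
            rw [show (4 : ℝ) = 2 ^ 2 by norm_num, ← pow_mul, ← pow_succ', Real.log_pow]
            push_cast; ring
        _ ≤ (1 + 2 * N) * 1 :=
            mul_le_mul_of_nonneg_left (by linarith [Real.log_two_lt_d9]) (by positivity)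
        _ ≤ 3 * N := by linarith
    have hlogpos : 0 < Real.log (2 * ((primorial N).totient : ℝ)) := Real.log_pos (by linarith)
    have hll : Real.log (Real.log (2 * ((primorial N).totient : ℝ))) ≤ 2 + Real.log N := by
      refine (Real.log_le_log hlogpos hlog).trans ?_
      rw [Real.log_mul (by norm_num) hNpos.ne']
      have := Real.log_le_sub_one_of_pos (show (0 : ℝ) < 3 by norm_num)
      linarith
    nlinarith

end Mertens

/-! ### Covering radius, lattice point counts, covolume and density -/

section Geometry

open MeasureTheory Module

variable {E : Type*} [NormedAddCommGroup E] [InnerProductSpace ℝ E]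

/-- Round t down with probability 1 - f and up with probability f, where f is its fractional part.
The error has mean zero, so the cross term vanishes on average, and its variance is f(1 - f) ≤ 1/4.
One of the two roundings does at least as well as the mean. -/
theorem exists_int_rounding_single (w b : E) (t : ℝ) :
    ∃ z : ℤ, ‖w + (t - z) • b‖ ^ 2 ≤ ‖w‖ ^ 2 + ‖b‖ ^ 2 / 4 := by
  have key : ∀ c : ℝ, ‖w + c • b‖ ^ 2 = ‖w‖ ^ 2 + 2 * c * inner ℝ w b + c ^ 2 * ‖b‖ ^ 2 := by
    intro c
    rw [norm_add_sq_real, norm_smul, real_inner_smul_right, mul_pow, Real.norm_eq_abs, sq_abs]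
    ring
  have hf0 := Int.fract_nonneg t
  have hf1 := (Int.fract_lt_one t).le
  have hf : t - ⌊t⌋ = Int.fract t := rfl
  by_contra! hcon
  have h1 := hcon ⌊t⌋
  have h2 := hcon (⌊t⌋ + 1)
  push_cast at h2
  rw [show t - ((⌊t⌋ : ℝ) + 1) = Int.fract t - 1 by rw [← hf]; ring, key] at h2
  rw [hf, key] at h1
  set f := Int.fract t
  have h3 : f * (1 - f) ≤ 1 / 4 := by nlinarith [sq_nonneg (f - 1 / 2)]
  have h4 := mul_le_mul_of_nonneg_right h3 (sq_nonneg ‖b‖)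
  rcases hf0.eq_or_lt with h0 | h0
  · rw [← h0] at h1
    nlinarith [sq_nonneg ‖b‖]
  · nlinarith [mul_le_mul_of_nonneg_left h1.le (by linarith : 0 ≤ 1 - f),
      mul_lt_mul_of_pos_left h2 h0]

/-- Rounding the coefficients of a linear combination one after the other. -/
theorem exists_int_rounding {ι : Type*} (s : Finset ι) (b : ι → E) (t : ι → ℝ) :
    ∃ z : ι → ℤ, ‖∑ i ∈ s, (t i - z i) • b i‖ ^ 2 ≤ (∑ i ∈ s, ‖b i‖ ^ 2) / 4 := by
  classical
  induction s using Finset.induction_on with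
  | empty => exact ⟨0, by simp⟩
  | insert a s ha ih =>
    obtain ⟨z, hz⟩ := ih
    obtain ⟨k, hk⟩ := exists_int_rounding_single (∑ i ∈ s, (t i - z i) • b i) (b a) (t a)
    refine ⟨Function.update z a k, ?_⟩
    rw [Finset.sum_insert ha, Finset.sum_insert ha, Function.update_self, add_comm]
    rw [Finset.sum_congr rfl fun i hi => by
      rw [Function.update_of_ne (ne_of_mem_of_not_mem hi ha)]]
    linarith

/-- A bound for the covering radius of a lattice containing a spanning family. -/
theorem exists_mem_norm_sub_le (L : Submodule ℤ E) {ι : Type*} [Fintype ι] (b : ι → E)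
    (hb : ∀ i, b i ∈ L) (hspan : Submodule.span ℝ (Set.range b) = ⊤) {τ : ℝ} (hτ : 0 ≤ τ)
    (hle : ∑ i, ‖b i‖ ^ 2 ≤ 4 * τ ^ 2) (x : E) : ∃ y ∈ L, ‖x - y‖ ≤ τ := by
  have hx : x ∈ Submodule.span ℝ (Set.range b) := hspan ▸ Submodule.mem_top
  obtain ⟨t, rfl⟩ := (Submodule.mem_span_range_iff_exists_fun ℝ).mp hx
  obtain ⟨z, hz⟩ := exists_int_rounding Finset.univ b t
  refine ⟨∑ i, z i • b i, Submodule.sum_mem _ fun i _ => Submodule.smul_mem _ _ (hb i), ?_⟩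
  refine abs_le_of_sq_le_sq' ?_ hτ |>.2
  rw [← Finset.sum_sub_distrib]
  rw [Finset.sum_congr rfl fun i _ => by
    rw [← Int.cast_smul_eq_zsmul ℝ (z i) (b i), ← sub_smul]]
  linarith

theorem exists_dualBasis {ι : Type*} [DecidableEq ι] [FiniteDimensional ℝ E] (B : Basis ι ℝ E) :
    ∃ d : ι → E, ∀ i x, inner ℝ (d i) x = B.repr x i :=
  ⟨fun i => (InnerProductSpace.toDual ℝ E).symm (LinearMap.toContinuousLinearMap (B.coord i)),
    fun i x => by rw [InnerProductSpace.toDual_symm_apply]; rfl⟩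

theorem abs_det_eq_one_of_sq_eq_neg (σ : E →ₗ[ℝ] E) (hσ : ∀ x, σ (σ x) = -x) :
    |LinearMap.det σ| = 1 := by
  have h : σ ∘ₗ σ = (-1 : ℝ) • LinearMap.id := by ext x; simp [hσ]
  have h2 := congrArg LinearMap.det h
  rw [LinearMap.det_comp, LinearMap.det_smul, LinearMap.det_id, mul_one] at h2
  have h3 := congrArg abs h2
  rw [abs_mul, abs_pow, abs_neg, abs_one, one_pow] at h3
  nlinarith [abs_nonneg (LinearMap.det σ)]

variable [FiniteDimensional ℝ E] [MeasurableSpace E] [BorelSpace E]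

/-- The volume of the ball of radius r + τ is the integral over a fundamental domain of the number
of translates g + x in the ball. If y ∈ L is within τ of x, each v ∈ X yields such a translate v - y
+ x, so that number is at least the cardinality of X. -/
theorem card_mul_covolume_le (L : Submodule ℤ E) [DiscreteTopology L] [IsZLattice ℝ L] {τ r : ℝ}
    (hτ : ∀ x : E, ∃ y ∈ L, ‖x - y‖ ≤ τ) (X : Finset E) (hX : ∀ x ∈ X, x ∈ L ∧ ‖x‖ ≤ r) :
    X.card * ZLattice.covolume L ≤ volume.real (Metric.closedBall (0 : E) (r + τ)) := by
  classical
  have := ZLattice.module_free ℝ L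
  have := ZLattice.module_finite ℝ L
  have : VAddInvariantMeasure L E volume :=
    inferInstanceAs (VAddInvariantMeasure L.toAddSubgroup E volume)
  let b := Module.Free.chooseBasis ℤ L
  set F := ZSpan.fundamentalDomain (b.ofZLatticeBasis ℝ)
  have hF : IsAddFundamentalDomain L F volume := ZLattice.isAddFundamentalDomain b volume
  rw [ZLattice.covolume_eq_measure_fundamentalDomain L volume hF, measureReal_def, measureReal_def,
    ← ENNReal.toReal_natCast, ← ENNReal.toReal_mul]
  refine ENNReal.toReal_mono measure_closedBall_lt_top.ne ?_
  set B := Metric.closedBall (0 : E) (r + τ)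
  have hB : MeasurableSet B := Metric.isClosed_closedBall.measurableSet
  have h1 : volume B = ∫⁻ x in F, ∑' g : L, B.indicator 1 (g +ᵥ x) := by
    rw [← lintegral_indicator_one hB, hF.lintegral_eq_tsum'' (B.indicator 1), lintegral_tsum]
    intro g
    exact ((measurable_one.indicator hB).comp (measurable_const_vadd g)).aemeasurable
  rw [h1, ← setLIntegral_const]
  refine lintegral_mono fun x => ?_
  obtain ⟨y, hy, hxy⟩ := hτ x
  let f : E → L := fun v => if hv : v ∈ L then ⟨v, hv⟩ - ⟨y, hy⟩ else 0
  have hf : ∀ v ∈ X, (f v : E) = v - y := by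
    intro v hv
    simp [f, (hX v hv).1]
  have hinj : Set.InjOn f X := by
    intro u hu v hv huv
    have := congrArg (Subtype.val) huv
    rw [hf u hu, hf v hv] at this
    exact sub_left_injective this
  calc (X.card : ENNReal) = ∑ g ∈ X.image f, (1 : ENNReal) := by
        rw [Finset.sum_const, Finset.card_image_of_injOn hinj]; simp
    _ = ∑ g ∈ X.image f, B.indicator 1 (g +ᵥ x) := by
        refine Finset.sum_congr rfl fun g hg => ?_
        obtain ⟨v, hv, rfl⟩ := Finset.mem_image.mp hg
        rw [Set.indicator_of_mem]
        · rfl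
        · rw [mem_closedBall_zero_iff]
          have : f v +ᵥ x = v + (x - y) := by
            change (f v : E) + x = _
            rw [hf v hv]; abel
          rw [this]
          exact (norm_add_le _ _).trans (add_le_add (hX v hv).2 hxy)
    _ ≤ _ := ENNReal.sum_le_tsum _

/-- A symplectic lattice has covolume `1`. -/
theorem covolume_eq_one_of_symplectic (L : Submodule ℤ E) [DiscreteTopology L] [IsZLattice ℝ L]
    (σ : E ≃ₗᵢ[ℝ] E) (hσL : σ '' (L : Set E) = (dualLattice L : Set E))
    (hσ : ∀ x, σ (σ x) = -x) : ZLattice.covolume L = 1 := by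
  classical
  have := ZLattice.module_free ℝ L
  have := ZLattice.module_finite ℝ L
  let b := Module.Free.chooseBasis ℤ L
  set B := b.ofZLatticeBasis ℝ
  have hBmem : ∀ i, B i ∈ L := fun i => by
    rw [Basis.ofZLatticeBasis_apply]; exact (b i).2
  let o : OrthonormalBasis _ ℝ E := (stdOrthonormalBasis ℝ E).reindex
    (Fintype.equivOfCardEq (by rw [Fintype.card_fin, finrank_eq_card_basis B]) :
      Fin (finrank ℝ E) ≃ Module.Free.ChooseBasisIndex ℤ L)
  have hvol : volume.real (ZSpan.fundamentalDomain o.toBasis) = 1 := by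
    rw [measureReal_congr (ZSpan.fundamentalDomain_ae_parallelepiped o.toBasis volume),
      measureReal_def, OrthonormalBasis.coe_toBasis, o.volume_parallelepiped, ENNReal.toReal_one]
  rw [ZLattice.covolume_eq_det_mul_measureReal L volume b o.toBasis, hvol, mul_one]
  have hB : (Subtype.val ∘ b : _ → E) = B := by
    funext i; exact (Basis.ofZLatticeBasis_apply ℝ L b i).symm
  rw [hB]
  have hdual : ∀ x ∈ L, σ x ∈ dualLattice L := fun x hx => by
    have : σ x ∈ (dualLattice L : Set E) := hσL ▸ Set.mem_image_of_mem σ hx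
    exact this
  -- The matrix A of the products ⟨σ b_i, b_j⟩ is integral because σ(L) lies in the dual. Since the
  -- dual basis lies in σ(L), A has an integral left inverse Z, so det A = ±1.
  choose A hA using fun i j => hdual (B i) (hBmem i) (B j) (hBmem j)
  obtain ⟨d, hd⟩ := exists_dualBasis B
  have hd' : ∀ i, d i ∈ dualLattice L := by
    intro i y hy
    refine ⟨b.repr ⟨y, hy⟩ i, ?_⟩
    rw [hd]
    exact Basis.ofZLatticeBasis_repr_apply ℝ L b ⟨y, hy⟩ i
  have hZ : ∀ i, ∃ z : _ → ℤ, d i = ∑ j, (z j : ℝ) • σ (B j) := by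
    intro i
    have h1 : d i ∈ σ '' (L : Set E) := hσL ▸ hd' i
    obtain ⟨y, hy, hyi⟩ := h1
    refine ⟨fun j => b.repr ⟨y, hy⟩ j, ?_⟩
    have hy2 : y = ∑ j, ((b.repr ⟨y, hy⟩ j : ℤ) : ℝ) • B j := by
      conv_lhs => rw [← B.sum_repr y]
      refine Finset.sum_congr rfl fun j _ => ?_
      congr 1
      exact Basis.ofZLatticeBasis_repr_apply ℝ L b ⟨y, hy⟩ j
    rw [← hyi]
    conv_lhs => rw [hy2]
    rw [map_sum]
    exact Finset.sum_congr rfl fun j _ => map_smul σ _ _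
  choose Z hZ using hZ
  have hZA : Matrix.of Z * Matrix.of A = 1 := by
    ext i k
    have h1 := hd i (B k)
    rw [hZ i, sum_inner] at h1
    rw [Matrix.mul_apply, Matrix.one_apply]
    simp only [Matrix.of_apply]
    have h2 : ((∑ j, Z i j * A j k : ℤ) : ℝ) = if i = k then 1 else 0 := by
      push_cast
      rw [Basis.repr_self, Finsupp.single_apply] at h1
      simp only [real_inner_smul_left, hA] at h1
      rw [h1]
      simp [eq_comm]
    exact_mod_cast h2
  have hdetA : |(((Matrix.of A).det : ℤ) : ℝ)| = 1 := by
    have hu : IsUnit (Matrix.of A).det := by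
      refine IsUnit.of_mul_eq_one_right (Matrix.of Z).det ?_
      rw [← Matrix.det_mul, hZA, Matrix.det_one]
    rcases Int.isUnit_iff.mp hu with h | h <;> simp [h]
  -- In an orthonormal basis, det A = det σ · (det B)² with |det σ| = 1. Hence |det B|, which is the
  -- covolume, equals 1.
  have hA2 : (Matrix.of A).map (Int.cast : ℤ → ℝ) =
      (o.toBasis.toMatrix (σ.toLinearEquiv.toLinearMap ∘ B)).transpose * o.toBasis.toMatrix B := by
    ext i j
    rw [Matrix.map_apply, Matrix.of_apply, ← hA, Matrix.mul_apply, ← o.sum_inner_mul_inner]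
    refine Finset.sum_congr rfl fun k _ => ?_
    rw [Matrix.transpose_apply, Basis.toMatrix_apply, Basis.toMatrix_apply,
      OrthonormalBasis.coe_toBasis_repr_apply, OrthonormalBasis.coe_toBasis_repr_apply,
      OrthonormalBasis.repr_apply_apply, OrthonormalBasis.repr_apply_apply, real_inner_comm]
    rfl
  have hdet := congrArg Matrix.det hA2
  rw [Matrix.det_mul, Matrix.det_transpose, ← Basis.det_apply, ← Basis.det_apply,
    Basis.det_comp] at hdet
  have hcast : ((Matrix.of A).map (Int.cast : ℤ → ℝ)).det = (((Matrix.of A).det : ℤ) : ℝ) := by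
    rw [Int.cast_det]
  rw [hcast] at hdet
  have h3 := congrArg abs hdet
  rw [hdetA, abs_mul, abs_mul, abs_det_eq_one_of_sq_eq_neg _ hσ, one_mul] at h3
  nlinarith [abs_nonneg (o.toBasis.det B)]

theorem packingDensity_ge_of_covolume_eq_one (L : Submodule ℤ E)
    (hspan : Submodule.span ℝ (L : Set E) = ⊤) [Nontrivial E] (hcov : ZLattice.covolume L = 1) {r : ℝ}
    (hmin : ∀ x ∈ L, x ≠ 0 → r ≤ ‖x‖) :
    volume.real (Metric.closedBall (0 : E) r) / 2 ^ finrank ℝ E ≤ packingDensity L := by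
  unfold packingDensity
  rw [hcov, mul_one]
  have : r ≤ latticeMinimum L := by
    refine le_csInf ?_ ?_
    -- The set of norms must be nonempty, since an infimum over the empty set takes the default
    -- value 0. A zero lattice cannot span a nontrivial space.
    · by_contra hne
      have h0 : (L : Set E) ⊆ {0} := by
        intro x hx
        by_contra hx0
        exact hne ⟨‖x‖, x, hx, hx0, rfl⟩
      have := Submodule.span_mono (R := ℝ) h0
      rw [hspan, Submodule.span_zero_singleton, top_le_iff] at this
      exact bot_ne_top this
    · rintro _ ⟨x, hx, hx0, rfl⟩
      exact hmin x hx hx0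
  gcongr
  exact measure_closedBall_lt_top.ne

theorem volume_real_closedBall_of_dim_even [Nontrivial E] {k : ℕ} (hk : finrank ℝ E = 2 * k)
    {r : ℝ} (hr : 0 ≤ r) : volume.real (Metric.closedBall (0 : E) r) =
      (r ^ 2) ^ k * (Real.pi ^ k / k.factorial) := by
  rw [measureReal_def, InnerProductSpace.volume_closedBall_of_dim_even hk, ENNReal.toReal_mul,
    ENNReal.toReal_pow, ENNReal.toReal_ofReal hr, ENNReal.toReal_ofReal (by positivity), hk,
    pow_mul]

end Geometry

/-! ### The space K_ℝ: conjugation, spanning sets, duality and dimension -/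

section Minkowski

open Module

variable (K : Type*) [Field K] [NumberField K]

/-- Coordinatewise complex conjugation on `K_ℝ`. -/
noncomputable def minkowskiConj : MinkowskiSpace K →ₗ[ℝ] MinkowskiSpace K where
  toFun x := ⟨WithLp.toLp 2 (fun φ => starRingEnd ℂ (x.coord φ)), fun φ => by
    have := x.2 φ
    change x.coord _ = _ at this
    simp [this]; rfl⟩
  map_add' x y := by
    ext φ
    exact map_add (starRingEnd ℂ) (x.coord φ) (y.coord φ)
  map_smul' c x := by
    ext φ
    change starRingEnd ℂ (c • x.coord φ) = c • starRingEnd ℂ (x.coord φ)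
    simp

variable {K}

theorem minkowskiConj_coord (x : MinkowskiSpace K) (φ : K →+* ℂ) :
    (minkowskiConj K x).coord φ = starRingEnd ℂ (x.coord φ) := rfl

theorem minkowskiConj_minkowskiConj (x : MinkowskiSpace K) :
    minkowskiConj K (minkowskiConj K x) = x := by
  ext φ; simp [minkowskiConj_coord]

theorem MinkowskiSpace.norm_sq_eq (x : MinkowskiSpace K) : ‖x‖ ^ 2 = ∑ φ, ‖x.coord φ‖ ^ 2 := by
  change ‖x.1‖ ^ 2 = _
  rw [PiLp.norm_sq_eq_of_L2]
  rfl

theorem norm_minkowskiConj (x : MinkowskiSpace K) : ‖minkowskiConj K x‖ = ‖x‖ := by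
  rw [← sq_eq_sq₀ (norm_nonneg _) (norm_nonneg _), MinkowskiSpace.norm_sq_eq,
    MinkowskiSpace.norm_sq_eq]
  simp [minkowskiConj_coord]

theorem toMinkowski_coord (x : K) (φ : K →+* ℂ) : (toMinkowski K x).coord φ = φ x := rfl

theorem norm_sq_toMinkowski (x : K) : ‖toMinkowski K x‖ ^ 2 = ∑ φ : K →+* ℂ, ‖φ x‖ ^ 2 :=
  MinkowskiSpace.norm_sq_eq _

theorem MinkowskiSpace.coord_sub (x y : MinkowskiSpace K) (φ : K →+* ℂ) :
    (x - y).coord φ = x.coord φ - y.coord φ := rfl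

theorem MinkowskiSpace.coord_neg (x : MinkowskiSpace K) (φ : K →+* ℂ) :
    (-x).coord φ = -x.coord φ := rfl

theorem MinkowskiSpace.coord_smul (r : ℝ) (x : MinkowskiSpace K) (φ : K →+* ℂ) :
    (r • x).coord φ = r * x.coord φ := by
  change r • x.coord φ = _
  simp

theorem sum_embeddings_eq_trace (x : K) :
    ∑ φ : K →+* ℂ, φ x = ((Algebra.trace ℚ K x : ℚ) : ℂ) := by
  have h2 := trace_eq_sum_embeddings (K := ℚ) (L := K) ℂ (x := x)
  rw [← (RingHom.equivRatAlgHom K ℂ).sum_comp] at h2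
  rw [eq_ratCast] at h2
  exact h2.symm

/-- A vector of `K_ℝ` that pairs to zero with all of `K` vanishes. -/
theorem MinkowskiSpace.eq_zero_of_sum_eq_zero (w : MinkowskiSpace K)
    (h : ∀ x : K, ∑ φ : K →+* ℂ, w.coord φ * φ x = 0) : w = 0 := by
  have hinj : Function.Injective fun φ : K →+* ℂ => ((φ : K →+* ℂ) : K →* ℂ) := fun φ ψ h =>
    RingHom.ext fun x => DFunLike.congr_fun h x
  have hli := Fintype.linearIndependent_iff.mp ((linearIndependent_monoidHom K ℂ).comp _ hinj)
    (fun φ => w.coord φ) (by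
      ext x
      rw [Finset.sum_apply]
      exact h x)
  exact MinkowskiSpace.ext hli

theorem span_range_toMinkowski :
    Submodule.span ℝ (Set.range (toMinkowski K)) = ⊤ := by
  rw [← Submodule.orthogonal_eq_bot_iff, Submodule.eq_bot_iff]
  intro w hw
  rw [Submodule.mem_orthogonal'] at hw
  have h0 : minkowskiConj K w = 0 := by
    refine MinkowskiSpace.eq_zero_of_sum_eq_zero _ fun x => ?_
    have h1 := hw _ (Submodule.subset_span ⟨x, rfl⟩)
    have h2 := MinkowskiSpace.inner_eq K (toMinkowski K x) w
    rw [real_inner_comm, h1] at h2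
    rw [← Complex.ofReal_zero, h2]
    exact Finset.sum_congr rfl fun φ _ => mul_comm _ _
  rw [← minkowskiConj_minkowskiConj w, h0, map_zero]

/-- The values of the pairing on a ℚ-basis of K contained in I are integers, so nondegeneracy of the
trace form yields y₀ ∈ K with the same values. Independence of the embeddings then forces w to be
the image of y₀. The pairing is bilinear, without conjugation, so K needs no automorphism inducing
complex conjugation. -/
theorem exists_toMinkowski_of_integral_pairing
    {I : FractionalIdeal (nonZeroDivisors (𝓞 K)) K} (hI : I ≠ 0) (w : MinkowskiSpace K)
    (h : ∀ a ∈ I, ∃ k : ℤ, ∑ φ : K →+* ℂ, w.coord φ * φ a = k) :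
    ∃ x ∈ FractionalIdeal.dual ℤ ℚ I, w = toMinkowski K x := by
  let B := NumberField.basisOfFractionalIdeal K (Units.mk0 I hI)
  have hB : ∀ i, B i ∈ I := fun i => by
    rw [NumberField.basisOfFractionalIdeal_apply]
    exact (NumberField.fractionalIdealBasis K _ i).2
  choose n hn using fun i => h (B i) (hB i)
  let ℓ : K →ₗ[ℚ] ℚ := B.constr ℚ fun i => (n i : ℚ)
  let y₀ : K := ((Algebra.traceForm ℚ K).toDual (traceForm_nondegenerate ℚ K)).symm ℓ
  have hy₀ : ∀ x, Algebra.trace ℚ K (y₀ * x) = ℓ x := fun x => by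
    rw [← Algebra.traceForm_apply]
    exact LinearMap.BilinForm.apply_toDual_symm_apply (hB := traceForm_nondegenerate ℚ K) ℓ x
  have hw : w = toMinkowski K y₀ := by
    rw [← sub_eq_zero]
    refine MinkowskiSpace.eq_zero_of_sum_eq_zero _ fun x => ?_
    let f : K →ₗ[ℚ] ℂ := AddMonoidHom.toRatLinearMap
      (∑ φ : K →+* ℂ, (AddMonoidHom.mulLeft ((w - toMinkowski K y₀).coord φ)).comp
        (φ : K →+ ℂ))
    have hf : ∀ x, f x = ∑ φ : K →+* ℂ, (w - toMinkowski K y₀).coord φ * φ x := fun x => by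
      simp [f]
    have hf0 : f = 0 := B.ext fun i => by
      rw [hf]
      simp only [MinkowskiSpace.coord_sub, sub_mul, Finset.sum_sub_distrib, hn,
        toMinkowski_coord, ← map_mul, LinearMap.zero_apply]
      rw [sum_embeddings_eq_trace, hy₀, Basis.constr_basis]
      simp
    rw [← hf, hf0, LinearMap.zero_apply]
  refine ⟨y₀, ?_, hw⟩
  rw [FractionalIdeal.mem_dual hI]
  intro a ha
  obtain ⟨k, hk⟩ := h a ha
  refine ⟨k, ?_⟩
  rw [hw] at hk
  simp only [toMinkowski_coord, ← map_mul] at hk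
  rw [sum_embeddings_eq_trace] at hk
  rw [Algebra.traceForm_apply]
  have : (Algebra.trace ℚ K (y₀ * a) : ℚ) = (k : ℚ) := by exact_mod_cast hk
  rw [this]
  simp

theorem span_range_toMinkowski_basis {ι : Type*} [Fintype ι] (b : Basis ι ℚ K) :
    Submodule.span ℝ (Set.range fun i => toMinkowski K (b i)) = ⊤ := by
  rw [eq_top_iff, ← span_range_toMinkowski, Submodule.span_le]
  rintro _ ⟨x, rfl⟩
  rw [← b.sum_repr x, map_sum]
  refine Submodule.sum_mem _ fun i _ => ?_
  have : toMinkowski K (b.repr x i • b i) = ((b.repr x i : ℚ) : ℝ) • toMinkowski K (b i) := by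
    ext φ
    rw [MinkowskiSpace.coord_smul, toMinkowski_coord, toMinkowski_coord, Algebra.smul_def,
      map_mul]
    simp
  rw [this]
  exact Submodule.smul_mem _ _ (Submodule.subset_span ⟨i, rfl⟩)

/-- The images of an integral basis span over ℝ. They are independent over ℝ because they are
independent over ℂ in the product of copies of ℂ. -/
theorem finrank_minkowskiSpace : finrank ℝ (MinkowskiSpace K) = finrank ℚ K := by
  let b := NumberField.integralBasis K
  have hb : ∀ i, b i = NumberField.RingOfIntegers.basis K i := NumberField.integralBasis_apply K
  have hspan := span_range_toMinkowski_basis b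
  have hli : LinearIndependent ℝ (fun i => toMinkowski K (b i)) := by
    have h1 := ((NumberField.canonicalEmbedding.latticeBasis K).linearIndependent).restrict_scalars
      (R := ℝ) (by intro a b hab; simpa using hab)
    let g : MinkowskiSpace K →ₗ[ℝ] ((K →+* ℂ) → ℂ) :=
      { toFun := fun x φ => x.coord φ
        map_add' := fun x y => rfl
        map_smul' := fun c x => rfl }
    refine LinearIndependent.of_comp g ?_
    convert h1 using 2 with i
    ext φ
    simp [g, hb]
    rfl
  have := (Basis.mk hli hspan.ge)
  rw [finrank_eq_card_basis this, finrank_eq_card_basis b]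

end Minkowski

/-! ### The isometry σ, the determinant form, and coordinates on Λ₀ and PΛ₀ -/

section Plane

open Module FractionalIdeal

variable {K : Type*} [Field K] [NumberField K]

/-- The isometry `(x₁, x₂) ↦ (-conj x₂, conj x₁)` of `K_ℝ²`. -/
noncomputable def planeRotationMap : MinkowskiPlane K →ₗ[ℝ] MinkowskiPlane K where
  toFun x := WithLp.toLp 2 (-minkowskiConj K x.snd, minkowskiConj K x.fst)
  map_add' x y := by
    simp [add_comm]
    rfl
  map_smul' c x := by
    simp only [WithLp.smul_fst, WithLp.smul_snd, map_smul, ← smul_neg]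
    rfl

theorem planeRotationMap_sq (x : MinkowskiPlane K) :
    planeRotationMap (planeRotationMap x) = -x := by
  change WithLp.toLp 2 (-minkowskiConj K (minkowskiConj K x.fst),
    minkowskiConj K (-minkowskiConj K x.snd)) = -x
  rw [map_neg, minkowskiConj_minkowskiConj, minkowskiConj_minkowskiConj]
  rfl

theorem norm_planeRotationMap (x : MinkowskiPlane K) : ‖planeRotationMap x‖ = ‖x‖ := by
  rw [← sq_eq_sq₀ (norm_nonneg _) (norm_nonneg _), WithLp.prod_norm_sq_eq_of_L2,
    WithLp.prod_norm_sq_eq_of_L2]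
  change ‖-minkowskiConj K x.snd‖ ^ 2 + ‖minkowskiConj K x.fst‖ ^ 2 = _
  rw [norm_neg, norm_minkowskiConj, norm_minkowskiConj, add_comm]

noncomputable def planeRotation : MinkowskiPlane K ≃ₗᵢ[ℝ] MinkowskiPlane K where
  toLinearEquiv := LinearEquiv.ofLinearMap planeRotationMap (-planeRotationMap)
    (by ext1 x; simp [planeRotationMap_sq]) (by ext1 x; simp [planeRotationMap_sq])
  norm_map' x := norm_planeRotationMap x

theorem planeRotation_apply (x : MinkowskiPlane K) : planeRotation x = planeRotationMap x := rfl

/-- The conjugations in σ cancel those in the scalar product, leaving the sum over the embeddings of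
a ℂ-bilinear determinant. This form carries all the duality statements. -/
theorem inner_planeRotation (x y : MinkowskiPlane K) :
    ((inner ℝ (planeRotation x) y : ℝ) : ℂ) =
      ∑ φ, (x.fst.coord φ * y.snd.coord φ - x.snd.coord φ * y.fst.coord φ) := by
  have h1 : (inner ℝ (planeRotation x) y : ℝ) =
      -inner ℝ y.fst (minkowskiConj K x.snd) + inner ℝ y.snd (minkowskiConj K x.fst) := by
    rw [WithLp.prod_inner_apply, planeRotation_apply]
    change inner ℝ (-minkowskiConj K x.snd) y.fst + inner ℝ (minkowskiConj K x.fst) y.snd = _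
    rw [inner_neg_left, real_inner_comm, real_inner_comm y.snd]
  rw [h1, Complex.ofReal_add, Complex.ofReal_neg, MinkowskiSpace.inner_eq, MinkowskiSpace.inner_eq,
    ← Finset.sum_neg_distrib, ← Finset.sum_add_distrib]
  refine Finset.sum_congr rfl fun φ _ => ?_
  rw [minkowskiConj_coord, minkowskiConj_coord, Complex.conj_conj, Complex.conj_conj]
  ring

/-- The map `(a, b) ↦ (α⁻¹ a, α b)` from `K²` to `K_ℝ²`. -/
noncomputable def planeMap (α : ℝ) : K × K →ₗ[𝓞 K] MinkowskiPlane K where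
  toFun x := WithLp.toLp 2 (α⁻¹ • toMinkowski K x.1, α • toMinkowski K x.2)
  map_add' x y := by
    simp
    rfl
  map_smul' s x := by
    simp [smul_comm _ s]
    rfl

theorem planeMap_fst (α : ℝ) (x : K × K) : (planeMap α x).fst = α⁻¹ • toMinkowski K x.1 := rfl

theorem planeMap_snd (α : ℝ) (x : K × K) : (planeMap α x).snd = α • toMinkowski K x.2 := rfl

theorem toMinkowski_injective : Function.Injective (toMinkowski K) := by
  intro x y h
  have φ : K →+* ℂ := Classical.choice inferInstance
  exact φ.injective (by rw [← toMinkowski_coord, h, toMinkowski_coord])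

theorem planeMap_injective {α : ℝ} (hα : α ≠ 0) : Function.Injective (planeMap (K := K) α) := by
  intro x y h
  refine Prod.ext ?_ ?_
  · exact toMinkowski_injective (smul_right_injective _ (inv_ne_zero hα)
      (congrArg WithLp.fst h))
  · exact toMinkowski_injective (smul_right_injective _ hα (congrArg WithLp.snd h))

theorem norm_sq_planeMap (α : ℝ) (x : K × K) : ‖planeMap α x‖ ^ 2 =
    (α⁻¹) ^ 2 * ‖toMinkowski K x.1‖ ^ 2 + α ^ 2 * ‖toMinkowski K x.2‖ ^ 2 := by
  rw [WithLp.prod_norm_sq_eq_of_L2, planeMap_fst, planeMap_snd, norm_smul, norm_smul, mul_pow,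
    mul_pow, Real.norm_eq_abs, Real.norm_eq_abs, sq_abs, sq_abs]

theorem inner_planeRotation_planeMap {α : ℝ} (hα : α ≠ 0) (x y : K × K) :
    inner ℝ (planeRotation (planeMap α x)) (planeMap α y) =
      ((Algebra.trace ℚ K (x.1 * y.2 - x.2 * y.1) : ℚ) : ℝ) := by
  have h := inner_planeRotation (planeMap α x) (planeMap α y)
  have h2 := sum_embeddings_eq_trace (x.1 * y.2 - x.2 * y.1)
  have h3 : ((inner ℝ (planeRotation (planeMap α x)) (planeMap α y) : ℝ) : ℂ) =
      (((Algebra.trace ℚ K (x.1 * y.2 - x.2 * y.1) : ℚ) : ℝ) : ℂ) := by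
    rw [h, Complex.ofReal_ratCast, ← h2]
    refine Finset.sum_congr rfl fun φ _ => ?_
    have hα' : (α : ℂ) ≠ 0 := by exact_mod_cast hα
    simp only [planeMap_fst, planeMap_snd, MinkowskiSpace.coord_smul, toMinkowski_coord, map_sub,
      map_mul, Complex.ofReal_inv]
    field_simp
  exact_mod_cast h3

variable (K) in
/-- The fractional ideal of all `x` with `Tr(x y) ∈ ℤ` for every algebraic integer `y`. -/
noncomputable abbrev codifferent : FractionalIdeal (nonZeroDivisors (𝓞 K)) K :=
  FractionalIdeal.dual ℤ ℚ 1

theorem codifferent_ne_zero : codifferent K ≠ 0 := dual_ne_zero ℤ ℚ one_ne_zero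

/-- The fractional ideal `P⁻¹ 𝓞_K^#`. -/
noncomputable abbrev polarIdeal (P : Ideal (𝓞 K)) :
    FractionalIdeal (nonZeroDivisors (𝓞 K)) K :=
  (P : FractionalIdeal (nonZeroDivisors (𝓞 K)) K)⁻¹ * codifferent K

theorem mul_polarIdeal {P : Ideal (𝓞 K)} (hP : P ≠ ⊥) :
    (P : FractionalIdeal (nonZeroDivisors (𝓞 K)) K) * polarIdeal P = codifferent K := by
  rw [← mul_assoc, mul_inv_cancel₀ (coeIdeal_ne_zero.mpr hP), one_mul]

theorem codifferent_le_polarIdeal {P : Ideal (𝓞 K)} (hP : P ≠ ⊥) :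
    codifferent K ≤ polarIdeal P := by
  rw [← mul_polarIdeal hP]
  calc (P : FractionalIdeal (nonZeroDivisors (𝓞 K)) K) * polarIdeal P ≤ 1 * polarIdeal P := by
        gcongr; exact coeIdeal_le_one
    _ = _ := one_mul _

theorem mem_baseLattice {P : Ideal (𝓞 K)} {x : MinkowskiPlane K} :
    x ∈ baseLattice P ↔ ∃ a ∈ (1 : FractionalIdeal (nonZeroDivisors (𝓞 K)) K),
      ∃ b ∈ polarIdeal P, planeMap (scalingFactor P) (a, b) = x := by
  have h : x ∈ baseLattice P ↔ x.fst ∈ (scalingFactor P)⁻¹ • idealLattice K 1 ∧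
      x.snd ∈ scalingFactor P • idealLattice K (polarIdeal P) := Iff.rfl
  rw [h, Submodule.mem_smul_pointwise_iff_exists, Submodule.mem_smul_pointwise_iff_exists]
  constructor
  · rintro ⟨⟨_, ⟨a, ha, rfl⟩, h1⟩, ⟨_, ⟨b, hb, rfl⟩, h2⟩⟩
    exact ⟨a, ha, b, hb, by
      refine (WithLp.equiv 2 _).injective (Prod.ext h1 h2)⟩
  · rintro ⟨a, ha, b, hb, rfl⟩
    exact ⟨⟨_, ⟨a, ha, rfl⟩, rfl⟩, ⟨_, ⟨b, hb, rfl⟩, rfl⟩⟩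

theorem planeMap_mem_baseLattice {P : Ideal (𝓞 K)} {a b : K}
    (ha : a ∈ (1 : FractionalIdeal (nonZeroDivisors (𝓞 K)) K)) (hb : b ∈ polarIdeal P) :
    planeMap (scalingFactor P) (a, b) ∈ baseLattice P :=
  mem_baseLattice.mpr ⟨a, ha, b, hb, rfl⟩

/-- Multiplication by P turns the factors 𝓞_K and P⁻¹𝓞_K^# of Λ₀ into P and 𝓞_K^#. -/
theorem mem_smul_top_baseLattice {P : Ideal (𝓞 K)} (hP : P ≠ ⊥) {x : baseLattice P} :
    x ∈ (P • ⊤ : Submodule (𝓞 K) (baseLattice P)) ↔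
      ∃ a ∈ (P : FractionalIdeal (nonZeroDivisors (𝓞 K)) K),
      ∃ b ∈ codifferent K, planeMap (scalingFactor P) (a, b) = x := by
  constructor
  · intro hx
    induction hx using Submodule.smul_induction_on' with
    | smul p hp y _ =>
      obtain ⟨a, ha, b, hb, h⟩ := mem_baseLattice.mp y.2
      obtain ⟨a, rfl⟩ := (mem_one_iff _).mp ha
      refine ⟨p • algebraMap _ _ a, ?_, p • b, ?_, ?_⟩
      · rw [mem_coeIdeal]
        exact ⟨p * a, P.mul_mem_right _ hp, by rw [map_mul, Algebra.smul_def]⟩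
      · rw [← mul_polarIdeal hP, Algebra.smul_def]
        exact mul_mem_mul ((mem_coeIdeal _).mpr ⟨p, hp, rfl⟩) hb
      · change planeMap _ (p • (algebraMap _ _ a, b)) = p • (y : MinkowskiPlane K)
        rw [map_smul, h]
    | add y hy z hz h1 h2 =>
      obtain ⟨a, ha, b, hb, h⟩ := h1
      obtain ⟨a', ha', b', hb', h'⟩ := h2
      refine ⟨a + a', Submodule.add_mem _ ha ha', b + b', Submodule.add_mem _ hb hb', ?_⟩
      change planeMap _ ((a, b) + (a', b')) = (y : MinkowskiPlane K) + z
      rw [map_add, h, h']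
  · rintro ⟨a, ha, b, hb, h⟩
    have key : ∀ b ∈ (P : FractionalIdeal (nonZeroDivisors (𝓞 K)) K) * polarIdeal P,
        ∃ y ∈ (P • ⊤ : Submodule (𝓞 K) (baseLattice P)),
          (y : MinkowskiPlane K) = planeMap (scalingFactor P) (0, b) := by
      intro b hb
      refine FractionalIdeal.mul_induction_on hb (fun i hi j hj => ?_) (fun i j h1 h2 => ?_)
      · obtain ⟨p, hp, rfl⟩ := (mem_coeIdeal _).mp hi
        refine ⟨p • ⟨_, planeMap_mem_baseLattice (zero_mem _) hj⟩,
          Submodule.smul_mem_smul hp Submodule.mem_top, ?_⟩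
        change p • planeMap _ _ = _
        rw [← map_smul, Prod.smul_mk, smul_zero, Algebra.smul_def]
      · obtain ⟨y, hy, h1⟩ := h1
        obtain ⟨z, hz, h2⟩ := h2
        refine ⟨y + z, Submodule.add_mem _ hy hz, ?_⟩
        rw [Submodule.coe_add, h1, h2, ← map_add, Prod.mk_add_mk, add_zero]
    obtain ⟨y, hy, hyb⟩ := key b (by rw [mul_polarIdeal hP]; exact hb)
    obtain ⟨p, hp, rfl⟩ := (mem_coeIdeal _).mp ha
    have h1 : x = p • (⟨_, planeMap_mem_baseLattice (one_mem_one _) (zero_mem _)⟩ :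
        baseLattice P) + y := by
      refine Subtype.ext ?_
      change (x : MinkowskiPlane K) = p • planeMap _ _ + (y : MinkowskiPlane K)
      rw [hyb, ← map_smul, ← map_add, ← h]
      congr 1
      simp [Algebra.smul_def]
    rw [h1]
    exact Submodule.add_mem _ (Submodule.smul_mem_smul hp Submodule.mem_top) hy

end Plane

/-! ### Λ₀/PΛ₀ as a plane over the residue field -/

section Lines

open Module FractionalIdeal

variable {K : Type*} [Field K] [NumberField K]

/-- J/PJ is a line over 𝓞_K/P. The ideal X = (x) + PJ lies between PJ and J, so XJ⁻¹ is an integral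
ideal containing P. It differs from P because x ∉ PJ, hence equals 𝓞_K by maximality. -/
theorem exists_sub_smul_mem {P : Ideal (𝓞 K)} (hP : P.IsMaximal)
    {J : FractionalIdeal (nonZeroDivisors (𝓞 K)) K} (hJ : J ≠ 0) {x : K} (hx : x ∈ J)
    (hxP : x ∉ (P : FractionalIdeal (nonZeroDivisors (𝓞 K)) K) * J) {y : K} (hy : y ∈ J) :
    ∃ s : 𝓞 K, y - s • x ∈ (P : FractionalIdeal (nonZeroDivisors (𝓞 K)) K) * J := by
  set X := spanSingleton (nonZeroDivisors (𝓞 K)) x +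
    (P : FractionalIdeal (nonZeroDivisors (𝓞 K)) K) * J
  have hPJ : (P : FractionalIdeal (nonZeroDivisors (𝓞 K)) K) * J ≤ J := by
    calc (P : FractionalIdeal (nonZeroDivisors (𝓞 K)) K) * J ≤ 1 * J := by
          gcongr; exact coeIdeal_le_one
      _ = J := one_mul _
  have hXJ : X ≤ J := by
    rw [show X = spanSingleton (nonZeroDivisors (𝓞 K)) x ⊔ _ from (sup_eq_add _ _).symm]
    exact sup_le (spanSingleton_le_iff_mem.mpr hx) hPJ
  have hX1 : X * J⁻¹ ≤ 1 := by
    calc X * J⁻¹ ≤ J * J⁻¹ := by gcongr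
      _ = 1 := mul_inv_cancel₀ hJ
  obtain ⟨Y, hY⟩ := le_one_iff_exists_coeIdeal.mp hX1
  have hXY : X = (Y : FractionalIdeal (nonZeroDivisors (𝓞 K)) K) * J := by
    rw [hY, mul_assoc, inv_mul_cancel₀ hJ, mul_one]
  have hPY : P ≤ Y := by
    rw [← coeIdeal_le_coeIdeal K, hY]
    calc (P : FractionalIdeal (nonZeroDivisors (𝓞 K)) K) = P * J * J⁻¹ := by
          rw [mul_assoc, mul_inv_cancel₀ hJ, mul_one]
      _ ≤ X * J⁻¹ := by
          gcongr
          exact le_add_of_nonneg_left (zero_le _)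
  have hxX : x ∈ X := by
    rw [show X = spanSingleton (nonZeroDivisors (𝓞 K)) x ⊔ _ from (sup_eq_add _ _).symm]
    exact (le_sup_left : _ ≤ spanSingleton (nonZeroDivisors (𝓞 K)) x ⊔ _)
      (mem_spanSingleton_self _ x)
  have hYtop : Y = ⊤ := by
    by_contra h
    rw [hP.eq_of_le h hPY, ← hXY] at hxP
    exact hxP hxX
  have hXJ' : X = J := by rw [hXY, hYtop, coeIdeal_top, one_mul]
  rw [← hXJ'] at hy
  obtain ⟨u, hu, v, hv, huv⟩ := (mem_add _ _ _).mp hy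
  obtain ⟨s, rfl⟩ := (mem_spanSingleton _).mp hu
  exact ⟨s, by rw [← huv, add_sub_cancel_left]; exact hv⟩

theorem polarIdeal_ne_zero {P : Ideal (𝓞 K)} (hP : P ≠ ⊥) : polarIdeal P ≠ 0 :=
  mul_ne_zero (inv_ne_zero (coeIdeal_ne_zero.mpr hP)) codifferent_ne_zero

theorem exists_sub_smul_mem_prime {P : Ideal (𝓞 K)} (hP : P.IsMaximal) {x y : K}
    (hx : x ∈ (1 : FractionalIdeal (nonZeroDivisors (𝓞 K)) K))
    (hxP : x ∉ (P : FractionalIdeal (nonZeroDivisors (𝓞 K)) K))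
    (hy : y ∈ (1 : FractionalIdeal (nonZeroDivisors (𝓞 K)) K)) :
    ∃ s : 𝓞 K, y - s • x ∈ (P : FractionalIdeal (nonZeroDivisors (𝓞 K)) K) := by
  have := exists_sub_smul_mem hP one_ne_zero hx (by rwa [mul_one]) hy
  rwa [mul_one] at this

theorem exists_sub_smul_mem_codifferent {P : Ideal (𝓞 K)} (hP : P.IsMaximal) (hP0 : P ≠ ⊥)
    {x y : K} (hx : x ∈ polarIdeal P) (hxP : x ∉ codifferent K) (hy : y ∈ polarIdeal P) :
    ∃ s : 𝓞 K, y - s • x ∈ codifferent K := by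
  have := exists_sub_smul_mem hP (polarIdeal_ne_zero hP0) hx (by rwa [mul_polarIdeal hP0]) hy
  rwa [mul_polarIdeal hP0] at this

theorem mul_mem_codifferent_of_mem_one {x d : K}
    (hx : x ∈ (1 : FractionalIdeal (nonZeroDivisors (𝓞 K)) K)) (hd : d ∈ codifferent K) :
    x * d ∈ codifferent K := by
  have := mul_mem_mul hx hd
  rwa [one_mul] at this

theorem mul_mem_codifferent_of_mem_prime {P : Ideal (𝓞 K)} (hP0 : P ≠ ⊥) {x b : K}
    (hx : x ∈ (P : FractionalIdeal (nonZeroDivisors (𝓞 K)) K)) (hb : b ∈ polarIdeal P) :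
    x * b ∈ codifferent K := by
  have := mul_mem_mul hx hb
  rwa [mul_polarIdeal hP0] at this

/-- The product 𝓞_K/P × P⁻¹𝓞_K^#/𝓞_K^# → P⁻¹𝓞_K^#/𝓞_K^# has no zero divisors: an x outside P is
invertible modulo P. This is the nondegeneracy of the determinant form modulo P. -/
theorem mem_prime_or_mem_codifferent {P : Ideal (𝓞 K)} (hP : P.IsMaximal) (hP0 : P ≠ ⊥) {x b : K}
    (hx : x ∈ (1 : FractionalIdeal (nonZeroDivisors (𝓞 K)) K)) (hb : b ∈ polarIdeal P)
    (h : x * b ∈ codifferent K) :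
    x ∈ (P : FractionalIdeal (nonZeroDivisors (𝓞 K)) K) ∨ b ∈ codifferent K := by
  by_contra! hcon
  obtain ⟨s, hs⟩ := exists_sub_smul_mem_prime hP hx hcon.1 (one_mem_one _)
  refine hcon.2 ?_
  have h1 := mul_mem_codifferent_of_mem_prime hP0 hs hb
  have h2 : b = (1 - s • x) * b + s • (x * b) := by
    rw [Algebra.smul_def, Algebra.smul_def]; ring
  rw [h2]
  exact Submodule.add_mem _ h1 (Submodule.smul_mem _ s h)

theorem scalingFactor_pos {P : Ideal (𝓞 K)} (hP0 : P ≠ ⊥) : 0 < scalingFactor P := by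
  have h1 : 0 < Nat.card (𝓞 K ⧸ P) := by
    have := Ideal.finiteQuotientOfFreeOfNeBot P hP0
    exact Nat.card_pos
  have h2 : (NumberField.discr K : ℝ) ≠ 0 := by exact_mod_cast NumberField.discr_ne_zero K
  unfold scalingFactor
  positivity

theorem mem_codeLattice {P : Ideal (𝓞 K)} {C : Submodule (𝓞 K ⧸ P) (CodeSpace P)}
    {x : MinkowskiPlane K} : x ∈ codeLattice P C ↔ ∃ y : baseLattice P,
      Submodule.mkQ (P • ⊤ : Submodule (𝓞 K) (baseLattice P)) y ∈ C ∧ (y : MinkowskiPlane K) = x :=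
  Iff.rfl

/-- The elements of `Λ_C`, where `C` is the line spanned by the class of `(a', b')`. -/
theorem exists_mem_codeLattice_iff {P : Ideal (𝓞 K)} (hP : P.IsMaximal) (hP0 : P ≠ ⊥)
    {C : Submodule (𝓞 K ⧸ P) (CodeSpace P)} (hC : finrank (𝓞 K ⧸ P) C = 1) :
    ∃ a' ∈ (1 : FractionalIdeal (nonZeroDivisors (𝓞 K)) K), ∃ b' ∈ polarIdeal P,
      ¬ (a' ∈ (P : FractionalIdeal (nonZeroDivisors (𝓞 K)) K) ∧ b' ∈ codifferent K) ∧
      ∀ x, x ∈ codeLattice P C ↔ ∃ s : 𝓞 K,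
        ∃ a ∈ (P : FractionalIdeal (nonZeroDivisors (𝓞 K)) K), ∃ b ∈ codifferent K,
          x = planeMap (scalingFactor P) (s • a' + a, s • b' + b) := by
  let _ := Ideal.Quotient.field P
  obtain ⟨⟨c, hc⟩, hc0, hcs⟩ := finrank_eq_one_iff'.mp hC
  obtain ⟨⟨y, hy⟩, rfl⟩ := Submodule.mkQ_surjective _ c
  obtain ⟨a', ha', b', hb', rfl⟩ := mem_baseLattice.mp hy
  refine ⟨a', ha', b', hb', ?_, fun x => ⟨?_, ?_⟩⟩
  · rintro ⟨h1, h2⟩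
    refine hc0 (Subtype.ext ?_)
    exact (Submodule.Quotient.mk_eq_zero _).mpr
      ((mem_smul_top_baseLattice hP0).mpr ⟨a', h1, b', h2, rfl⟩)
  · rintro ⟨y, hyC, rfl⟩
    obtain ⟨r, hr⟩ := hcs ⟨_, hyC⟩
    obtain ⟨s, rfl⟩ := Ideal.Quotient.mk_surjective r
    have h1 : Submodule.mkQ (P • ⊤ : Submodule (𝓞 K) (baseLattice P))
        (s • ⟨_, hy⟩) = Submodule.mkQ _ y := congrArg Subtype.val hr
    have h2 := (Submodule.Quotient.eq _).mp h1.symm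
    obtain ⟨a, ha, b, hb, hab⟩ := (mem_smul_top_baseLattice hP0).mp h2
    refine ⟨s, a, ha, b, hb, ?_⟩
    have h3 : (y : MinkowskiPlane K) = s • planeMap (scalingFactor P) (a', b') +
        planeMap (scalingFactor P) (a, b) := by
      rw [hab]
      change (y : MinkowskiPlane K) = s • planeMap (scalingFactor P) (a', b') +
        (y - s • planeMap (scalingFactor P) (a', b'))
      abel
    refine h3.trans ?_
    rw [← map_smul, ← map_add]
    rfl
  · rintro ⟨s, a, ha, b, hb, rfl⟩
    have hP1 : a ∈ (1 : FractionalIdeal (nonZeroDivisors (𝓞 K)) K) := coeIdeal_le_one ha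
    have hbJ := codifferent_le_polarIdeal hP0 hb
    refine ⟨s • ⟨_, hy⟩ + ⟨_, planeMap_mem_baseLattice hP1 hbJ⟩, ?_, ?_⟩
    · have h0 : Submodule.mkQ (P • ⊤ : Submodule (𝓞 K) (baseLattice P))
          ⟨_, planeMap_mem_baseLattice hP1 hbJ⟩ = 0 :=
        (Submodule.Quotient.mk_eq_zero _).mpr
          ((mem_smul_top_baseLattice hP0).mpr ⟨a, ha, b, hb, rfl⟩)
      change Submodule.mkQ _ (_ + _) ∈ C
      rw [map_add, h0, add_zero]
      exact C.smul_mem (Ideal.Quotient.mk P s) hc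
    · change s • planeMap (scalingFactor P) (a', b') + planeMap (scalingFactor P) (a, b) = _
      rw [← map_smul, ← map_add]
      rfl

theorem exists_polarIdeal_not_mem {P : Ideal (𝓞 K)} (hP : P.IsMaximal) (hP0 : P ≠ ⊥) :
    ∃ b ∈ polarIdeal P, b ∉ codifferent K := by
  by_contra! hcon
  have h1 : polarIdeal P ≤ codifferent K := hcon
  have h2 : (P : FractionalIdeal (nonZeroDivisors (𝓞 K)) K) * polarIdeal P = 1 * polarIdeal P := by
    rw [one_mul, mul_polarIdeal hP0]
    exact le_antisymm (codifferent_le_polarIdeal hP0) h1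
  have h3 := mul_right_cancel₀ (polarIdeal_ne_zero hP0) h2
  rw [coeIdeal_eq_one] at h3
  exact hP.ne_top (by rw [h3, Ideal.one_eq_top])

/-- The classes of (1, 0) and (0, j), with j in P⁻¹𝓞_K^# but not in 𝓞_K^#, form a basis. The
dimension 2 gives the number q + 1 of lines. -/
theorem finrank_codeSpace {P : Ideal (𝓞 K)} (hP : P.IsMaximal) (hP0 : P ≠ ⊥) :
    finrank (𝓞 K ⧸ P) (CodeSpace P) = 2 := by
  let _ := Ideal.Quotient.field P
  obtain ⟨j, hj, hjD⟩ := exists_polarIdeal_not_mem hP hP0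
  let e₁ : CodeSpace P := Submodule.mkQ _
    ⟨_, planeMap_mem_baseLattice (one_mem_one _) (zero_mem (polarIdeal P))⟩
  let e₂ : CodeSpace P := Submodule.mkQ _ ⟨_, planeMap_mem_baseLattice (zero_mem _) hj⟩
  have hcomb : ∀ (s t : 𝓞 K) (a b : K) (hab : planeMap (scalingFactor P) (a, b) ∈ baseLattice P),
      Submodule.mkQ (P • ⊤ : Submodule (𝓞 K) (baseLattice P)) ⟨_, hab⟩ =
        Ideal.Quotient.mk P s • e₁ + Ideal.Quotient.mk P t • e₂ ↔
      a - s • 1 ∈ (P : FractionalIdeal (nonZeroDivisors (𝓞 K)) K) ∧ b - t • j ∈ codifferent K := by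
    intro s t a b hab
    have h1 : Ideal.Quotient.mk P s • e₁ + Ideal.Quotient.mk P t • e₂ =
        Submodule.mkQ (P • ⊤ : Submodule (𝓞 K) (baseLattice P))
          (s • ⟨_, planeMap_mem_baseLattice (one_mem_one _) (zero_mem (polarIdeal P))⟩ +
            t • ⟨_, planeMap_mem_baseLattice (zero_mem _) hj⟩) := rfl
    rw [h1]
    refine (Submodule.Quotient.eq _).trans ?_
    rw [mem_smul_top_baseLattice hP0]
    have h2 : ((⟨planeMap (scalingFactor P) (a, b), hab⟩ -
        (s • ⟨_, planeMap_mem_baseLattice (one_mem_one _) (zero_mem (polarIdeal P))⟩ +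
            t • ⟨_, planeMap_mem_baseLattice (zero_mem _) hj⟩) : baseLattice P) :
              MinkowskiPlane K) = planeMap (scalingFactor P) (a - s • 1, b - t • j) := by
      change planeMap (scalingFactor P) (a, b) - (s • planeMap (scalingFactor P) (1, 0) +
        t • planeMap (scalingFactor P) (0, j)) = _
      rw [← map_smul, ← map_smul, ← map_add, ← map_sub]
      simp
    rw [h2]
    constructor
    · rintro ⟨c, hc, d, hd, h⟩
      have := planeMap_injective (scalingFactor_pos hP0).ne' h
      rw [Prod.mk.injEq] at this
      rw [← this.1, ← this.2]
      exact ⟨hc, hd⟩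
    · rintro ⟨h1, h2⟩
      exact ⟨_, h1, _, h2, rfl⟩
  have hli : LinearIndependent (𝓞 K ⧸ P) ![e₁, e₂] := by
    rw [LinearIndependent.pair_iff]
    intro r t hrt
    obtain ⟨r, rfl⟩ := Ideal.Quotient.mk_surjective r
    obtain ⟨t, rfl⟩ := Ideal.Quotient.mk_surjective t
    have h0 : planeMap (scalingFactor P) ((0 : K), (0 : K)) ∈ baseLattice P :=
      planeMap_mem_baseLattice (zero_mem _) (zero_mem _)
    have h1 : Submodule.mkQ (P • ⊤ : Submodule (𝓞 K) (baseLattice P)) ⟨_, h0⟩ = 0 := by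
      refine (Submodule.Quotient.mk_eq_zero _).mpr ?_
      exact (mem_smul_top_baseLattice hP0).mpr ⟨0, zero_mem _, 0, zero_mem _, rfl⟩
    obtain ⟨h2, h3⟩ := (hcomb r t 0 0 h0).mp (by rw [h1, hrt])
    rw [zero_sub, ← neg_smul] at h2 h3
    constructor
    · rw [Ideal.Quotient.eq_zero_iff_mem]
      rw [Algebra.smul_def, mul_one, mem_coeIdeal] at h2
      obtain ⟨x, hx, hxr⟩ := h2
      have := FaithfulSMul.algebraMap_injective (𝓞 K) K hxr
      rw [this] at hx
      exact neg_mem_iff.mp hx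
    · rw [Ideal.Quotient.eq_zero_iff_mem]
      rw [Algebra.smul_def] at h3
      rcases mem_prime_or_mem_codifferent hP hP0 ((mem_one_iff _).mpr ⟨_, rfl⟩) hj h3 with h | h
      · obtain ⟨x, hx, hxr⟩ := (mem_coeIdeal _).mp h
        have := FaithfulSMul.algebraMap_injective (𝓞 K) K hxr
        rw [this] at hx
        exact neg_mem_iff.mp hx
      · exact absurd h hjD
  have hspan : ⊤ ≤ Submodule.span (𝓞 K ⧸ P) (Set.range ![e₁, e₂]) := by
    rintro v -
    obtain ⟨⟨y, hy⟩, rfl⟩ := Submodule.mkQ_surjective _ v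
    obtain ⟨a, ha, b, hb, rfl⟩ := mem_baseLattice.mp hy
    obtain ⟨t, ht⟩ := exists_sub_smul_mem_codifferent hP hP0 hj hjD hb
    obtain ⟨s, rfl⟩ := (mem_one_iff _).mp ha
    rw [(hcomb s t _ b hy).mpr ⟨by rw [Algebra.smul_def, mul_one, sub_self]; exact zero_mem _, ht⟩]
    refine Submodule.add_mem _ (Submodule.smul_mem _ _ (Submodule.subset_span ⟨0, rfl⟩))
      (Submodule.smul_mem _ _ (Submodule.subset_span ⟨1, rfl⟩))
  rw [finrank_eq_card_basis (Basis.mk hli hspan), Fintype.card_fin]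

end Lines

/-! ### The lattices Λ_C are symplectic -/

section Symplectic

open Module FractionalIdeal

/-- A subgroup pairing integrally with a spanning set is discrete. -/
theorem discreteTopology_of_integral_pairing {E : Type*} [NormedAddCommGroup E]
    [InnerProductSpace ℝ E] [FiniteDimensional ℝ E] (σ : E ≃ₗᵢ[ℝ] E) (M : Submodule ℤ E)
    (S : Set E) (hS : Submodule.span ℝ S = ⊤)
    (h : ∀ x ∈ M, ∀ y ∈ S, ∃ k : ℤ, inner ℝ (σ x) y = (k : ℝ)) : DiscreteTopology M := by
  obtain ⟨s, hsS, hspan, hli⟩ := exists_linearIndependent ℝ S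
  have hfin : s.Finite := hli.setFinite
  obtain ⟨R, hR, hRs⟩ : ∃ R : ℝ, 0 < R ∧ ∀ y ∈ s, ‖y‖ < R := by
    obtain ⟨R, hR⟩ := hfin.isBounded.exists_norm_le
    exact ⟨max R 0 + 1, by positivity, fun y hy => by
      have := hR y hy; have := le_max_left R 0; linarith⟩
  -- A vector shorter than 1/R has integral pairings of absolute value less than 1 with a finite
  -- spanning set, so all of them vanish.
  have key : ∀ x ∈ M, ‖x‖ < R⁻¹ → x = 0 := by
    intro x hx hxR
    have h0 : σ x = 0 := by
      rw [← inner_self_eq_zero (𝕜 := ℝ)]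
      have hv : ∀ v ∈ Submodule.span ℝ s, inner ℝ (σ x) v = 0 := by
        intro v hv
        induction hv using Submodule.span_induction with
        | zero => simp
        | add u v _ _ hu hv => rw [inner_add_right, hu, hv, add_zero]
        | smul c u _ hu => rw [real_inner_smul_right, hu, mul_zero]
        | mem y hy =>
          obtain ⟨k, hk⟩ := h x hx y (hsS hy)
          have h1 := abs_real_inner_le_norm (σ x) y
          rw [hk, σ.norm_map] at h1
          have h2 : ‖x‖ * ‖y‖ < 1 := by
            calc ‖x‖ * ‖y‖ ≤ ‖x‖ * R := by gcongr; exact (hRs y hy).le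
              _ < R⁻¹ * R := by gcongr
              _ = 1 := inv_mul_cancel₀ hR.ne'
          have h3 : |k| < 1 := by exact_mod_cast h1.trans_lt h2
          rw [hk, Int.abs_lt_one_iff.mp h3, Int.cast_zero]
      exact hv _ (by rw [hspan, hS]; trivial)
    simpa using h0
  refine discreteTopology_of_isOpen_singleton_zero (Metric.isOpen_iff.mpr ?_)
  rintro x rfl
  refine ⟨R⁻¹, inv_pos.mpr hR, fun y hy => ?_⟩
  rw [mem_ball_zero_iff] at hy
  exact Subtype.ext (key y y.2 hy)

theorem MinkowskiSpace.coord_zero {K : Type*} [Field K] [NumberField K] (φ : K →+* ℂ) :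
    (0 : MinkowskiSpace K).coord φ = 0 := rfl

theorem FractionalIdeal.add_mem_of_mem {R L : Type*} [CommRing R] [CommRing L] [Algebra R L]
    {S : Submonoid R} {I : FractionalIdeal S L} {x y : L} (hx : x ∈ I) (hy : y ∈ I) : x + y ∈ I :=
  Submodule.add_mem (I : Submodule R L) hx hy

theorem FractionalIdeal.sub_mem_of_mem {R L : Type*} [CommRing R] [CommRing L] [Algebra R L]
    {S : Submonoid R} {I : FractionalIdeal S L} {x y : L} (hx : x ∈ I) (hy : y ∈ I) : x - y ∈ I :=
  Submodule.sub_mem (I : Submodule R L) hx hy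

theorem FractionalIdeal.neg_mem_of_mem {R L : Type*} [CommRing R] [CommRing L] [Algebra R L]
    {S : Submonoid R} {I : FractionalIdeal S L} {x : L} (hx : x ∈ I) : -x ∈ I :=
  Submodule.neg_mem (I : Submodule R L) hx

variable {K : Type*} [Field K] [NumberField K]

theorem span_toMinkowski_fractionalIdeal {I : FractionalIdeal (nonZeroDivisors (𝓞 K)) K}
    (hI : I ≠ 0) : Submodule.span ℝ (toMinkowski K '' (I : Set K)) = ⊤ := by
  rw [eq_top_iff, ← span_range_toMinkowski_basis
    (NumberField.basisOfFractionalIdeal K (Units.mk0 I hI))]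
  refine Submodule.span_mono ?_
  rintro _ ⟨i, rfl⟩
  refine ⟨_, ?_, rfl⟩
  rw [NumberField.basisOfFractionalIdeal_apply]
  exact (NumberField.fractionalIdealBasis K _ i).2

theorem span_planeMap {α : ℝ} (hα : α ≠ 0) {S T : Set K}
    (hS : Submodule.span ℝ (toMinkowski K '' S) = ⊤)
    (hT : Submodule.span ℝ (toMinkowski K '' T) = ⊤) :
    Submodule.span ℝ ((fun a => planeMap α (a, (0 : K))) '' S ∪
      (fun b => planeMap α ((0 : K), b)) '' T) = ⊤ := by
  set V := Submodule.span ℝ ((fun a => planeMap α (a, (0 : K))) '' S ∪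
      (fun b => planeMap α ((0 : K), b)) '' T)
  let e := (WithLp.linearEquiv 2 ℝ (MinkowskiSpace K × MinkowskiSpace K)).symm.toLinearMap
  let f := e ∘ₗ LinearMap.inl ℝ (MinkowskiSpace K) (MinkowskiSpace K)
  let g := e ∘ₗ LinearMap.inr ℝ (MinkowskiSpace K) (MinkowskiSpace K)
  have hf : ⊤ ≤ V.comap f := by
    rw [← hS, Submodule.span_le]
    rintro _ ⟨a, ha, rfl⟩
    have h1 : f (toMinkowski K a) = α • planeMap α (a, (0 : K)) := by
      refine (WithLp.equiv 2 _).injective (Prod.ext ?_ ?_)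
      · change toMinkowski K a = α • α⁻¹ • toMinkowski K a
        rw [smul_inv_smul₀ hα]
      · change 0 = α • α • toMinkowski K 0
        simp
    change f _ ∈ V
    rw [h1]
    exact V.smul_mem _ (Submodule.subset_span (Or.inl ⟨a, ha, rfl⟩))
  have hg : ⊤ ≤ V.comap g := by
    rw [← hT, Submodule.span_le]
    rintro _ ⟨a, ha, rfl⟩
    have h1 : g (toMinkowski K a) = α⁻¹ • planeMap α ((0 : K), a) := by
      refine (WithLp.equiv 2 _).injective (Prod.ext ?_ ?_)
      · change 0 = α⁻¹ • α⁻¹ • toMinkowski K 0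
        simp
      · change toMinkowski K a = α⁻¹ • α • toMinkowski K a
        rw [inv_smul_smul₀ hα]
    change g _ ∈ V
    rw [h1]
    exact V.smul_mem _ (Submodule.subset_span (Or.inr ⟨a, ha, rfl⟩))
  rw [eq_top_iff]
  intro x _
  have : x = f x.fst + g x.snd := by
    refine (WithLp.equiv 2 _).injective (Prod.ext ?_ ?_)
    · change x.fst = x.fst + 0
      rw [add_zero]
    · change x.snd = 0 + x.snd
      rw [zero_add]
  rw [this]
  exact V.add_mem (hf trivial) (hg trivial)

theorem exists_int_trace_of_mem_codifferent {d : K} (hd : d ∈ codifferent K) :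
    ∃ k : ℤ, ((Algebra.trace ℚ K d : ℚ) : ℝ) = k := by
  obtain ⟨k, hk⟩ := (mem_dual (one_ne_zero : (1 : FractionalIdeal (nonZeroDivisors (𝓞 K)) K) ≠ 0)).mp hd 1 (one_mem_one _)
  refine ⟨k, ?_⟩
  rw [Algebra.traceForm_apply, mul_one] at hk
  rw [← hk]
  simp

/-- The lattice `P Λ₀` as a set of vectors. -/
theorem span_prime_baseLattice {P : Ideal (𝓞 K)} (hP0 : P ≠ ⊥) :
    Submodule.span ℝ ((fun a => planeMap (scalingFactor P) (a, (0 : K))) ''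
        ((P : FractionalIdeal (nonZeroDivisors (𝓞 K)) K) : Set K) ∪
      (fun b => planeMap (scalingFactor P) ((0 : K), b)) '' (codifferent K : Set K)) = ⊤ :=
  span_planeMap (scalingFactor_pos hP0).ne'
    (span_toMinkowski_fractionalIdeal (coeIdeal_ne_zero.mpr hP0))
    (span_toMinkowski_fractionalIdeal codifferent_ne_zero)

variable {P : Ideal (𝓞 K)}

/-- The determinant form is integral between Λ₀ and PΛ₀, and PΛ₀ spans the space. -/
theorem discreteTopology_baseLattice (hP0 : P ≠ ⊥) :
    DiscreteTopology ((baseLattice P).restrictScalars ℤ) := by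
  refine discreteTopology_of_integral_pairing planeRotation _ _ (span_prime_baseLattice hP0) ?_
  intro x hx y hy
  obtain ⟨a, ha, b, hb, rfl⟩ := mem_baseLattice.mp hx
  rcases hy with ⟨c, hc, rfl⟩ | ⟨d, hd, rfl⟩
  · rw [inner_planeRotation_planeMap (scalingFactor_pos hP0).ne']
    refine exists_int_trace_of_mem_codifferent ?_
    have := mul_mem_codifferent_of_mem_prime hP0 hc hb
    rw [mul_zero, zero_sub, mul_comm]
    exact neg_mem_of_mem this
  · rw [inner_planeRotation_planeMap (scalingFactor_pos hP0).ne']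
    refine exists_int_trace_of_mem_codifferent ?_
    rw [mul_zero, sub_zero]
    exact mul_mem_codifferent_of_mem_one ha hd

theorem span_baseLattice (hP0 : P ≠ ⊥) :
    Submodule.span ℝ ((baseLattice P).restrictScalars ℤ : Set (MinkowskiPlane K)) = ⊤ := by
  rw [eq_top_iff, ← span_prime_baseLattice hP0]
  refine Submodule.span_mono (Set.union_subset ?_ ?_)
  · rintro _ ⟨a, ha, rfl⟩
    exact planeMap_mem_baseLattice (coeIdeal_le_one ha) (zero_mem _)
  · rintro _ ⟨b, hb, rfl⟩
    exact planeMap_mem_baseLattice (zero_mem _) (codifferent_le_polarIdeal hP0 hb)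

theorem codeLattice_le (C : Submodule (𝓞 K ⧸ P) (CodeSpace P)) :
    codeLattice P C ≤ (baseLattice P).restrictScalars ℤ := by
  intro x hx
  obtain ⟨y, -, rfl⟩ := mem_codeLattice.mp hx
  exact y.2

theorem prime_smul_mem_codeLattice (hP0 : P ≠ ⊥) (C : Submodule (𝓞 K ⧸ P) (CodeSpace P))
    {a b : K} (ha : a ∈ (P : FractionalIdeal (nonZeroDivisors (𝓞 K)) K)) (hb : b ∈ codifferent K) :
    planeMap (scalingFactor P) (a, b) ∈ codeLattice P C := by
  refine mem_codeLattice.mpr ⟨⟨_, planeMap_mem_baseLattice (coeIdeal_le_one ha)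
    (codifferent_le_polarIdeal hP0 hb)⟩, ?_, rfl⟩
  have h0 := (Submodule.Quotient.mk_eq_zero _).mpr
      ((mem_smul_top_baseLattice (x := ⟨_, planeMap_mem_baseLattice (coeIdeal_le_one ha)
    (codifferent_le_polarIdeal hP0 hb)⟩) hP0).mpr ⟨a, ha, b, hb, rfl⟩)
  rw [Submodule.mkQ_apply, h0]
  exact zero_mem C

theorem span_codeLattice (hP0 : P ≠ ⊥) (C : Submodule (𝓞 K ⧸ P) (CodeSpace P)) :
    Submodule.span ℝ (codeLattice P C : Set (MinkowskiPlane K)) = ⊤ := by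
  rw [eq_top_iff, ← span_prime_baseLattice hP0]
  refine Submodule.span_mono (Set.union_subset ?_ ?_)
  · rintro _ ⟨a, ha, rfl⟩
    exact prime_smul_mem_codeLattice hP0 C ha (zero_mem _)
  · rintro _ ⟨b, hb, rfl⟩
    exact prime_smul_mem_codeLattice hP0 C (zero_mem _) hb

theorem discreteTopology_codeLattice (hP0 : P ≠ ⊥) (C : Submodule (𝓞 K ⧸ P) (CodeSpace P)) :
    DiscreteTopology (codeLattice P C) := by
  have := discreteTopology_baseLattice hP0
  exact DiscreteTopology.of_subset (t := (codeLattice P C : Set (MinkowskiPlane K)))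
    (s := ((baseLattice P).restrictScalars ℤ : Set (MinkowskiPlane K))) this (codeLattice_le C)

/-- The determinant of two vectors of Λ_C lies in 𝓞_K^#, because an alternating form vanishes on a
line. Conversely, if σu is in the dual, integrality against PΛ₀ puts u in Λ₀, and integrality
against all 𝓞_K-multiples of the generator (a', b') makes u proportional to it modulo P. -/
theorem planeRotation_codeLattice (hP : P.IsMaximal) (hP0 : P ≠ ⊥)
    {C : Submodule (𝓞 K ⧸ P) (CodeSpace P)} (hC : finrank (𝓞 K ⧸ P) C = 1) :
    planeRotation '' (codeLattice P C : Set (MinkowskiPlane K)) =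
      (dualLattice (codeLattice P C) : Set (MinkowskiPlane K)) := by
  obtain ⟨a', ha', b', hb', hab', hmem⟩ := exists_mem_codeLattice_iff hP hP0 hC
  have hα := (scalingFactor_pos hP0).ne'
  set α := scalingFactor P
  refine Set.Subset.antisymm ?_ ?_
  · rintro _ ⟨x, hx, rfl⟩ y hy
    obtain ⟨s, a, ha, b, hb, rfl⟩ := (hmem x).mp hx
    obtain ⟨r, c, hc, d, hd, rfl⟩ := (hmem y).mp hy
    rw [inner_planeRotation_planeMap hα]
    refine exists_int_trace_of_mem_codifferent ?_
    have hsa : s • a' ∈ (1 : FractionalIdeal (nonZeroDivisors (𝓞 K)) K) :=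
      Submodule.smul_mem _ s ha'
    have hra : r • a' ∈ (1 : FractionalIdeal (nonZeroDivisors (𝓞 K)) K) :=
      Submodule.smul_mem _ r ha'
    have hsb : s • b' ∈ polarIdeal P := Submodule.smul_mem _ s hb'
    have hrb : r • b' ∈ polarIdeal P := Submodule.smul_mem _ r hb'
    have h1 := mul_mem_codifferent_of_mem_one hsa hd
    have h2 := mul_mem_codifferent_of_mem_prime hP0 ha hrb
    have h3 := mul_mem_codifferent_of_mem_one (coeIdeal_le_one ha) hd
    have h4 := mul_mem_codifferent_of_mem_prime hP0 hc hsb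
    have h5 := mul_mem_codifferent_of_mem_one hra hb
    have h6 := mul_mem_codifferent_of_mem_one (coeIdeal_le_one hc) hb
    -- The terms in a'b', the only ones that could leave 𝓞_K^#, cancel.
    have h7 : (s • a' + a) * (r • b' + d) - (s • b' + b) * (r • a' + c) =
        (s • a') * d + a * (r • b') + a * d - c * (s • b') - (r • a') * b - c * b := by
      simp only [Algebra.smul_def]; ring
    rw [h7]
    exact sub_mem_of_mem (sub_mem_of_mem (sub_mem_of_mem (add_mem_of_mem (add_mem_of_mem h1 h2) h3) h4) h5) h6
  · intro v hv
    refine ⟨planeRotation.symm v, ?_, planeRotation.apply_symm_apply v⟩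
    obtain ⟨u, rfl⟩ := planeRotation.surjective v
    rw [LinearIsometryEquiv.symm_apply_apply]
    have hmem0 : ∀ s : 𝓞 K, ∀ a ∈ (P : FractionalIdeal (nonZeroDivisors (𝓞 K)) K),
        ∀ b ∈ codifferent K, ∃ k : ℤ, inner ℝ (planeRotation u)
          (planeMap α (s • a' + a, s • b' + b)) = (k : ℝ) :=
      fun s a ha b hb => hv _ ((hmem _).mpr ⟨s, a, ha, b, hb, rfl⟩)
    -- Testing against the vectors (0, d) with d ∈ 𝓞_K^# puts the first coordinate in the dual of
    -- 𝓞_K^#, which is 𝓞_K. Testing below against (c, 0) with c ∈ P puts the second in the dual of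
    -- P, which is P⁻¹𝓞_K^#.
    obtain ⟨a, ha, hua⟩ : ∃ a ∈ (1 : FractionalIdeal (nonZeroDivisors (𝓞 K)) K),
        α • u.fst = toMinkowski K a := by
      obtain ⟨a, ha, h⟩ := exists_toMinkowski_of_integral_pairing (K := K) codifferent_ne_zero
        (α • u.fst) (fun d hd => by
          obtain ⟨k, hk⟩ := hmem0 0 0 (zero_mem _) d hd
          refine ⟨k, ?_⟩
          have h1 := inner_planeRotation u (planeMap α ((0 : 𝓞 K) • a' + 0, (0 : 𝓞 K) • b' + d))
          rw [hk] at h1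
          rw [← Complex.ofReal_intCast, h1]
          refine Finset.sum_congr rfl fun φ _ => ?_
          simp only [planeMap_fst, planeMap_snd, MinkowskiSpace.coord_smul, toMinkowski_coord,
            zero_smul, zero_add, map_zero, MinkowskiSpace.coord_zero]
          ring)
      rw [dual_dual] at ha
      exact ⟨a, ha, h⟩
    obtain ⟨b, hb, hub⟩ : ∃ b ∈ polarIdeal P, α⁻¹ • u.snd = toMinkowski K b := by
      obtain ⟨b, hb, h⟩ := exists_toMinkowski_of_integral_pairing (K := K)
        (I := (P : FractionalIdeal (nonZeroDivisors (𝓞 K)) K)) (coeIdeal_ne_zero.mpr hP0)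
        (-(α⁻¹ • u.snd)) (fun c hc => by
          obtain ⟨k, hk⟩ := hmem0 0 c hc 0 (zero_mem _)
          refine ⟨k, ?_⟩
          have h1 := inner_planeRotation u (planeMap α ((0 : 𝓞 K) • a' + c, (0 : 𝓞 K) • b' + 0))
          rw [hk] at h1
          rw [← Complex.ofReal_intCast, h1]
          refine Finset.sum_congr rfl fun φ _ => ?_
          simp only [planeMap_fst, planeMap_snd, MinkowskiSpace.coord_smul, toMinkowski_coord,
            zero_smul, zero_add, map_zero, MinkowskiSpace.coord_zero,
            MinkowskiSpace.coord_neg]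
          ring)
      rw [dual_eq_mul_inv, mul_comm] at hb
      refine ⟨-b, neg_mem_of_mem hb, ?_⟩
      rw [map_neg, ← h, neg_neg]
    have hu : u = planeMap α (a, b) := by
      refine (WithLp.equiv 2 _).injective (Prod.ext ?_ ?_)
      · change u.fst = α⁻¹ • toMinkowski K a
        rw [← hua, inv_smul_smul₀ hα]
      · change u.snd = α • toMinkowski K b
        rw [← hub, smul_inv_smul₀ hα]
    have hw : a * b' - b * a' ∈ codifferent K := by
      rw [mem_dual (one_ne_zero : (1 : FractionalIdeal (nonZeroDivisors (𝓞 K)) K) ≠ 0)]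
      intro s hs
      obtain ⟨s, rfl⟩ := (mem_one_iff _).mp hs
      obtain ⟨k, hk⟩ := hmem0 s 0 (zero_mem _) 0 (zero_mem _)
      rw [hu, inner_planeRotation_planeMap hα] at hk
      refine ⟨k, ?_⟩
      rw [Algebra.traceForm_apply]
      have h1 : (a * b' - b * a') * algebraMap (𝓞 K) K s =
          a * (s • b' + 0) - b * (s • a' + 0) := by
        simp only [Algebra.smul_def]; ring
      rw [h1]
      simp only [algebraMap_int_eq, eq_intCast]
      exact_mod_cast hk.symm
    suffices h : ∃ s : 𝓞 K, a - s • a' ∈ (P : FractionalIdeal (nonZeroDivisors (𝓞 K)) K) ∧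
        b - s • b' ∈ codifferent K by
      obtain ⟨s, h1, h2⟩ := h
      refine (hmem u).mpr ⟨s, _, h1, _, h2, ?_⟩
      rw [hu, add_sub_cancel, add_sub_cancel]
    -- At least one coordinate of (a', b') is nonzero modulo P. That coordinate determines s, and
    -- ab' - ba' ∈ 𝓞_K^# settles the other.
    by_cases hb'D : b' ∈ codifferent K
    · have ha'P : a' ∉ (P : FractionalIdeal (nonZeroDivisors (𝓞 K)) K) := fun h => hab' ⟨h, hb'D⟩
      obtain ⟨s, hs⟩ := exists_sub_smul_mem_prime hP ha' ha'P ha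
      refine ⟨s, hs, sub_mem_of_mem ?_ (Submodule.smul_mem _ s hb'D)⟩
      have h1 : a' * b ∈ codifferent K := by
        have := sub_mem_of_mem (mul_mem_codifferent_of_mem_one ha hb'D) hw
        rwa [sub_sub_cancel, mul_comm] at this
      exact (mem_prime_or_mem_codifferent hP hP0 ha' hb h1).resolve_left ha'P
    · obtain ⟨s, hs⟩ := exists_sub_smul_mem_codifferent hP hP0 hb' hb'D hb
      refine ⟨s, ?_, hs⟩
      have h1 : (a - s • a') * b' ∈ codifferent K := by
        have h2 := add_mem_of_mem hw (mul_mem_codifferent_of_mem_one ha' hs)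
        have h3 : a * b' - b * a' + a' * (b - s • b') = (a - s • a') * b' := by
          simp only [Algebra.smul_def]; ring
        rwa [h3] at h2
      exact (mem_prime_or_mem_codifferent hP hP0
        (sub_mem_of_mem ha (Submodule.smul_mem _ s ha')) hb' h1).resolve_right hb'D

theorem isSymplecticLattice_codeLattice (hP : P.IsMaximal) (hP0 : P ≠ ⊥)
    {C : Submodule (𝓞 K ⧸ P) (CodeSpace P)} (hC : finrank (𝓞 K ⧸ P) C = 1) :
    IsSymplecticLattice (codeLattice P C) :=
  ⟨⟨discreteTopology_codeLattice hP0 C, span_codeLattice hP0 C⟩, planeRotation,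
    planeRotation_codeLattice hP hP0 hC, planeRotationMap_sq⟩

theorem covolume_codeLattice (hP : P.IsMaximal) (hP0 : P ≠ ⊥)
    {C : Submodule (𝓞 K ⧸ P) (CodeSpace P)} (hC : finrank (𝓞 K ⧸ P) C = 1) :
    ZLattice.covolume (codeLattice P C) = 1 := by
  have := discreteTopology_codeLattice hP0 C
  have : IsZLattice ℝ (codeLattice P C) := ⟨span_codeLattice hP0 C⟩
  exact covolume_eq_one_of_symplectic _ planeRotation (planeRotation_codeLattice hP hP0 hC)
    planeRotationMap_sq

end Symplectic

/-! ### Counting lines, covolume of Λ₀, and the averaging argument -/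

section Counting

open Module FractionalIdeal

variable {K : Type*} [Field K] [NumberField K] {P : Ideal (𝓞 K)}

theorem card_codeSpace (hP : P.IsMaximal) (hP0 : P ≠ ⊥) :
    Nat.card (CodeSpace P) = Nat.card (𝓞 K ⧸ P) ^ 2 := by
  let _ := Ideal.Quotient.field P
  have := Ideal.finiteQuotientOfFreeOfNeBot P hP0
  have : Module.Finite (𝓞 K ⧸ P) (CodeSpace P) :=
    Module.finite_of_finrank_pos (by rw [finrank_codeSpace hP hP0]; norm_num)
  rw [Module.natCard_eq_pow_finrank (K := 𝓞 K ⧸ P), finrank_codeSpace hP hP0]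

theorem card_line (hP : P.IsMaximal) (hP0 : P ≠ ⊥) {C : Submodule (𝓞 K ⧸ P) (CodeSpace P)}
    (hC : finrank (𝓞 K ⧸ P) C = 1) : Nat.card C = Nat.card (𝓞 K ⧸ P) := by
  let _ := Ideal.Quotient.field P
  have := Ideal.finiteQuotientOfFreeOfNeBot P hP0
  have : Module.Finite (𝓞 K ⧸ P) C := Module.finite_of_finrank_pos (by rw [hC]; norm_num)
  rw [Module.natCard_eq_pow_finrank (K := 𝓞 K ⧸ P), hC, pow_one]

theorem card_lines (hP : P.IsMaximal) (hP0 : P ≠ ⊥) :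
    Nat.card {C : Submodule (𝓞 K ⧸ P) (CodeSpace P) // finrank (𝓞 K ⧸ P) C = 1} =
      Nat.card (𝓞 K ⧸ P) + 1 := by
  let _ := Ideal.Quotient.field P
  have := Ideal.finiteQuotientOfFreeOfNeBot P hP0
  rw [← Projectivization.card_of_finrank_two (𝓞 K ⧸ P) (CodeSpace P) (finrank_codeSpace hP hP0)]
  exact Nat.card_congr (Projectivization.equivSubmodule (𝓞 K ⧸ P) (CodeSpace P)).symm

theorem relIndex_codeLattice (hP : P.IsMaximal) (hP0 : P ≠ ⊥)
    {C : Submodule (𝓞 K ⧸ P) (CodeSpace P)} (hC : finrank (𝓞 K ⧸ P) C = 1) :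
    (codeLattice P C).toAddSubgroup.relIndex ((baseLattice P).restrictScalars ℤ).toAddSubgroup =
      Nat.card (𝓞 K ⧸ P) := by
  have hfin := Ideal.finiteQuotientOfFreeOfNeBot P hP0
  let π := (Submodule.mkQ (P • ⊤ : Submodule (𝓞 K) (baseLattice P))).toAddMonoidHom
  have h1 : (codeLattice P C).toAddSubgroup.addSubgroupOf
      ((baseLattice P).restrictScalars ℤ).toAddSubgroup = C.toAddSubgroup.comap π := by
    ext x
    constructor
    · rintro ⟨y, hy, hyx⟩
      have : y = x := Subtype.ext hyx
      rw [← this]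
      exact hy
    · intro hx
      exact ⟨x, hx, rfl⟩
  have h0 : (C.toAddSubgroup.comap π).index = C.toAddSubgroup.index :=
    AddSubgroup.index_comap_of_surjective _ (Submodule.mkQ_surjective _)
  rw [AddSubgroup.relIndex, h1]
  refine Eq.trans h0 ?_
  have h2 := AddSubgroup.card_mul_index C.toAddSubgroup
  have h3 : Nat.card C.toAddSubgroup = Nat.card (𝓞 K ⧸ P) := card_line hP hP0 hC
  rw [h3, card_codeSpace hP hP0, sq] at h2
  exact Nat.eq_of_mul_eq_mul_left Nat.card_pos h2

/-- Read off from any Λ_C, which has covolume 1 and index q²/q = q in Λ₀. No discriminant has to be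
computed. -/
theorem covolume_baseLattice (hP : P.IsMaximal) (hP0 : P ≠ ⊥) :
    ZLattice.covolume ((baseLattice P).restrictScalars ℤ) = (Nat.card (𝓞 K ⧸ P) : ℝ)⁻¹ := by
  have hfin := Ideal.finiteQuotientOfFreeOfNeBot P hP0
  obtain ⟨C, hC⟩ : Nonempty {C : Submodule (𝓞 K ⧸ P) (CodeSpace P) //
      finrank (𝓞 K ⧸ P) C = 1} := by
    refine (Nat.card_pos_iff.mp ?_).1
    rw [card_lines hP hP0]; omega
  have := discreteTopology_codeLattice hP0 C
  have : IsZLattice ℝ (codeLattice P C) := ⟨span_codeLattice hP0 C⟩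
  have := discreteTopology_baseLattice hP0
  have : IsZLattice ℝ ((baseLattice P).restrictScalars ℤ) := ⟨span_baseLattice hP0⟩
  have h := ZLattice.covolume_div_covolume_eq_relIndex' (codeLattice P C)
    ((baseLattice P).restrictScalars ℤ) (codeLattice_le C)
  rw [covolume_codeLattice hP hP0 hC, relIndex_codeLattice hP hP0 hC] at h
  rw [← h, one_div, inv_inv]

/-- Two different lattices `Λ_C` meet in `P Λ₀`. -/
theorem eq_or_mem_of_mem_codeLattice (hP : P.IsMaximal) (hP0 : P ≠ ⊥)
    {C C' : Submodule (𝓞 K ⧸ P) (CodeSpace P)} (hC : finrank (𝓞 K ⧸ P) C = 1)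
    (hC' : finrank (𝓞 K ⧸ P) C' = 1) {x : MinkowskiPlane K} (hx : x ∈ codeLattice P C)
    (hx' : x ∈ codeLattice P C') :
    C = C' ∨ ∃ a ∈ (P : FractionalIdeal (nonZeroDivisors (𝓞 K)) K),
      ∃ b ∈ codifferent K, planeMap (scalingFactor P) (a, b) = x := by
  let _ := Ideal.Quotient.field P
  obtain ⟨y, hy, rfl⟩ := mem_codeLattice.mp hx
  obtain ⟨z, hz, hzy⟩ := mem_codeLattice.mp hx'
  obtain rfl : z = y := Subtype.ext hzy
  by_cases h0 : Submodule.mkQ (P • ⊤ : Submodule (𝓞 K) (baseLattice P)) z = 0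
  · right
    exact (mem_smul_top_baseLattice hP0).mp ((Submodule.Quotient.mk_eq_zero _).mp h0)
  · left
    have key : ∀ D : Submodule (𝓞 K ⧸ P) (CodeSpace P), finrank (𝓞 K ⧸ P) D = 1 →
        Submodule.mkQ (P • ⊤ : Submodule (𝓞 K) (baseLattice P)) z ∈ D →
        D = Submodule.span (𝓞 K ⧸ P)
          {Submodule.mkQ (P • ⊤ : Submodule (𝓞 K) (baseLattice P)) z} := by
      intro D hD hzD
      refine le_antisymm ?_ (by rwa [Submodule.span_singleton_le_iff_mem])
      intro w hw
      obtain ⟨c, hc⟩ := (finrank_eq_one_iff_of_nonzero' (⟨_, hzD⟩ : D)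
        (fun h => h0 (congrArg Subtype.val h))).mp hD ⟨w, hw⟩
      exact Submodule.mem_span_singleton.mpr ⟨c, congrArg Subtype.val hc⟩
    rw [key C hC hy, key C' hC' hz]

theorem smul_mem_codeLattice {C : Submodule (𝓞 K ⧸ P) (CodeSpace P)} {x : MinkowskiPlane K}
    (hx : x ∈ codeLattice P C) (s : 𝓞 K) : s • x ∈ codeLattice P C := by
  obtain ⟨y, hy, rfl⟩ := mem_codeLattice.mp hx
  exact mem_codeLattice.mpr ⟨s • y, C.smul_mem (Ideal.Quotient.mk P s) hy, rfl⟩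

theorem norm_smul_of_norm_eq_one {s : 𝓞 K} (hs : ∀ φ : K →+* ℂ, ‖φ s‖ = 1)
    (x : MinkowskiPlane K) : ‖s • x‖ = ‖x‖ := by
  have key : ∀ y : MinkowskiSpace K, ‖s • y‖ ^ 2 = ‖y‖ ^ 2 := by
    intro y
    rw [MinkowskiSpace.norm_sq_eq, MinkowskiSpace.norm_sq_eq]
    refine Finset.sum_congr rfl fun φ _ => ?_
    have : (s • y).coord φ = φ s * y.coord φ := rfl
    rw [this, norm_mul, hs, one_mul]
  rw [← sq_eq_sq₀ (norm_nonneg _) (norm_nonneg _), WithLp.prod_norm_sq_eq_of_L2,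
    WithLp.prod_norm_sq_eq_of_L2]
  exact congrArg₂ (· + ·) (key x.fst) (key x.snd)

theorem smul_eq_zero_of_minkowskiPlane {s : 𝓞 K} {x : MinkowskiPlane K} (h : s • x = 0)
    (hx : x ≠ 0) : s = 0 := by
  by_contra hs
  have key : ∀ y : MinkowskiSpace K, s • y = 0 → y = 0 := by
    intro y hy
    ext φ
    have h1 : φ s * y.coord φ = 0 := congrArg (fun z : MinkowskiSpace K => z.coord φ) hy
    refine (mul_eq_zero.mp h1).resolve_left ?_
    exact (_root_.map_ne_zero φ).mpr (by exact_mod_cast hs)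
  refine hx ((WithLp.equiv 2 _).injective (Prod.ext ?_ ?_))
  · exact key _ (congrArg WithLp.fst h)
  · exact key _ (congrArg WithLp.snd h)

/-- The orbit of a nonzero vector under the `m`-th roots of unity. -/
theorem exists_orbit {m : ℕ} {ζ : 𝓞 K} (hm : 0 < m) (hζ : IsPrimitiveRoot ζ m)
    {C : Submodule (𝓞 K ⧸ P) (CodeSpace P)} {x : MinkowskiPlane K}
    (hx : x ∈ codeLattice P C) (hx0 : x ≠ 0) :
    ∃ X : Finset (MinkowskiPlane K), X.card = m ∧
      ∀ y ∈ X, y ∈ codeLattice P C ∧ y ≠ 0 ∧ ‖y‖ = ‖x‖ := by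
  classical
  have hinj : Set.InjOn (fun i : ℕ => ζ ^ i • x) (Finset.range m : Set ℕ) := by
    intro i hi j hj hij
    have h1 : (ζ ^ i - ζ ^ j) • x = 0 := by
      rw [sub_smul, sub_eq_zero]; exact hij
    have h2 := sub_eq_zero.mp (smul_eq_zero_of_minkowskiPlane h1 hx0)
    exact hζ.pow_inj (by simpa using hi) (by simpa using hj) h2
  refine ⟨(Finset.range m).image fun i => ζ ^ i • x, ?_, ?_⟩
  · rw [Finset.card_image_of_injOn hinj, Finset.card_range]
  · intro y hy
    obtain ⟨i, -, rfl⟩ := Finset.mem_image.mp hy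
    refine ⟨smul_mem_codeLattice hx _, ?_, norm_smul_of_norm_eq_one ?_ x⟩
    · intro h
      have := smul_eq_zero_of_minkowskiPlane h hx0
      exact (hζ.isUnit hm.ne').pow i |>.ne_zero this
    · intro φ
      have h1 : (φ ((ζ ^ i : 𝓞 K) : K)) ^ m = 1 := by
        rw [← map_pow, ← map_pow, ← pow_mul, mul_comm, pow_mul, hζ.pow_eq_one]
        simp
      exact Complex.norm_eq_one_of_pow_eq_one h1 hm.ne'

/-- The averaging argument: if `Λ₀` has few vectors of norm at most `r` and `P Λ₀` has no such
nonzero vectors, then one of the `Λ_C` has no nonzero vectors of norm at most `r`. -/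
theorem exists_codeLattice_of_card_lt {m : ℕ} {ζ : 𝓞 K} (hm : 0 < m) (hζ : IsPrimitiveRoot ζ m)
    (hP : P.IsMaximal) (hP0 : P ≠ ⊥) {r : ℝ}
    (hshort : ∀ a ∈ (P : FractionalIdeal (nonZeroDivisors (𝓞 K)) K), ∀ b ∈ codifferent K,
      planeMap (scalingFactor P) (a, b) ≠ 0 → r ≤ ‖planeMap (scalingFactor P) (a, b)‖)
    (hcard : ∀ X : Finset (MinkowskiPlane K), (∀ x ∈ X, x ∈ baseLattice P ∧ ‖x‖ ≤ r) →
      X.card < (Nat.card (𝓞 K ⧸ P) + 1) * m) :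
    ∃ C : Submodule (𝓞 K ⧸ P) (CodeSpace P), finrank (𝓞 K ⧸ P) C = 1 ∧
      ∀ x ∈ codeLattice P C, x ≠ 0 → r ≤ ‖x‖ := by
  classical
  by_contra! hcon
  have hfin := Ideal.finiteQuotientOfFreeOfNeBot P hP0
  let S := {C : Submodule (𝓞 K ⧸ P) (CodeSpace P) // finrank (𝓞 K ⧸ P) C = 1}
  have hS : Nat.card S = Nat.card (𝓞 K ⧸ P) + 1 := card_lines hP hP0
  have : Finite S := Nat.finite_of_card_ne_zero (by omega)
  have : Fintype S := Fintype.ofFinite S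
  have hX : ∀ C : S, ∃ X : Finset (MinkowskiPlane K), X.card = m ∧
      ∀ y ∈ X, y ∈ codeLattice P C.1 ∧ y ≠ 0 ∧ ‖y‖ < r := by
    intro C
    obtain ⟨x, hx, hx0, hxr⟩ := hcon C.1 C.2
    obtain ⟨X, hXm, hX⟩ := exists_orbit hm hζ hx hx0
    exact ⟨X, hXm, fun y hy => ⟨(hX y hy).1, (hX y hy).2.1, (hX y hy).2.2 ▸ hxr⟩⟩
  choose X hXm hX using hX
  -- A common vector of two orbits would lie in PΛ₀, be nonzero and be shorter than r, against
  -- `hshort`. So the q + 1 orbits together contain (q + 1)m vectors of Λ₀.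
  have hdisj : ∀ C ∈ (Finset.univ : Finset S), ∀ C' ∈ (Finset.univ : Finset S), C ≠ C' →
      Disjoint (X C) (X C') := by
    intro C _ C' _ hCC'
    rw [Finset.disjoint_left]
    intro y hy hy'
    rcases eq_or_mem_of_mem_codeLattice hP hP0 C.2 C'.2 (hX C y hy).1 (hX C' y hy').1 with h | h
    · exact hCC' (Subtype.ext h)
    · obtain ⟨a, ha, b, hb, rfl⟩ := h
      exact (hshort a ha b hb (hX C _ hy).2.1).not_gt (hX C _ hy).2.2
  have h1 := hcard (Finset.univ.biUnion X) (by
    intro x hx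
    obtain ⟨C, -, hx⟩ := Finset.mem_biUnion.mp hx
    exact ⟨codeLattice_le C.1 (hX C x hx).1, (hX C x hx).2.2.le⟩)
  rw [Finset.card_biUnion hdisj, Finset.sum_congr rfl fun C _ => hXm C, Finset.sum_const,
    Finset.card_univ, ← Nat.card_eq_fintype_card, hS, smul_eq_mul] at h1
  exact lt_irrefl _ h1

end Counting

/-! ### Norm bounds: long vectors in PΛ₀ and a short vector in P⁻¹𝓞_K^# -/

section Norms

open Module FractionalIdeal NumberField

variable {K : Type*} [Field K] [NumberField K] {P : Ideal (𝓞 K)}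

/-- Write (x) = A·I with A a nonzero integral ideal, whose norm is at least 1. -/
theorem absNorm_le_abs_norm {I : FractionalIdeal (nonZeroDivisors (𝓞 K)) K} {x : K} (hx : x ∈ I)
    (hx0 : x ≠ 0) : absNorm I ≤ |Algebra.norm ℚ x| := by
  have hI : I ≠ 0 := by
    rintro rfl
    exact hx0 ((mem_zero_iff _).mp hx)
  have h1 : spanSingleton (nonZeroDivisors (𝓞 K)) x * I⁻¹ ≤ 1 := by
    calc spanSingleton (nonZeroDivisors (𝓞 K)) x * I⁻¹ ≤ I * I⁻¹ := by
          gcongr; exact spanSingleton_le_iff_mem.mpr hx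
      _ = 1 := mul_inv_cancel₀ hI
  obtain ⟨A, hA⟩ := le_one_iff_exists_coeIdeal.mp h1
  have h2 : spanSingleton (nonZeroDivisors (𝓞 K)) x = A * I := by
    rw [hA, mul_assoc, inv_mul_cancel₀ hI, mul_one]
  have h3 : absNorm (spanSingleton (nonZeroDivisors (𝓞 K)) x) = Ideal.absNorm A * absNorm I := by
    rw [h2, map_mul, coeIdeal_absNorm]
  rw [absNorm_span_singleton] at h3
  rw [h3]
  have h4 : (Ideal.absNorm A : ℚ) ≠ 0 := by
    intro h0
    rw [h0, zero_mul, abs_eq_zero, Algebra.norm_eq_zero_iff] at h3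
    exact hx0 h3
  have h5 : (1 : ℚ) ≤ Ideal.absNorm A := by
    have : Ideal.absNorm A ≠ 0 := by exact_mod_cast h4
    exact_mod_cast Nat.one_le_iff_ne_zero.mpr this
  exact le_mul_of_one_le_left (absNorm_nonneg I) h5

theorem absNorm_codifferent : absNorm (codifferent K) = ((discr K).natAbs : ℚ)⁻¹ := by
  have h := coeIdeal_differentIdeal ℤ ℚ K (𝓞 K)
  have h2 : absNorm (codifferent K)⁻¹ = ((discr K).natAbs : ℚ) := by
    rw [← h, coeIdeal_absNorm, absNorm_differentIdeal K]
  rw [← h2, map_inv₀, inv_inv]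

theorem absNorm_prime : absNorm (P : FractionalIdeal (nonZeroDivisors (𝓞 K)) K) =
    (Nat.card (𝓞 K ⧸ P) : ℚ) := by
  rw [coeIdeal_absNorm]
  rfl

theorem abs_discr_eq : |(discr K : ℝ)| = ((discr K).natAbs : ℝ) := by
  rw [Nat.cast_natAbs, Int.cast_abs]

theorem norm_sq_le_pow_arith_mean (x : K) :
    (|Algebra.norm ℚ x| : ℝ) ^ 2 ≤ (‖toMinkowski K x‖ ^ 2 / finrank ℚ K) ^ finrank ℚ K := by
  have hn : 0 < finrank ℚ K := finrank_pos
  have hcard : (∑ _φ : K →+* ℂ, (1 : ℝ)) = finrank ℚ K := by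
    rw [Finset.sum_const, Finset.card_univ, Embeddings.card K ℂ]; simp
  have h := Real.geom_mean_le_arith_mean Finset.univ (fun _ : K →+* ℂ => 1)
    (fun φ => ‖φ x‖ ^ 2) (fun _ _ => zero_le_one) (by rw [hcard]; exact_mod_cast hn)
    (fun _ _ => by positivity)
  simp only [Real.rpow_one, one_mul] at h
  rw [hcard, ← norm_sq_toMinkowski] at h
  have hprod : ∏ φ : K →+* ℂ, ‖φ x‖ ^ 2 = (|Algebra.norm ℚ x| : ℝ) ^ 2 := by
    rw [Finset.prod_pow]
    congr 1
    have h1 := congrArg (‖·‖) (Algebra.norm_eq_prod_embeddings ℚ ℂ x)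
    rw [norm_prod, ← Fintype.prod_equiv (RingHom.equivRatAlgHom K ℂ) (fun f => ‖f x‖)
      (fun φ => ‖φ x‖) fun _ => rfl] at h1
    rw [← h1]
    simp
  rw [hprod] at h
  have h2 := pow_le_pow_left₀ (by positivity) h (finrank ℚ K)
  rwa [Real.rpow_inv_natCast_pow (by positivity) hn.ne'] at h2

theorem scalingFactor_pow (P : Ideal (𝓞 K)) : (scalingFactor P ^ 2) ^ finrank ℚ K =
    Nat.card (𝓞 K ⧸ P) * |(discr K : ℝ)| := by
  have hn : (0 : ℝ) < finrank ℚ K := by exact_mod_cast finrank_pos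
  rw [← pow_mul, scalingFactor, ← Real.rpow_natCast, ← Real.rpow_mul (by positivity)]
  push_cast
  rw [one_div_mul_cancel (by positivity), Real.rpow_one]

theorem one_le_abs_discr : 1 ≤ |(discr K : ℝ)| := by
  rw [abs_discr_eq]
  exact_mod_cast Nat.one_le_iff_ne_zero.mpr (Int.natAbs_ne_zero.mpr (discr_ne_zero K))

/-- A lower bound for the norms of the nonzero vectors of `P Λ₀`. -/
theorem card_div_discr_le (hP0 : P ≠ ⊥) {a b : K}
    (ha : a ∈ (P : FractionalIdeal (nonZeroDivisors (𝓞 K)) K)) (hb : b ∈ codifferent K)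
    (hab : planeMap (scalingFactor P) (a, b) ≠ 0) :
    Nat.card (𝓞 K ⧸ P) / |(discr K : ℝ)| ≤
      (‖planeMap (scalingFactor P) (a, b)‖ ^ 2 / finrank ℚ K) ^ finrank ℚ K := by
  have hn : (0 : ℝ) < finrank ℚ K := by exact_mod_cast finrank_pos
  have hd := one_le_abs_discr (K := K)
  have hα := scalingFactor_pos hP0
  have hpow := scalingFactor_pow P
  have hfin := Ideal.finiteQuotientOfFreeOfNeBot P hP0
  have hq : (0 : ℝ) < Nat.card (𝓞 K ⧸ P) := by exact_mod_cast Nat.card_pos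
  rw [norm_sq_planeMap]
  set α := scalingFactor P
  set q : ℝ := ((Nat.card (𝓞 K ⧸ P) : ℕ) : ℝ)
  set d := |(discr K : ℝ)|
  set n := finrank ℚ K
  -- One nonzero coordinate suffices. The scaling α balances the factors: (α²)^n = qd, so N(b) ≥ 1/d
  -- gives qd/d² = q/d, and N(a) ≥ q gives q²/(qd) = q/d.
  by_cases ha0 : a = 0
  · have hb0 : b ≠ 0 := by
      rintro rfl
      exact hab (by rw [ha0]; exact map_zero _)
    have h1 := absNorm_le_abs_norm hb hb0
    rw [absNorm_codifferent] at h1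
    have h2 : d⁻¹ ≤ (|Algebra.norm ℚ b| : ℝ) := by
      rw [show d = _ from abs_discr_eq]
      simpa using (Rat.cast_le (K := ℝ)).mpr h1
    calc q / d = (α ^ 2) ^ n * d⁻¹ ^ 2 := by rw [hpow]; field_simp
      _ ≤ (α ^ 2) ^ n * (|Algebra.norm ℚ b| : ℝ) ^ 2 := by gcongr
      _ ≤ (α ^ 2) ^ n * (‖toMinkowski K b‖ ^ 2 / n) ^ n := by
          gcongr; exact norm_sq_le_pow_arith_mean b
      _ = (α ^ 2 * ‖toMinkowski K b‖ ^ 2 / n) ^ n := by rw [← mul_pow, mul_div_assoc]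
      _ ≤ _ := by
          gcongr
          exact le_add_of_nonneg_left (by positivity)
  · have h1 := absNorm_le_abs_norm ha ha0
    rw [absNorm_prime] at h1
    have h2 : q ≤ (|Algebra.norm ℚ a| : ℝ) := by simpa using (Rat.cast_le (K := ℝ)).mpr h1
    have hpow' : ((α⁻¹) ^ 2) ^ n = (q * d)⁻¹ := by rw [← hpow]; simp
    calc q / d = ((α⁻¹) ^ 2) ^ n * q ^ 2 := by rw [hpow']; field_simp
      _ ≤ ((α⁻¹) ^ 2) ^ n * (|Algebra.norm ℚ a| : ℝ) ^ 2 := by gcongr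
      _ ≤ ((α⁻¹) ^ 2) ^ n * (‖toMinkowski K a‖ ^ 2 / n) ^ n := by
          gcongr; exact norm_sq_le_pow_arith_mean a
      _ = ((α⁻¹) ^ 2 * ‖toMinkowski K a‖ ^ 2 / n) ^ n := by rw [← mul_pow, mul_div_assoc]
      _ ≤ _ := by
          gcongr
          exact le_add_of_nonneg_right (by positivity)

theorem norm_sq_toMinkowski_one : ‖toMinkowski K (1 : K)‖ ^ 2 = finrank ℚ K := by
  rw [norm_sq_toMinkowski]
  simp [Embeddings.card K ℂ]

theorem inv_scalingFactor_sq_le (hP0 : P ≠ ⊥) : ((scalingFactor P)⁻¹) ^ 2 ≤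
    ((Nat.card (𝓞 K ⧸ P) : ℝ) ^ (1 / (finrank ℚ K : ℝ)))⁻¹ := by
  have hn : 0 < finrank ℚ K := finrank_pos
  have hfin := Ideal.finiteQuotientOfFreeOfNeBot P hP0
  have hq : (0 : ℝ) < Nat.card (𝓞 K ⧸ P) := by exact_mod_cast Nat.card_pos
  rw [inv_pow]
  refine inv_anti₀ (by positivity) ?_
  refine le_of_pow_le_pow_left₀ hn.ne' (by positivity) ?_
  rw [scalingFactor_pow, one_div, Real.rpow_inv_natCast_pow hq.le hn.ne']
  exact le_mul_of_one_le_right hq.le one_le_abs_discr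

open scoped Classical in
open InfinitePlace in
theorem exists_short_polarIdeal (hP0 : P ≠ ⊥) : ∃ v ∈ polarIdeal P, v ≠ 0 ∧
    scalingFactor P ^ 2 * ‖toMinkowski K v‖ ^ 2 ≤ 4 * finrank ℚ K *
      ((Nat.card (𝓞 K ⧸ P) : ℝ) ^ (1 / (finrank ℚ K : ℝ)))⁻¹ := by
  have hn : 0 < finrank ℚ K := finrank_pos
  have hfin := Ideal.finiteQuotientOfFreeOfNeBot P hP0
  have hq : (0 : ℝ) < Nat.card (𝓞 K ⧸ P) := by exact_mod_cast Nat.card_pos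
  have hd : 0 < |(discr K : ℝ)| := by linarith [one_le_abs_discr (K := K)]
  have hJ := polarIdeal_ne_zero (K := K) hP0
  have hα := scalingFactor_pos hP0
  set q : ℝ := ((Nat.card (𝓞 K ⧸ P) : ℕ) : ℝ)
  have hNJ : (absNorm (polarIdeal P) : ℝ) = (q * |(discr K : ℝ)|)⁻¹ := by
    rw [map_mul, map_inv₀, absNorm_prime, absNorm_codifferent, abs_discr_eq]
    push_cast
    rw [mul_inv]
  -- Minkowski's theorem is applied to the body of all v with |φ(v)| < t for every embedding φ. With
  -- J = P⁻¹𝓞_K^# of norm 1/(q|d|), the choice t^n = 2^n/(q√|d|) reduces its volume condition to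
  -- 2^{-r₂} < 2^{r₁} π^{r₂}. In α²t² = 4q^{-1/n} the discriminant cancels.
  set t : ℝ := 2 * ((q * √|(discr K : ℝ)|)⁻¹) ^ ((finrank ℚ K : ℝ)⁻¹)
  have ht : 0 ≤ t := by positivity
  have htn : t ^ finrank ℚ K = 2 ^ finrank ℚ K * (q * √|(discr K : ℝ)|)⁻¹ := by
    rw [mul_pow, Real.rpow_inv_natCast_pow (by positivity) hn.ne']
  obtain ⟨v, hv, hv0, hvt⟩ := mixedEmbedding.exists_ne_zero_mem_ideal_lt K
    (f := fun _ => t.toNNReal) (Units.mk0 _ hJ) (by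
      rw [mixedEmbedding.minkowskiBound,
        mixedEmbedding.volume_fundamentalDomain_fractionalIdealLatticeBasis,
        mixedEmbedding.volume_fundamentalDomain_latticeBasis, mixedEmbedding.finrank,
        mixedEmbedding.convexBodyLT_volume, Finset.prod_pow_eq_pow_sum,
        InfinitePlace.sum_mult_eq, Units.val_mk0, hNJ]
      have h2 : (2⁻¹ : ENNReal) = ((2⁻¹ : NNReal) : ENNReal) := by
        rw [ENNReal.coe_inv two_ne_zero]; rfl
      rw [h2, ENNReal.ofReal]
      norm_cast
      rw [← NNReal.coe_lt_coe]
      push_cast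
      rw [Real.coe_toNNReal _ ht, Real.coe_toNNReal _ (by positivity), htn]
      have h3 : nrRealPlaces K + nrComplexPlaces K ≠ 0 := by
        have := card_add_two_mul_card_eq_rank K
        omega
      have h4 : (2⁻¹ : ℝ) ^ nrComplexPlaces K <
          2 ^ nrRealPlaces K * Real.pi ^ nrComplexPlaces K := by
        rw [inv_pow, inv_lt_iff_one_lt_mul₀ (by positivity)]
        calc (1 : ℝ) < 2 ^ (nrRealPlaces K + nrComplexPlaces K) := one_lt_pow₀ one_lt_two h3
          _ = 2 ^ nrRealPlaces K * 1 ^ nrComplexPlaces K * 2 ^ nrComplexPlaces K := by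
              rw [one_pow, mul_one, pow_add]
          _ ≤ _ := by
              gcongr
              linarith [Real.pi_gt_three]
      have h5 : ‖discr K‖ = √|(discr K : ℝ)| ^ 2 := by
        rw [Int.norm_eq_abs, Real.sq_sqrt hd.le]
      have h6 : |(discr K : ℝ)| = √|(discr K : ℝ)| ^ 2 := (Real.sq_sqrt hd.le).symm
      have h7 : 0 < √|(discr K : ℝ)| := Real.sqrt_pos.mpr hd
      calc (q * |(discr K : ℝ)|)⁻¹ * (2⁻¹ ^ nrComplexPlaces K * √‖discr K‖) * 2 ^ finrank ℚ K
          = 2⁻¹ ^ nrComplexPlaces K * (2 ^ finrank ℚ K * (q * √|(discr K : ℝ)|)⁻¹) := by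
            rw [h5, Real.sqrt_sq h7.le]
            nth_rewrite 1 [h6]
            field_simp
        _ < _ := mul_lt_mul_of_pos_right h4 (by positivity))
  refine ⟨v, hv, hv0, ?_⟩
  have h1 : ‖toMinkowski K v‖ ^ 2 ≤ finrank ℚ K * t ^ 2 := by
    rw [norm_sq_toMinkowski]
    calc ∑ φ : K →+* ℂ, ‖φ v‖ ^ 2 ≤ ∑ _φ : K →+* ℂ, t ^ 2 := by
          refine Finset.sum_le_sum fun φ _ => ?_
          have := hvt (InfinitePlace.mk φ)
          rw [InfinitePlace.apply, Real.coe_toNNReal _ ht] at this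
          exact pow_le_pow_left₀ (norm_nonneg _) this.le 2
      _ = _ := by rw [Finset.sum_const, Finset.card_univ, Embeddings.card K ℂ, nsmul_eq_mul]
  have h2 : scalingFactor P ^ 2 * t ^ 2 = 4 * (q ^ (1 / (finrank ℚ K : ℝ)))⁻¹ := by
    refine (pow_left_inj₀ (by positivity) (by positivity) hn.ne').mp ?_
    rw [mul_pow, scalingFactor_pow, ← pow_mul t, mul_comm 2, pow_mul, htn, mul_pow, mul_pow,
      inv_pow _ (finrank ℚ K), one_div, Real.rpow_inv_natCast_pow hq.le hn.ne', ← pow_mul,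
      mul_comm _ 2, pow_mul, inv_pow, mul_pow, Real.sq_sqrt hd.le]
    norm_num
    change q * _ * _ = _
    field_simp
  calc scalingFactor P ^ 2 * ‖toMinkowski K v‖ ^ 2 ≤ scalingFactor P ^ 2 * (finrank ℚ K * t ^ 2) := by
        gcongr
    _ = finrank ℚ K * (scalingFactor P ^ 2 * t ^ 2) := by ring
    _ = _ := by rw [h2]; ring

end Norms

/-! ### The radius of a ball of given volume -/

section RadiusEstimates

open Real

theorem div_exp_pow_le_factorial (k : ℕ) (hk : k ≠ 0) : (k / exp 1) ^ k ≤ (k.factorial : ℝ) := by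
  refine le_trans (le_mul_of_one_le_left (by positivity) ?_) (Stirling.le_factorial_stirling k)
  rw [one_le_sqrt]
  have : (1 : ℝ) ≤ k := by exact_mod_cast Nat.one_le_iff_ne_zero.mpr hk
  nlinarith [pi_gt_three]

/-- The radius of the ball of volume `T` in dimension `2 k`, with bounds for its square. -/
theorem exists_radius {k : ℕ} (hk : k ≠ 0) {T : ℝ} (hT : 1 ≤ T) (hT' : T ≤ 4 * (k : ℝ) ^ 2) :
    ∃ r : ℝ, 0 < r ∧ (r ^ 2) ^ k * (π ^ k / k.factorial) = T ∧ k / 9 ≤ r ^ 2 ∧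
      r ^ 2 < 4 * (k : ℝ) ^ 3 := by
  have hk1 : (1 : ℝ) ≤ k := by exact_mod_cast Nat.one_le_iff_ne_zero.mpr hk
  have hT0 : 0 < T := by linarith
  have hf : (0 : ℝ) < k.factorial := by positivity
  set s : ℝ := (T * k.factorial) ^ ((k : ℝ)⁻¹) / π with hs
  have hs0 : 0 < s := by positivity
  have hpow : (s * π) ^ k = T * k.factorial := by
    rw [hs, div_mul_cancel₀ _ pi_ne_zero, rpow_inv_natCast_pow (by positivity) hk]
  refine ⟨√s, sqrt_pos.mpr hs0, ?_, ?_, ?_⟩ <;> rw [sq_sqrt hs0.le]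
  · rw [← mul_div_assoc, ← mul_pow, hpow, mul_div_cancel_right₀ _ hf.ne']
  · have h1 : k / exp 1 ≤ s * π := by
      refine le_of_pow_le_pow_left₀ hk (by positivity) ?_
      rw [hpow]
      exact (div_exp_pow_le_factorial k hk).trans (le_mul_of_one_le_left hf.le hT)
    rw [div_le_iff₀ (exp_pos 1)] at h1
    -- The constant 9 in the lower bound for r² is an upper bound for πe, coming from k! ≥ (k/e)^k.
    -- The upper bound for r² uses only k! ≤ k^k and T^{1/k} ≤ T.
    have h2 : π * exp 1 ≤ 9 := by nlinarith [pi_lt_d2, exp_one_lt_d9, pi_pos, exp_pos 1]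
    rw [div_le_iff₀ (by norm_num)]
    calc (k : ℝ) ≤ s * (π * exp 1) := by linarith
      _ ≤ s * 9 := by gcongr
  · have h1 : s * π ≤ T * k := by
      refine le_of_pow_le_pow_left₀ hk (by positivity) ?_
      rw [hpow, mul_pow]
      gcongr
      · exact le_self_pow₀ hT hk
      · exact_mod_cast k.factorial_le_pow
    have h2 : s * 3 < s * π := by gcongr; exact pi_gt_three
    have h3 : T * k ≤ 4 * (k : ℝ) ^ 2 * k := by gcongr
    nlinarith

theorem sq_add_pow_le {k : ℕ} {r τ : ℝ} (hr : 0 < r) (hτ : 0 ≤ τ) :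
    ((r + τ) ^ 2) ^ k ≤ (r ^ 2) ^ k * exp (2 * k * τ / r) := by
  have h : r + τ ≤ r * exp (τ / r) := by
    calc r + τ = r * (τ / r + 1) := by field_simp; ring
      _ ≤ r * exp (τ / r) := by gcongr; exact add_one_le_exp _
  calc ((r + τ) ^ 2) ^ k ≤ ((r * exp (τ / r)) ^ 2) ^ k := by gcongr
    _ = (r ^ 2) ^ k * exp (2 * k * τ / r) := by
      rw [mul_pow, mul_pow, ← exp_nat_mul, ← exp_nat_mul]
      congr 2
      push_cast
      ring

end RadiusEstimates

/-! ### Covering radius of Λ₀ and dense lattices in the cyclotomic case -/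

section Cyclotomic

open Module NumberField

variable {K : Type*} [Field K] [NumberField K] {P : Ideal (𝓞 K)}

theorem finrank_minkowskiPlane : finrank ℝ (MinkowskiPlane K) = 2 * finrank ℚ K := by
  rw [(WithLp.linearEquiv 2 ℝ (MinkowskiSpace K × MinkowskiSpace K)).finrank_eq,
    Module.finrank_prod, finrank_minkowskiSpace]
  ring

variable (K) in
theorem abs_discr_le_of_isCyclotomicExtension (m : ℕ) [NeZero m] [IsCyclotomicExtension {m} ℚ K] :
    |(discr K : ℝ)| ≤ (m : ℝ) ^ finrank ℚ K := by
  rw [abs_discr_eq, IsCyclotomicExtension.Rat.natAbs_discr m K, IsCyclotomicExtension.Rat.finrank m K]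
  exact_mod_cast Nat.div_le_self _ _

theorem norm_sq_toMinkowski_mul {m : ℕ} [NeZero m] {ζ : K} (hζ : IsPrimitiveRoot ζ m) (i : ℕ) (x : K) :
    ‖toMinkowski K (ζ ^ i * x)‖ ^ 2 = ‖toMinkowski K x‖ ^ 2 := by
  rw [norm_sq_toMinkowski, norm_sq_toMinkowski]
  refine Finset.sum_congr rfl fun φ _ => ?_
  have h : ‖φ ζ‖ = 1 := (hζ.map_of_injective φ.injective).norm'_eq_one (NeZero.ne m)
  rw [map_mul, map_pow, norm_mul, norm_pow, h, one_pow, one_mul]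

/-- A bound for the covering radius of the lattice `Λ₀`. -/
theorem exists_mem_baseLattice_norm_sub_le (m : ℕ) [NeZero m] [IsCyclotomicExtension {m} ℚ K]
    (hP0 : P ≠ ⊥) {τ : ℝ} (hτ : 0 ≤ τ)
    (h : 5 * (finrank ℚ K : ℝ) ^ 2 *
      ((Nat.card (𝓞 K ⧸ P) : ℝ) ^ (1 / (finrank ℚ K : ℝ)))⁻¹ ≤ 4 * τ ^ 2)
    (x : MinkowskiPlane K) : ∃ y ∈ (baseLattice P).restrictScalars ℤ, ‖x - y‖ ≤ τ := by
  obtain ⟨v, hv, hv0, hvn⟩ := exists_short_polarIdeal (K := K) hP0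
  have hζ := IsCyclotomicExtension.zeta_spec m ℚ K
  set ζ := IsCyclotomicExtension.zeta m ℚ K
  have hα := scalingFactor_pos (K := K) hP0
  have hint : ∀ i : ℕ, ζ ^ i = ((hζ.toInteger ^ i : 𝓞 K) : K) := fun i =>
    (map_pow (algebraMap (𝓞 K) K) hζ.toInteger i).symm
  let B := hζ.powerBasis ℚ
  have hB : ∀ i, B.basis i = ζ ^ (i : ℕ) := fun i => by
    rw [B.basis_eq_pow]
    exact congrArg (· ^ (i : ℕ)) (hζ.powerBasis_gen ℚ)
  let B' := B.basis.map (LinearEquiv.ofInjectiveEndo (LinearMap.mulRight ℚ v)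
    (mul_left_injective₀ hv0))
  have hB' : ∀ i, B' i = ζ ^ (i : ℕ) * v := fun i => by
    rw [← hB]
    rfl
  have hdim : B.dim = finrank ℚ K := B.finrank.symm
  -- Multiplication by ζ^i preserves norms, so the k = [K : ℚ] multiples of (1, 0) and the k
  -- multiples of (0, v) have two common lengths. Writing Q = q^{1/k}, the squared norms sum to at
  -- most k · k/Q + k · 4k/Q = 5k²/Q.
  refine exists_mem_norm_sub_le _ (Sum.elim
    (fun i => planeMap (scalingFactor P) (B.basis i, 0))
    (fun i => planeMap (scalingFactor P) (0, B' i))) ?_ ?_ hτ ?_ x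
  · rintro (i | i)
    · refine planeMap_mem_baseLattice ?_ (FractionalIdeal.zero_mem _)
      rw [hB, hint]
      exact FractionalIdeal.coe_mem_one _ _
    · refine planeMap_mem_baseLattice (FractionalIdeal.zero_mem _) ?_
      rw [hB', hint]
      exact Submodule.smul_mem (polarIdeal (K := K) P : Submodule (𝓞 K) K) _ hv
  · have h1 := span_range_toMinkowski_basis B.basis
    have h2 := span_range_toMinkowski_basis B'
    rw [Set.range_comp' (toMinkowski K)] at h1 h2
    have h3 := span_planeMap hα.ne' h1 h2
    rwa [← Set.range_comp, ← Set.range_comp, ← Set.Sum.elim_range] at h3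
  · rw [Fintype.sum_sum_type]
    simp only [Sum.elim_inl, Sum.elim_inr, norm_sq_planeMap, hB, hB', norm_sq_toMinkowski_mul hζ,
      map_zero, norm_zero]
    have hone : ∀ i : ℕ, ‖toMinkowski K (ζ ^ i)‖ ^ 2 = finrank ℚ K := fun i => by
      rw [← mul_one (ζ ^ i), norm_sq_toMinkowski_mul hζ, norm_sq_toMinkowski_one]
    simp only [hone, Finset.sum_const, Finset.card_univ, Fintype.card_fin, nsmul_eq_mul, hdim]
    have h1 := inv_scalingFactor_sq_le (K := K) hP0
    have hn : (0 : ℝ) ≤ finrank ℚ K := Nat.cast_nonneg _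
    have h2 := mul_le_mul_of_nonneg_left h1 (mul_nonneg hn hn)
    have h3 := mul_le_mul_of_nonneg_left hvn hn
    nlinarith

/-- If `T` is slightly smaller than `m`, then some lattice of the family has density at least
`T / 2 ^ (2 φ(m))`. -/
theorem exists_symplectic_packingDensity_ge (m : ℕ) [NeZero m] [IsCyclotomicExtension {m} ℚ K]
    (hP : P.IsMaximal) (hP0 : P ≠ ⊥) {T : ℝ} (hT : 1 ≤ T)
    (hT' : T ≤ 4 * (m.totient : ℝ) ^ 2)
    (hq : 4 * (m.totient : ℝ) ^ 2 * m < (Nat.card (𝓞 K ⧸ P) : ℝ) ^ (1 / (m.totient : ℝ)))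
    (hTm : T * Real.exp (√(45 * (m.totient : ℝ) ^ 3 /
      (Nat.card (𝓞 K ⧸ P) : ℝ) ^ (1 / (m.totient : ℝ)))) ≤ m) :
    ∃ L ∈ codeLatticeFamily P, IsSymplecticLattice L ∧ T / 2 ^ (2 * m.totient) ≤ packingDensity L := by
  have hk : finrank ℚ K = m.totient := IsCyclotomicExtension.Rat.finrank m K
  have hm : 0 < m := Nat.pos_of_ne_zero (NeZero.ne m)
  have hk0 : m.totient ≠ 0 := (Nat.totient_pos.mpr hm).ne'
  have hfin := Ideal.finiteQuotientOfFreeOfNeBot P hP0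
  have hdim : finrank ℝ (MinkowskiPlane K) = 2 * m.totient := by rw [finrank_minkowskiPlane, hk]
  have : Nontrivial (MinkowskiPlane K) := nontrivial_of_finrank_pos (R := ℝ) (by omega)
  have hq0 : (0 : ℝ) < Nat.card (𝓞 K ⧸ P) := by exact_mod_cast Nat.card_pos
  obtain ⟨r, hr, hrT, hr1, hr2⟩ := exists_radius hk0 hT hT'
  have hmem := fun τ => exists_mem_baseLattice_norm_sub_le (K := K) m hP0 (τ := τ)
  have hshort := fun a b => card_div_discr_le (K := K) (a := a) (b := b) hP0
  have hdisc := abs_discr_le_of_isCyclotomicExtension K m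
  have hd1 := one_le_abs_discr (K := K)
  rw [hk] at hmem hdisc hshort
  set q : ℝ := ((Nat.card (𝓞 K ⧸ P) : ℕ) : ℝ) with hqdef
  set k := m.totient
  set Q : ℝ := q ^ (1 / (k : ℝ))
  have hQ : 0 < Q := by positivity
  have hQk : Q ^ k = q := by
    rw [show Q = q ^ ((k : ℝ)⁻¹) by rw [← one_div], Real.rpow_inv_natCast_pow hq0.le hk0]
  have hk1 : (0 : ℝ) < k := by positivity
  have hvol : ∀ {s : ℝ}, 0 ≤ s → _ := fun {s} hs =>
    volume_real_closedBall_of_dim_even (E := MinkowskiPlane K) hdim hs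
  -- The value for which 4τ² equals the covering bound 5k²/Q. As r² ≥ k/9, it yields (2kτ/r)² =
  -- 5k⁴/(Qr²) ≤ 45k³/Q, the source of the 45.
  set τ : ℝ := √(5 / 4 * (k : ℝ) ^ 2 * Q⁻¹)
  have hτ2 : τ ^ 2 = 5 / 4 * (k : ℝ) ^ 2 * Q⁻¹ := Real.sq_sqrt (by positivity)
  have hτ : 0 ≤ τ := Real.sqrt_nonneg _
  have hcover : ∀ x, ∃ y ∈ (baseLattice P).restrictScalars ℤ, ‖x - y‖ ≤ τ :=
    hmem τ hτ (by rw [hτ2]; linarith)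
  have hbig : MeasureTheory.volume.real (Metric.closedBall (0 : MinkowskiPlane K) (r + τ)) ≤ m := by
    rw [hvol (by positivity)]
    calc ((r + τ) ^ 2) ^ k * (Real.pi ^ k / k.factorial)
        ≤ (r ^ 2) ^ k * Real.exp (2 * k * τ / r) * (Real.pi ^ k / k.factorial) := by
          gcongr; exact sq_add_pow_le hr hτ
      _ = T * Real.exp (2 * k * τ / r) := by rw [← hrT]; ring
      _ ≤ T * Real.exp (√(45 * (k : ℝ) ^ 3 / Q)) := by
          gcongr
          refine Real.le_sqrt_of_sq_le ?_
          rw [div_pow, mul_pow, hτ2, div_le_div_iff₀ (by positivity) hQ]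
          calc (2 * (k : ℝ)) ^ 2 * (5 / 4 * (k : ℝ) ^ 2 * Q⁻¹) * Q = 45 * (k : ℝ) ^ 3 * (k / 9) := by
                field_simp; ring
            _ ≤ _ := by gcongr
      _ ≤ m := hTm
  have hζ := (IsCyclotomicExtension.zeta_spec m ℚ K).toInteger_isPrimitiveRoot
  obtain ⟨C, hC, hCr⟩ := exists_codeLattice_of_card_lt (P := P) (r := r) hm hζ hP hP0 (by
      intro a ha b hb hab
      by_contra! hlt
      have h1 := hshort a b ha hb hab
      rw [div_le_iff₀ (by linarith)] at h1
      -- A nonzero vector of PΛ₀ shorter than r would give q ≤ (r²/k)^k |d|. Since |d| ≤ m^k and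
      -- r²/k < 4k², the right side is below (4k²m)^k < Q^k = q.
      have h2 : q < q := by
        calc q ≤ (‖planeMap (scalingFactor P) (a, b)‖ ^ 2 / k) ^ k * |(discr K : ℝ)| := h1
          _ ≤ (r ^ 2 / k) ^ k * (m : ℝ) ^ k := by gcongr
          _ = (r ^ 2 / k * m) ^ k := by rw [mul_pow]
          _ < Q ^ k := by
              refine pow_lt_pow_left₀ (lt_trans ?_ hq) (by positivity) hk0
              have hm' : (0 : ℝ) < m := by exact_mod_cast hm
              gcongr
              rw [div_lt_iff₀ hk1]
              linarith
          _ = q := hQk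
      exact lt_irrefl _ h2) (by
      intro X hX
      have := discreteTopology_baseLattice (K := K) hP0
      have : IsZLattice ℝ ((baseLattice P).restrictScalars ℤ) := ⟨span_baseLattice hP0⟩
      have h1 := card_mul_covolume_le _ hcover X hX
      rw [covolume_baseLattice hP hP0, ← hqdef, ← div_eq_mul_inv] at h1
      have h2 := (div_le_iff₀ hq0).mp (h1.trans hbig)
      -- The count qm falls short of (q + 1)m by a full orbit.
      have h3 : X.card ≤ m * Nat.card (𝓞 K ⧸ P) := by
        rw [hqdef] at h2
        exact_mod_cast h2
      nlinarith)
  refine ⟨codeLattice P C, ⟨C, hC, rfl⟩, isSymplecticLattice_codeLattice hP hP0 hC, ?_⟩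
  have h1 := packingDensity_ge_of_covolume_eq_one (codeLattice P C) (span_codeLattice hP0 C)
    (covolume_codeLattice hP hP0 hC) hCr
  rwa [hvol hr.le, hrT, hdim] at h1

end Cyclotomic

/-! ### Existence of admissible primes and numerical estimates -/

section PrimeChoices

open Filter Asymptotics

theorem le_card_quotient_of_liesOver {K : Type*} [Field K] [NumberField K] {P : Ideal (𝓞 K)}
    (hP : P ≠ ⊤) {p : ℕ} (hp : p.Prime) [P.LiesOver (Ideal.span {(p : ℤ)})] :
    p ≤ Nat.card (𝓞 K ⧸ P) := by
  have h := Ideal.absNorm_eq_pow_inertiaDeg' P hp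
  change Nat.card (𝓞 K ⧸ P) = _ at h
  rw [h]
  refine Nat.le_self_pow (fun h0 => hP ?_) p
  rw [h0, pow_zero] at h
  exact Ideal.absNorm_eq_one_iff.mp h

theorem isMaximal_of_liesOver {K : Type*} [Field K] [NumberField K] {P : Ideal (𝓞 K)}
    (hP : P.IsPrime) {p : ℕ} (hp : p.Prime) (h : P.LiesOver (Ideal.span {(p : ℤ)})) :
    P.IsMaximal ∧ P ≠ ⊥ := by
  have h0 : P ≠ ⊥ := Ideal.ne_bot_of_liesOver_of_ne_bot (p := Ideal.span {(p : ℤ)})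
    (by simpa [Ideal.span_singleton_eq_bot] using hp.ne_zero) P
  exact ⟨hP.isMaximal h0, h0⟩

theorem exists_isAdmissiblePrimeChoice :
    ∃ P : (m : ℕ+) → Ideal (𝓞 (CyclotomicField (m : ℕ) ℚ)), IsAdmissiblePrimeChoice P := by
  have hex : ∀ m : ℕ+, ∃ P : Ideal (𝓞 (CyclotomicField (m : ℕ) ℚ)), (P.IsPrime ∧
      ∃ p : ℕ, p.Prime ∧ ¬ p ∣ (m : ℕ) ∧ P.LiesOver (Ideal.span {(p : ℤ)})) ∧
      ((m : ℕ) : ℝ) ^ (4 * (m : ℕ)) ≤ Nat.card (𝓞 (CyclotomicField (m : ℕ) ℚ) ⧸ P) := by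
    intro m
    -- A prime p > m cannot divide m. As q ≥ p ≥ m^{4m} and φ(m) ≤ m, the root q^{1/φ(m)} is at
    -- least m⁴, which dominates φ(m)²m ≤ m³.
    obtain ⟨p, hmp, hp⟩ := Nat.exists_infinite_primes ((m : ℕ) + 1 + (m : ℕ) ^ (4 * (m : ℕ)))
    have hmax : (Ideal.span {(p : ℤ)}).IsMaximal :=
      ((Ideal.span_singleton_prime (by exact_mod_cast hp.ne_zero)).mpr
        (Nat.prime_iff_prime_int.mp hp)).isMaximal
        (by simpa [Ideal.span_singleton_eq_bot] using hp.ne_zero)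
    obtain ⟨P, hP, hPp⟩ := Ideal.exists_maximal_ideal_liesOver_of_isIntegral
      (S := 𝓞 (CyclotomicField (m : ℕ) ℚ)) (Ideal.span {(p : ℤ)})
    refine ⟨P, ⟨hP.isPrime, p, hp, fun h => ?_, hPp⟩, ?_⟩
    · have := Nat.le_of_dvd m.pos h
      omega
    · have h1 := le_card_quotient_of_liesOver hP.ne_top hp
      have h2 : (m : ℕ) ^ (4 * (m : ℕ)) ≤ Nat.card (𝓞 (CyclotomicField (m : ℕ) ℚ) ⧸ P) := by omega
      exact_mod_cast h2
  choose P hP hcard using hex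
  refine ⟨P, hP, ?_⟩
  rw [isLittleO_iff]
  intro c hc
  have htop : Tendsto (fun m : ℕ+ => ((m : ℕ) : ℝ)) atTop atTop :=
    tendsto_natCast_atTop_atTop.comp tendsto_PNat_val_atTop_atTop
  filter_upwards [htop.eventually_ge_atTop c⁻¹] with m hm
  have hm1 : (1 : ℝ) ≤ (m : ℕ) := by exact_mod_cast m.pos
  have hφ : ((m : ℕ).totient : ℝ) ≤ (m : ℕ) := by exact_mod_cast Nat.totient_le _
  have hφ0 : (0 : ℝ) < (m : ℕ).totient := by exact_mod_cast Nat.totient_pos.mpr m.pos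
  rw [Real.norm_of_nonneg (by positivity), Real.norm_of_nonneg (by positivity)]
  have hQ : ((m : ℕ) : ℝ) ^ 4 ≤ (Nat.card (𝓞 (CyclotomicField (m : ℕ) ℚ) ⧸ P m) : ℝ) ^
      (1 / ((m : ℕ).totient : ℝ)) := by
    calc ((m : ℕ) : ℝ) ^ 4 = ((m : ℕ) : ℝ) ^ (4 : ℝ) := by norm_cast
      _ ≤ ((m : ℕ) : ℝ) ^ ((4 * (m : ℕ) : ℕ) * (1 / ((m : ℕ).totient : ℝ))) := by
          refine Real.rpow_le_rpow_of_exponent_le hm1 ?_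
          rw [mul_one_div, le_div_iff₀ hφ0]
          push_cast
          gcongr
      _ = (((m : ℕ) : ℝ) ^ (4 * (m : ℕ))) ^ (1 / ((m : ℕ).totient : ℝ)) := by
          rw [Real.rpow_mul (by positivity), Real.rpow_natCast]
      _ ≤ _ := Real.rpow_le_rpow (by positivity) (hcard m) (by positivity)
  calc ((m : ℕ).totient : ℝ) ^ 2 * (m : ℕ) ≤ ((m : ℕ) : ℝ) ^ 2 * (m : ℕ) := by gcongr
    _ ≤ (c * (m : ℕ)) * (((m : ℕ) : ℝ) ^ 2 * (m : ℕ)) :=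
        le_mul_of_one_le_left (by positivity) ((inv_le_iff_one_le_mul₀' hc).mp hm)
    _ = c * ((m : ℕ) : ℝ) ^ 4 := by ring
    _ ≤ _ := by gcongr

theorem one_le_log_log {x : ℝ} (hx : 32 ≤ x) : 1 ≤ Real.log (Real.log x) := by
  have h1 : Real.exp 1 ≤ Real.log x := by
    calc Real.exp 1 ≤ 5 * Real.log 2 := by linarith [Real.exp_one_lt_d9, Real.log_two_gt_d9]
      _ = Real.log 32 := by
          rw [show (32 : ℝ) = 2 ^ 5 by norm_num, Real.log_pow]
          norm_num
      _ ≤ Real.log x := Real.log_le_log (by norm_num) hx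
  rwa [Real.le_log_iff_exp_le ((Real.exp_pos 1).trans_le h1)]

theorem exp_sqrt_le {c : ℝ} (hc : c ≤ 1e-8) : 1.78 * Real.exp (√c) ≤ 1.7802 := by
  have h1 : √c ≤ 1e-4 := Real.sqrt_le_iff.mpr ⟨by norm_num, by norm_num; linarith⟩
  have h2 := Real.one_sub_le_exp_neg (√c)
  have h3 : Real.exp (√c) * Real.exp (-√c) = 1 := by rw [← Real.exp_add]; simp
  nlinarith [Real.exp_pos (√c)]

end PrimeChoices

/-! ### The corollary -/

theorem mainTheorem6 :
    (∃ P : (m : ℕ+) → Ideal (𝓞 (CyclotomicField (m : ℕ) ℚ)), IsAdmissiblePrimeChoice P) ∧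
    ∀ P : (m : ℕ+) → Ideal (𝓞 (CyclotomicField (m : ℕ) ℚ)), IsAdmissiblePrimeChoice P →
      {n : ℕ | ∃ m : ℕ+,
        Module.finrank ℝ (MinkowskiPlane (CyclotomicField (m : ℕ) ℚ)) = n ∧
        n = 2 * (m : ℕ).totient ∧
        ∃ L ∈ codeLatticeFamily (P m), IsSymplecticLattice L ∧
          packingDensity L ≥ 0.89 * n * Real.log (Real.log n) / 2 ^ n}.Infinite := by
  refine ⟨exists_isAdmissiblePrimeChoice, fun P ⟨hP, hlittle⟩ => ?_⟩
  -- With φ(m)²m ≤ 10⁻¹⁰ Q, where Q = q^{1/φ(m)}, one gets 45φ(m)³/Q ≤ 10⁻⁸. The volume loss is then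
  -- a factor at most e^{0.0001}, covered by the margin from 1.78 to 1.7802.
  obtain ⟨M, hM⟩ := Filter.eventually_atTop.mp
    (Asymptotics.isLittleO_iff.mp hlittle (show (0 : ℝ) < 1e-10 by norm_num))
  refine Set.infinite_of_forall_exists_gt fun a => ?_
  -- From φ(m) ≥ a + M + 16 follow n = 2φ(m) > a, m ≥ M, and n ≥ 32, hence log log n ≥ 1.
  obtain ⟨m₀, hm0, hB, hm⟩ := exists_totient_ratio (a + M + 16)
  obtain ⟨m, rfl⟩ : ∃ m : ℕ+, (m : ℕ) = m₀ := ⟨⟨m₀, hm0⟩, rfl⟩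
  have hm0' : NeZero ((m : ℕ) : ℚ) := ⟨by exact_mod_cast hm0.ne'⟩
  have hcyc : IsCyclotomicExtension {(m : ℕ)} ℚ (CyclotomicField (m : ℕ) ℚ) :=
    CyclotomicField.isCyclotomicExtension (m : ℕ) ℚ
  have hφm : (m : ℕ).totient ≤ m := Nat.totient_le _
  have hsmall := hM m (show (M : ℕ) ≤ m by omega)
  rw [Real.norm_of_nonneg (by positivity), Real.norm_of_nonneg (by positivity)] at hsmall
  obtain ⟨hPm, p, hp, -, hPp⟩ := hP m
  obtain ⟨hmax, hbot⟩ := isMaximal_of_liesOver hPm hp hPp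
  have hfin := Ideal.finiteQuotientOfFreeOfNeBot (P m) hbot
  have hQ : (0 : ℝ) < (Nat.card (𝓞 (CyclotomicField (m : ℕ) ℚ) ⧸ P m) : ℝ) ^
      (1 / ((m : ℕ).totient : ℝ)) :=
    Real.rpow_pos_of_pos (by exact_mod_cast Nat.card_pos) _
  have hφ : (16 : ℝ) ≤ (m : ℕ).totient := by exact_mod_cast (by omega : 16 ≤ (m : ℕ).totient)
  have hll := one_le_log_log (x := 2 * ((m : ℕ).totient : ℝ)) (by linarith)
  have hll' : Real.log (Real.log (2 * ((m : ℕ).totient : ℝ))) ≤ 2 * ((m : ℕ).totient : ℝ) :=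
    (Real.log_le_self (Real.log_nonneg (by linarith))).trans (Real.log_le_self (by positivity))
  have hφm' : ((m : ℕ).totient : ℝ) ≤ (m : ℕ) := by exact_mod_cast hφm
  refine ⟨2 * (m : ℕ).totient, ⟨m, ?_, rfl, ?_⟩, by omega⟩
  · rw [finrank_minkowskiPlane, IsCyclotomicExtension.Rat.finrank (m : ℕ)]
  push_cast
  set φ : ℝ := ((m : ℕ).totient : ℝ)
  set ℓ := Real.log (Real.log (2 * φ))
  -- With n = 2φ, T = 0.89 n log log n = 1.78 φℓ. The estimate ℓ ≤ 2φ keeps it below 4φ², and the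
  -- primorial bound gives T e^{0.0001} ≤ 1.7802 φℓ ≤ m.
  obtain ⟨L, hL, hLs, hLd⟩ := exists_symplectic_packingDensity_ge (m : ℕ) hmax hbot
    (T := 0.89 * (2 * φ) * ℓ) (by nlinarith) (by nlinarith) (by nlinarith) (by
      refine le_trans ?_ hm
      have h1 : 45 * φ ^ 3 / (Nat.card (𝓞 (CyclotomicField (m : ℕ) ℚ) ⧸ P m) : ℝ) ^ (1 / φ) ≤
          1e-8 := by
        rw [div_le_iff₀ hQ]
        have : φ ^ 3 ≤ φ ^ 2 * (m : ℕ) := by rw [pow_succ]; gcongr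
        linarith
      calc _ = φ * ℓ * (1.78 * Real.exp (√(45 * φ ^ 3 /
            (Nat.card (𝓞 (CyclotomicField (m : ℕ) ℚ) ⧸ P m) : ℝ) ^ (1 / φ)))) := by ring
        _ ≤ φ * ℓ * 1.7802 := by
            gcongr
            exact exp_sqrt_le h1
        _ = _ := by ring)
  exact ⟨L, hL, hLs, hLd⟩
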